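/- Let $d\ge 1$ be an integer and $0<\alpha<1$. Let $\mathbb B$ be the regular $d$-ary tree with root $0$, let $|x|$ be the generation of the vertex $x$, and write $y\ge x$ if $y$ is $x$ or a descendant of $x$. Let $(U_x)_{x\in\mathbb B}$ be independent exponential random variables with mean one. Put $$T(x)=\sum_{y\le x}\alpha^{|y|}U_y ,\qquad T(\infty)=\lim_{n\to\infty}\inf\{t:\#\{x:T(x)\le t\}\ge n\},\qquad T(x,\infty)=\lim_{n\to\infty}\ \min_{y\ge x,\ |y|=n}\bigl(T(y)-T(x)\bigr).$$ Almost surely the cluster $A_\infty=\{x:T(x)<T(\infty)\}$ contains a unique infinite line of descent $0=X_0,X_1,X_2,\dots$ with $|X_n|=n$. Let $W_n=\alpha^{-n-1}T(X_n,\infty)$ for $n\ge 0$, and let $F$ be the law of $W_0$. Let $\Lambda$ be the tilted law $\Lambda(A)=E(e^{\alpha W_0};W_0\in A)/E(e^{\alpha W_0})$ on $(0,\infty)$, write $\Lambda(t)=\Lambda((0,t))$, and let $p$ be the Markov kernel $p(\cdot\,|\,w)=\Lambda(\cdot\,|\,(0,w/\alpha))$, $w>0$. Let $P_\mu$ denote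 the law of the Markov chain on $(0,\infty)$ with initial law $\mu$ and transition kernel $p$. Let $\bar p$ be the following Markov kernel on $(0,\infty)^2$. If $w_1\ge w_2$, then, given $(w_1,w_2)$, with probability $\Lambda(w_2/\alpha)/\Lambda(w_1/\alpha)$ both coordinates move to the same point, which has law $\Lambda(\cdot\,|\,(0,w_2/\alpha))$, and otherwise they move independently, the first one with law $\Lambda(\cdot\,|\,[w_2/\alpha,w_1/\alpha))$ and the second one with law $\Lambda(\cdot\,|\,(0,w_2/\alpha))$. If $w_2>w_1$, the same holds with the roles of the two coordinates exchanged. Let $P_{w_1,w_2}$ (respectively $P_\mu$, for a law $\mu$ on $(0,\infty)^2$) be the law of the Markov chain $(W^1_n,W^2_n)_{n\ge0}$ with kernel $\bar p$ started at $(w_1,w_2)$ (respectively with initial law $\mu$). For two sequences of random variables, $\tau_{\rm couple}\in\{0,1,2,\dots\}\cup\{\infty\}$ denotes the first $n$ at which they are equal. Then the following hold. (1) For every $\theta>0$ there are $c,\lambda>0$ such that, for all $n\ge0$ and all $w_1,w_2>0$, $$P_{w_1,w_2}(\tau_{\rm couple}>n)\le c\,\bigl((w_1\wedge w_2)^{-\theta}+1\bigr)e^{-\lambda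 n}.$$ Moreover $\tau_{\rm couple}<\infty$ $P_\mu$-almost surely, for every law $\mu$ on $(0,\infty)^2$. (2) There is exactly one stationary probability law $\pi$ on $(0,\infty)$ for the kernel $p$, and there are constants $c,\lambda>0$ such that: (a) there are processes $(W_n)_{n\ge0}$ with law $P_F$ and $(\overline W_n)_{n\ge0}$ with law $P_\pi$, defined on the same probability space, such that almost surely $W_n\ge\overline W_n$ for all $n$ and $W_n=\overline W_n$ for all $n\ge\tau_{\rm couple}=\min\{n:W_n=\overline W_n\}$, and such that $P(\tau_{\rm couple}>n)\le c\,e^{-\lambda n}$ for all $n\ge0$; (b) for the backbone times $W_n=\alpha^{-n-1}T(X_n,\infty)$ of the percolation model, $|\mathcal L(W_n)-\pi|\le 2c\,e^{-\lambda n}$ for all $n\ge0$, where $|\cdot|$ is the total variation norm of a signed measure (total mass of its variation measure). -/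

import Mathlib

open MeasureTheory ProbabilityTheory Set
open scoped ENNReal

/-! ### First-passage percolation on the regular `d`-ary tree

A vertex of the regular `d`-ary tree is a finite word over `Fin d`: the root is `[]`, the children
of `x` are the words `x ++ [i]`, the generation of `x` is `x.length`, the ancestors of `x` are its
prefixes `x.take k`, and `x <+: y` says that `y` is a descendant of `x` (or `x` itself).
A configuration `U` assigns a real number to each vertex. -/

instance expMeasure_one_isProbabilityMeasure : IsProbabilityMeasure (expMeasure 1) :=
  isProbabilityMeasure_expMeasure one_pos

/-- The law of a family of independent exponential variables of mean one, indexed by the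
vertices. -/
noncomputable def percLaw (d : ℕ) : Measure (List (Fin d) → ℝ) :=
  Measure.infinitePi fun _ => expMeasure 1

instance percLaw_isProbabilityMeasure (d : ℕ) : IsProbabilityMeasure (percLaw d) := by
  unfold percLaw; infer_instance

/-- `T(x) = ∑_{y ≤ x} α ^ |y| U_y`, the time at which the vertex `x` gets wet. -/
noncomputable def hitTime {d : ℕ} (α : ℝ) (U : List (Fin d) → ℝ) (x : List (Fin d)) : ℝ≥0∞ :=
  ∑ k ∈ Finset.range (x.length + 1), ENNReal.ofReal (α ^ k * U (x.take k))

/-- `C(t)`, the set of vertices that are wet at time `t`. -/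
def wetSet {d : ℕ} (α : ℝ) (U : List (Fin d) → ℝ) (t : ℝ≥0∞) : Set (List (Fin d)) :=
  {x | hitTime α U x ≤ t}

/-- The time at which the wet set has reached `n` vertices. (Almost surely the vertices get wet at
distinct times, so that this is the first time at which there are exactly `n` wet vertices.) -/
noncomputable def growTime {d : ℕ} (α : ℝ) (U : List (Fin d) → ℝ) (n : ℕ) : ℝ≥0∞ :=
  sInf {t | (n : ℕ∞) ≤ (wetSet α U t).encard}

/-- `T(∞)`, the limit of the nondecreasing sequence `growTime`. -/
noncomputable def explosionTime {d : ℕ} (α : ℝ) (U : List (Fin d) → ℝ) : ℝ≥0∞ :=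
  ⨆ n, growTime α U n

/-- `A_∞`, the infinite cluster: the vertices that are wet strictly before time `T(∞)`. -/
def infiniteCluster {d : ℕ} (α : ℝ) (U : List (Fin d) → ℝ) : Set (List (Fin d)) :=
  {x | hitTime α U x < explosionTime α U}

/-- `T(x, ∞)`, the limit as `n → ∞` of the minimum of `T(y) - T(x)` over the descendants `y` of `x`
that lie `n` generations below `x`. These minima are nondecreasing in `n`. -/
noncomputable def timeToInfinity {d : ℕ} (α : ℝ) (U : List (Fin d) → ℝ) (x : List (Fin d)) :
    ℝ≥0∞ :=
  ⨆ n : ℕ, ⨅ y ∈ {y : List (Fin d) | x <+: y ∧ y.length = x.length + n},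
    (hitTime α U y - hitTime α U x)

/-- An infinite line of descent `r` from the root, the vertex in generation `n` being
`(r 0, …, r (n - 1))`, all of whose vertices belong to the infinite cluster. -/
def IsLineOfDescent {d : ℕ} (α : ℝ) (U : List (Fin d) → ℝ) (r : ℕ → Fin d) : Prop :=
  ∀ n : ℕ, List.ofFn (fun i : Fin n => r i) ∈ infiniteCluster α U

open Classical in
/-- The backbone: its vertex in generation `n` is the vertex in generation `n` of the almost surely
unique infinite line of descent in the infinite cluster. (The value on the null event on which
there is no such unique line is irrelevant.) -/
noncomputable def backbone {d : ℕ} (α : ℝ) (U : List (Fin d) → ℝ) (n : ℕ) : List (Fin d) :=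
  if h : ∃! r : ℕ → Fin d, IsLineOfDescent α U r then
    List.ofFn (fun i : Fin n => h.choose i)
  else []

/-- `W_n`, the rescaled time `T(X_n, ∞) α ^ (-n - 1)` to percolate to infinity from the vertex
`X_n` of the backbone in generation `n`. -/
noncomputable def backboneTime {d : ℕ} (α : ℝ) (n : ℕ) (U : List (Fin d) → ℝ) : ℝ :=
  (timeToInfinity α U (backbone α U n)).toReal / α ^ (n + 1)

/-- `F`, the law of `W_0`. -/
noncomputable def initialLaw (d : ℕ) (α : ℝ) : Measure ℝ :=
  (percLaw d).map (backboneTime α 0)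

/-- `Λ(A) = E(e^{α W_0} ; W_0 ∈ A) / E(e^{α W_0})`. -/
noncomputable def tiltedLaw (d : ℕ) (α : ℝ) : Measure ℝ :=
  (initialLaw d α).tilted fun w => α * w

instance tiltedLaw_isFiniteMeasure (d : ℕ) (α : ℝ) : IsFiniteMeasure (tiltedLaw d α) := by
  unfold tiltedLaw; infer_instance

/-! ### The transition kernels -/

section Kernels

/-- `Λ(·| [a, b))` as a kernel in `(a, b)`. It is the zero measure if `Λ` does not charge
`[a, b)`. -/
noncomputable def condIco (Λ : Measure ℝ) [IsFiniteMeasure Λ] : Kernel (ℝ × ℝ) ℝ where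
  toFun v := Λ[|Ico v.1 v.2]
  measurable' := by
    have key : ∀ s : Set ℝ, MeasurableSet s →
        Measurable fun v : ℝ × ℝ => Λ (Ico v.1 v.2 ∩ s) := by
      intro s hs
      have hm : MeasurableSet {q : (ℝ × ℝ) × ℝ | (q.1.1 ≤ q.2 ∧ q.2 < q.1.2) ∧ q.2 ∈ s} := by
        have h₁ : Measurable fun q : (ℝ × ℝ) × ℝ => q.1.1 := by fun_prop
        have h₂ : Measurable fun q : (ℝ × ℝ) × ℝ => q.1.2 := by fun_prop
        exact ((measurableSet_le h₁ measurable_snd).inter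
          (measurableSet_lt measurable_snd h₂)).inter (measurable_snd hs)
      exact measurable_measure_prodMk_left (ν := Λ) hm
    refine Measure.measurable_of_measurable_coe _ fun s hs => ?_
    simp only [cond_apply measurableSet_Ico]
    have h1 := key univ MeasurableSet.univ
    simp only [inter_univ] at h1
    exact h1.inv.mul (key s hs)

/-- `Λ(·| (0, a))` as a kernel in `a`. It is the zero measure if `Λ` does not charge `(0, a)`. -/
noncomputable def condBelow (Λ : Measure ℝ) [IsFiniteMeasure Λ] : Kernel ℝ ℝ where
  toFun a := Λ[|Ioo 0 a]
  measurable' := by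
    have key : ∀ s : Set ℝ, Measurable fun a : ℝ => Λ (Ioo 0 a ∩ s) := fun s =>
      Monotone.measurable fun a b hab =>
        measure_mono (inter_subset_inter_left _ (Ioo_subset_Ioo_right hab))
    refine Measure.measurable_of_measurable_coe _ fun s hs => ?_
    simp only [cond_apply measurableSet_Ioo]
    have h1 := key univ
    simp only [inter_univ] at h1
    exact h1.inv.mul (key s)

instance (Λ : Measure ℝ) [IsFiniteMeasure Λ] : IsFiniteKernel (condIco Λ) :=
  ⟨1, ENNReal.one_lt_top, fun v => by
    have : IsZeroOrProbabilityMeasure (condIco Λ v) :=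
      inferInstanceAs (IsZeroOrProbabilityMeasure (Λ[|Ico v.1 v.2]))
    exact prob_le_one⟩

instance (Λ : Measure ℝ) [IsFiniteMeasure Λ] : IsFiniteKernel (condBelow Λ) :=
  ⟨1, ENNReal.one_lt_top, fun a => by
    have : IsZeroOrProbabilityMeasure (condBelow Λ a) :=
      inferInstanceAs (IsZeroOrProbabilityMeasure (Λ[|Ioo 0 a]))
    exact prob_le_one⟩

theorem measurable_measure_Ioo_div (Λ : Measure ℝ) (α : ℝ) :
    Measurable fun w : ℝ => Λ (Ioo 0 (w / α)) :=
  (Monotone.measurable (f := fun a : ℝ => Λ (Ioo 0 a)) fun _ _ hab =>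
    measure_mono (Ioo_subset_Ioo_right hab)).comp (measurable_id.div_const α)

/-- The points `w` with `Λ((0, w / α)) > 0`. -/
def chargedSet (Λ : Measure ℝ) (α : ℝ) : Set ℝ := {w | Λ (Ioo 0 (w / α)) ≠ 0}

theorem measurableSet_chargedSet (Λ : Measure ℝ) (α : ℝ) : MeasurableSet (chargedSet Λ α) :=
  (measurable_measure_Ioo_div Λ α) (measurableSet_singleton 0).compl

open Classical in
/-- The transition kernel `p(·| w) = Λ(·| (0, w / α))` for `w > 0`. The state space is `(0, ∞)`.
To have a kernel on `ℝ`, every `w` with `Λ((0, w / α)) = 0`, in particular every `w ≤ 0`, is made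
absorbing; for the tilted law `Λ` of the percolation model and `w > 0` that does not occur. -/
noncomputable def stepKernel (Λ : Measure ℝ) [IsFiniteMeasure Λ] (α : ℝ) : Kernel ℝ ℝ :=
  Kernel.piecewise (measurableSet_chargedSet Λ α)
    ((condBelow Λ).comap (fun w => w / α) (measurable_id.div_const α)) Kernel.id

instance (Λ : Measure ℝ) [IsFiniteMeasure Λ] (α : ℝ) : IsMarkovKernel (stepKernel Λ α) := by
  classical
  refine ⟨fun w => ?_⟩
  unfold stepKernel
  rw [Kernel.piecewise_apply]
  split_ifs with h
  · exact cond_isProbabilityMeasure h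
  · infer_instance

/-- `Λ((0, w₂ / α)) / Λ((0, w₁ / α))`. -/
noncomputable def jumpRatio (Λ : Measure ℝ) (α : ℝ) (w : ℝ × ℝ) : ℝ≥0∞ :=
  Λ (Ioo 0 (w.2 / α)) / Λ (Ioo 0 (w.1 / α))

theorem measurable_jumpRatio (Λ : Measure ℝ) (α : ℝ) : Measurable (jumpRatio Λ α) :=
  ((measurable_measure_Ioo_div Λ α).comp measurable_snd).div
    ((measurable_measure_Ioo_div Λ α).comp measurable_fst)

/-- The joint transition kernel for `w₁ ≥ w₂ > 0`: with probability
`Λ((0, w₂ / α)) / Λ((0, w₁ / α))` both coordinates jump to the same point, chosen from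
`Λ(·| (0, w₂ / α))`; otherwise they jump independently, the first one according to
`Λ(·| [w₂ / α, w₁ / α))` and the second one according to `Λ(·| (0, w₂ / α))`. -/
noncomputable def orderedPairKernel (Λ : Measure ℝ) [IsFiniteMeasure Λ] (α : ℝ) :
    Kernel (ℝ × ℝ) (ℝ × ℝ) where
  toFun w :=
    jumpRatio Λ α w • (Λ[|Ioo 0 (w.2 / α)]).map (fun x => (x, x)) +
      (1 - jumpRatio Λ α w) •
        (Λ[|Ico (w.2 / α) (w.1 / α)]).prod (Λ[|Ioo 0 (w.2 / α)])
  measurable' := by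
    have hr := measurable_jumpRatio Λ α
    let K₁ : Kernel (ℝ × ℝ) ℝ := (condBelow Λ).comap (fun w : ℝ × ℝ => w.2 / α) (by fun_prop)
    let K₂ : Kernel (ℝ × ℝ) ℝ :=
      (condIco Λ).comap (fun w : ℝ × ℝ => (w.2 / α, w.1 / α)) (by fun_prop)
    refine Measure.measurable_of_measurable_coe _ fun s hs => ?_
    have e1 : Measurable fun w => (K₁.map (fun x : ℝ => (x, x))) w s :=
      Kernel.measurable_coe _ hs
    have e2 : Measurable fun w => (Kernel.prod K₂ K₁) w s := Kernel.measurable_coe _ hs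
    have hd : Measurable fun x : ℝ => (x, x) := by fun_prop
    simp only [Kernel.map_apply _ hd] at e1
    simp only [Kernel.prod_apply] at e2
    exact (hr.mul e1).add ((measurable_const.sub hr).mul e2)

theorem orderedPairKernel_isProbabilityMeasure (Λ : Measure ℝ) [IsFiniteMeasure Λ] {α : ℝ}
    {w : ℝ × ℝ} (h₁ : w.1 ∈ chargedSet Λ α) (h₂ : w.2 ∈ chargedSet Λ α)
    (h : w.2 / α ≤ w.1 / α) : IsProbabilityMeasure (orderedPairKernel Λ α w) := by
  have hp : IsProbabilityMeasure (Λ[|Ioo 0 (w.2 / α)]) := cond_isProbabilityMeasure h₂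
  refine ⟨?_⟩
  change (jumpRatio Λ α w • (Λ[|Ioo 0 (w.2 / α)]).map (fun x => (x, x)) +
      (1 - jumpRatio Λ α w) •
        (Λ[|Ico (w.2 / α) (w.1 / α)]).prod (Λ[|Ioo 0 (w.2 / α)])) univ = 1
  have hmap : ((Λ[|Ioo 0 (w.2 / α)]).map (fun x => (x, x))) univ = 1 := by
    have hd : Measurable fun x : ℝ => (x, x) := by fun_prop
    rw [Measure.map_apply hd MeasurableSet.univ]
    simp
  have hle : jumpRatio Λ α w ≤ 1 :=
    ENNReal.div_le_of_le_mul (by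
      rw [one_mul]; exact measure_mono (Ioo_subset_Ioo_right h))
  rw [Measure.add_apply, Measure.smul_apply, Measure.smul_apply, hmap, smul_eq_mul, smul_eq_mul,
    mul_one]
  by_cases hI : Λ (Ico (w.2 / α) (w.1 / α)) = 0
  · have hge : 1 ≤ jumpRatio Λ α w := by
      have hsub : Λ (Ioo 0 (w.1 / α)) ≤ Λ (Ioo 0 (w.2 / α)) := by
        calc Λ (Ioo 0 (w.1 / α))
            ≤ Λ (Ioo 0 (w.2 / α) ∪ Ico (w.2 / α) (w.1 / α)) := by
              refine measure_mono fun x hx => ?_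
              rcases lt_or_ge x (w.2 / α) with hlt | hge
              · exact Or.inl ⟨hx.1, hlt⟩
              · exact Or.inr ⟨hge, hx.2⟩
          _ ≤ Λ (Ioo 0 (w.2 / α)) + Λ (Ico (w.2 / α) (w.1 / α)) := measure_union_le _ _
          _ = Λ (Ioo 0 (w.2 / α)) := by rw [hI, add_zero]
      unfold jumpRatio
      rw [ENNReal.le_div_iff_mul_le (Or.inl h₁) (Or.inl (measure_ne_top _ _)), one_mul]
      exact hsub
    rw [le_antisymm hle hge]
    simp
  · have hq : IsProbabilityMeasure (Λ[|Ico (w.2 / α) (w.1 / α)]) := cond_isProbabilityMeasure hI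
    rw [measure_univ, mul_one, add_tsub_cancel_of_le hle]

/-- The pairs `(w₁, w₂)` with `Λ((0, w₁ / α)) > 0` and `Λ((0, w₂ / α)) > 0`. -/
def chargedPairs (Λ : Measure ℝ) (α : ℝ) : Set (ℝ × ℝ) := chargedSet Λ α ×ˢ chargedSet Λ α

theorem measurableSet_chargedPairs (Λ : Measure ℝ) (α : ℝ) : MeasurableSet (chargedPairs Λ α) :=
  (measurableSet_chargedSet Λ α).prod (measurableSet_chargedSet Λ α)

open Classical in
/-- The joint transition kernel on pairs: `orderedPairKernel` if `w₁ ≥ w₂`, and the kernel obtained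
from it by exchanging the coordinates if `w₂ > w₁` (the order of `w₁` and `w₂` is expressed as that
of `w₁ / α` and `w₂ / α`, which is the same for `α > 0`). The state space is `(0, ∞)²`; as for
`stepKernel`, the other pairs are made absorbing. -/
noncomputable def pairKernel (Λ : Measure ℝ) [IsFiniteMeasure Λ] (α : ℝ) :
    Kernel (ℝ × ℝ) (ℝ × ℝ) :=
  Kernel.piecewise (measurableSet_chargedPairs Λ α)
    (Kernel.piecewise (measurableSet_le (measurable_snd.div_const α)
        (measurable_fst.div_const α) : MeasurableSet {w : ℝ × ℝ | w.2 / α ≤ w.1 / α})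
      (orderedPairKernel Λ α)
      (((orderedPairKernel Λ α).comap Prod.swap measurable_swap).map Prod.swap))
    Kernel.id

instance (Λ : Measure ℝ) [IsFiniteMeasure Λ] (α : ℝ) : IsMarkovKernel (pairKernel Λ α) := by
  classical
  refine ⟨fun w => ?_⟩
  unfold pairKernel
  rw [Kernel.piecewise_apply]
  split_ifs with h
  · rw [Kernel.piecewise_apply]
    split_ifs with h'
    · exact orderedPairKernel_isProbabilityMeasure Λ h.1 h.2 h'
    · rw [Kernel.map_apply _ measurable_swap, Kernel.comap_apply]
      have hlt : w.1 / α < w.2 / α := not_le.mp h'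
      have : IsProbabilityMeasure (orderedPairKernel Λ α w.swap) :=
        orderedPairKernel_isProbabilityMeasure Λ (w := w.swap) h.2 h.1 hlt.le
      exact Measure.isProbabilityMeasure_map measurable_swap.aemeasurable
  · infer_instance

end Kernels

/-! ### Markov chains -/

/-- The law, on the space of trajectories, of the time-homogeneous Markov chain with initial law
`μ` and transition kernel `κ`. -/
noncomputable def chainLaw {S : Type*} [MeasurableSpace S] (κ : Kernel S S) [IsMarkovKernel κ]
    (μ : Measure S) : Measure (ℕ → S) :=
  Kernel.trajMeasure (X := fun _ => S) μ fun n =>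
    κ.comap (fun h : (Finset.Iic n) → S => h ⟨n, Finset.mem_Iic.mpr le_rfl⟩)
      (measurable_pi_apply _)

/-- The coupling time `min {n : x_n = y_n}` of two sequences, `⊤` if there is no such `n`. -/
noncomputable def couplingTime (x y : ℕ → ℝ) : ℕ∞ := ⨅ (k : ℕ) (_ : x k = y k), (k : ℕ∞)

/-- `p`, the transition kernel of the chain `(W_n)`. -/
noncomputable def backboneKernel (d : ℕ) (α : ℝ) : Kernel ℝ ℝ := stepKernel (tiltedLaw d α) α

instance (d : ℕ) (α : ℝ) : IsMarkovKernel (backboneKernel d α) := by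
  unfold backboneKernel; infer_instance

/-- The transition kernel of the coupled pair of chains; both its marginals are `p`. -/
noncomputable def backbonePairKernel (d : ℕ) (α : ℝ) : Kernel (ℝ × ℝ) (ℝ × ℝ) :=
  pairKernel (tiltedLaw d α) α

instance (d : ℕ) (α : ℝ) : IsMarkovKernel (backbonePairKernel d α) := by
  unfold backbonePairKernel; infer_instance

/-- `π` is a stationary law, on `(0, ∞)`, of the chain `(W_n)`. -/
structure IsStationaryLaw (d : ℕ) (α : ℝ) (π : Measure ℝ) : Prop where
  isProbabilityMeasure : IsProbabilityMeasure π
  measure_Iic : π (Iic 0) = 0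
  invariant : Kernel.Invariant (backboneKernel d α) π

/-! ### Markov chains -/

section MarkovChains

variable {S S' : Type*} [MeasurableSpace S] [MeasurableSpace S']

/-! Let V be the limiting time at which generation n first gets wet (`escapeTime`); it agrees with
the explosion time. V is the sum of the root variable and α W₀, the two being independent, and W₀ is
the minimum of the d independent copies of V attached to the children of the root. Since the root
variable is exponential, the pair (V, W₀) has density e^{-(v - αw)} on v > αw with respect to dv
F(dw). The factor e^{αw} is exactly the tilt, so that given V = v the law of W₀ is Λ(· | (0, v/α)) =
p(· | v). The law of the minimum has density d S(v)^{d-1} with respect to that of V, where S is the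
survival function of V. Hence Λ has a density a(x) Λ((0, x/α)) with a positive, nonincreasing and at
most d e^{-(1-α)x} (`isPantographLaw_tiltedLaw`). Almost surely the backbone always moves to the
child with the smallest escape time, and W₀ is the escape time of that child, while the next
backbone time is its own W₀. Repeating the conditional law above along the backbone gives the powers
of p (`map_backboneTime`).

The coupling estimates use only this form of Λ. Near 0 the mass that Λ gives to [βt, t) is at least
a fixed fraction of the mass of (0, βt), which pushes the chain away from 0: w^{-θ} contracts up to
an additive constant when θ ≤ 1/2 (`exists_drift`). From w₁ > w₂ the coupled pair fails to merge
with probability at most 1 - Λ((0, w₂/α)), which is bounded away from 1 unless w₂ is small. Merging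
handles the large values and drift the small ones, so min(w₁, w₂)^{-θ} + B, set to zero on the
diagonal, contracts geometrically in mean (`exists_contraction`, `exists_offDiag_decay`). Starting
laws without a moment at 0 are treated by dominated convergence (`tendsto_offDiag`), which also
yields uniqueness of the stationary law.

For existence, coupling F with its image under p shows that the laws F pⁿ are setwise Cauchy,
geometrically fast. They are all bounded by one multiple of Λ, because 1/Λ((0, w/α)) is a second
Lyapunov function (`exists_comp_pow_le`); this domination makes the setwise limit countably additive
and gives it a finite moment of order -1/2. Finally, F p has a nonincreasing density with respect to
F, so it is stochastically smaller (`initialLaw_Iic_le`). The coupled kernel preserves order, hence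
F dominates the limit π, and running the coupled kernel from a quantile coupling of F and π produces
the monotone processes and the total variation bound (`exists_monotone_coupling`). -/

instance chainLaw_isProbabilityMeasure (κ : Kernel S S) [IsMarkovKernel κ] (μ : Measure S)
    [IsProbabilityMeasure μ] : IsProbabilityMeasure (chainLaw κ μ) := by
  unfold chainLaw; infer_instance

/-- The last coordinate of a path of length `n`. -/
def lastCoord (n : ℕ) (h : Finset.Iic n → S) : S := h ⟨n, Finset.mem_Iic.mpr le_rfl⟩

theorem measurable_lastCoord (n : ℕ) : Measurable (lastCoord n : (Finset.Iic n → S) → S) :=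
  measurable_pi_apply _

theorem chainLaw_map_frestrictLe_succ (κ : Kernel S S) [IsMarkovKernel κ] (μ : Measure S)
    [IsProbabilityMeasure μ] (n : ℕ) :
    (chainLaw κ μ).map
        (fun x => (Preorder.frestrictLe (π := fun _ => S) n x, x (n + 1))) =
      (chainLaw κ μ).map (Preorder.frestrictLe (π := fun _ => S) n) ⊗ₘ
        κ.comap (lastCoord n) (measurable_lastCoord n) :=
  (Kernel.map_frestrictLe_trajMeasure_compProd_eq_map_trajMeasure (X := fun _ => S) (μ₀ := μ)
    (κ := fun n => κ.comap (lastCoord n) (measurable_lastCoord n)) (a := n)).symm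

theorem chainLaw_map_zero (κ : Kernel S S) [IsMarkovKernel κ] (μ : Measure S)
    [IsProbabilityMeasure μ] : (chainLaw κ μ).map (fun ω => ω 0) = μ := by
  have h : (chainLaw κ μ).map (Preorder.frestrictLe (π := fun _ => S) 0) =
      μ.map (MeasurableEquiv.piUnique fun _ : Finset.Iic 0 => S).symm := by
    unfold chainLaw Kernel.trajMeasure
    rw [Measure.map_comp _ _ (by fun_prop), Kernel.traj_map_frestrictLe_of_le le_rfl]
    exact Measure.id_comp
  have e : (fun ω : ℕ → S => ω 0) =
      (fun h : Finset.Iic 0 → S => h ⟨0, Finset.mem_Iic.mpr le_rfl⟩) ∘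
        Preorder.frestrictLe (π := fun _ => S) 0 := rfl
  rw [e, ← Measure.map_map (measurable_pi_apply _) (by fun_prop), h,
    Measure.map_map (measurable_pi_apply _) (MeasurableEquiv.measurable _)]
  exact Measure.map_id

/-- Cylinders over initial segments form a π-system that generates the product σ-algebra. -/
theorem measure_path_ext {ν ρ : Measure (ℕ → S)} [IsFiniteMeasure ν]
    (h : ∀ n, ν.map (Preorder.frestrictLe (π := fun _ => S) n) =
      ρ.map (Preorder.frestrictLe (π := fun _ => S) n)) : ν = ρ := by
  have huniv : ν univ = ρ univ := by
    have := congrArg (fun m => m univ) (h 0)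
    simpa [Measure.map_apply (Preorder.measurable_frestrictLe (X := fun _ => S) 0)] using this
  refine ext_of_generate_finite (measurableCylinders fun _ : ℕ => S)
    generateFrom_measurableCylinders.symm isPiSystem_measurableCylinders ?_ huniv
  intro t ht
  obtain ⟨N, A, hA, rfl⟩ : ∃ N A, MeasurableSet A ∧ t = cylinder (Finset.Iic N) A := by
    simpa [measurableCylinders_nat] using ht
  have := congrArg (fun m => m A) (h N)
  simp only [Measure.map_apply (Preorder.measurable_frestrictLe (X := fun _ => S) N) hA] at this
  exact this

/-- The recursion for initial segments determines all of them from the first. This is the tool that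
recognizes a process built from another chain as a chain. -/
theorem eq_chainLaw {κ : Kernel S S} [IsMarkovKernel κ] {μ : Measure S} [IsProbabilityMeasure μ]
    {ν : Measure (ℕ → S)} [IsProbabilityMeasure ν] (h₀ : ν.map (fun ω => ω 0) = μ)
    (hs : ∀ n, ν.map (fun x => (Preorder.frestrictLe (π := fun _ => S) n x, x (n + 1))) =
      ν.map (Preorder.frestrictLe (π := fun _ => S) n) ⊗ₘ
        κ.comap (lastCoord n) (measurable_lastCoord n)) : ν = chainLaw κ μ := by
  refine measure_path_ext fun n => ?_
  induction n with
  | zero =>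
    have e : Preorder.frestrictLe (π := fun _ => S) 0 =
        (fun (s : S) (_ : Finset.Iic 0) => s) ∘ fun ω : ℕ → S => ω 0 := by
      ext ω i
      have : (i : ℕ) = 0 := Nat.le_zero.mp (Finset.mem_Iic.mp i.2)
      simp [Preorder.frestrictLe, this]
    rw [e, ← Measure.map_map (by fun_prop) (by fun_prop),
      ← Measure.map_map (by fun_prop) (by fun_prop), h₀, chainLaw_map_zero]
  | succ n ih =>
    -- `g` appends one state to a path, so the segment up to n + 1 is an image of the pair in `hs`.
    let g : (Finset.Iic n → S) × S → (Finset.Iic (n + 1) → S) := fun q i =>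
      if hi : (i : ℕ) ≤ n then q.1 ⟨i, Finset.mem_Iic.mpr hi⟩ else q.2
    have hg : Measurable g := by
      refine measurable_pi_lambda _ fun i => ?_
      by_cases hi : (i : ℕ) ≤ n
      · simp only [g, hi, dite_true]; fun_prop
      · simp only [g, hi, dite_false]; fun_prop
    have e : Preorder.frestrictLe (π := fun _ => S) (n + 1) =
        g ∘ fun x => (Preorder.frestrictLe (π := fun _ => S) n x, x (n + 1)) := by
      ext ω i
      by_cases hi : (i : ℕ) ≤ n
      · simp [g, hi]
      · have : (i : ℕ) = n + 1 := by have := Finset.mem_Iic.mp i.2; omega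
        simp [g, this]
    rw [e, ← Measure.map_map hg (by fun_prop), ← Measure.map_map hg (by fun_prop), hs n,
      chainLaw_map_frestrictLe_succ, ih]

theorem chainLaw_map_pair (κ : Kernel S S) [IsMarkovKernel κ] (μ : Measure S)
    [IsProbabilityMeasure μ] (n : ℕ) :
    (chainLaw κ μ).map (fun ω => (ω n, ω (n + 1))) = (chainLaw κ μ).map (fun ω => ω n) ⊗ₘ κ := by
  have e : (fun ω : ℕ → S => (ω n, ω (n + 1))) =
      Prod.map (lastCoord n) id ∘
        fun x => (Preorder.frestrictLe (π := fun _ => S) n x, x (n + 1)) := rfl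
  have e' : (fun ω : ℕ → S => ω n) =
      lastCoord n ∘ Preorder.frestrictLe (π := fun _ => S) n := rfl
  have hl := measurable_lastCoord (S := S) n
  rw [e, ← Measure.map_map (by fun_prop) (by fun_prop), chainLaw_map_frestrictLe_succ, e',
    ← Measure.map_map hl (by fun_prop)]
  ext s hs
  rw [Measure.map_apply (by fun_prop) hs, Measure.compProd_apply ((hl.prodMap measurable_id) hs),
    Measure.compProd_apply hs,
    lintegral_map (Kernel.measurable_kernel_prodMk_left hs) hl]
  rfl

theorem chainLaw_map_eval (κ : Kernel S S) [IsMarkovKernel κ] (μ : Measure S)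
    [IsProbabilityMeasure μ] (n : ℕ) :
    (chainLaw κ μ).map (fun ω => ω n) = (κ ^ n) ∘ₘ μ := by
  induction n with
  | zero => rw [chainLaw_map_zero]; exact Measure.id_comp.symm
  | succ n ih =>
    have e : (fun ω : ℕ → S => ω (n + 1)) = Prod.snd ∘ fun ω : ℕ → S => (ω n, ω (n + 1)) := rfl
    rw [e, ← Measure.map_map (by fun_prop) (by fun_prop), chainLaw_map_pair]
    change ((chainLaw κ μ).map (fun ω => ω n) ⊗ₘ κ).snd = _
    rw [Measure.snd_compProd, ih, pow_succ', Measure.comp_assoc]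
    rfl

theorem comp_pow_succ (κ : Kernel S S) (μ : Measure S) (n : ℕ) :
    (κ ^ (n + 1)) ∘ₘ μ = κ ∘ₘ ((κ ^ n) ∘ₘ μ) := by
  rw [pow_succ', Measure.comp_assoc]; rfl

theorem comp_pow_zero (κ : Kernel S S) (μ : Measure S) : (κ ^ 0 : Kernel S S) ∘ₘ μ = μ := Measure.id_comp

instance isMarkovKernel_pow (κ : Kernel S S) [IsMarkovKernel κ] (n : ℕ) :
    IsMarkovKernel (κ ^ n) := by
  induction n with
  | zero => exact inferInstanceAs (IsMarkovKernel Kernel.id)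
  | succ n ih => rw [pow_succ']; exact inferInstanceAs (IsMarkovKernel (κ ∘ₖ (κ ^ n)))

variable {κ : Kernel S S} {μ : Measure S}

theorem ae_mem_comp_pow {A : Set S} (hA : MeasurableSet A)
    (hκ : ∀ w ∈ A, ∀ᵐ v ∂κ w, v ∈ A) (hμ : ∀ᵐ w ∂μ, w ∈ A) (n : ℕ) :
    ∀ᵐ w ∂((κ ^ n) ∘ₘ μ), w ∈ A := by
  induction n with
  | zero => rwa [comp_pow_zero]
  | succ n ih =>
    rw [comp_pow_succ]
    exact Measure.ae_comp_of_ae_ae hA (ih.mono hκ)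

theorem ae_chainLaw_forall_mem [IsMarkovKernel κ] [IsProbabilityMeasure μ] {A : Set S}
    (hA : MeasurableSet A) (hκ : ∀ w ∈ A, ∀ᵐ v ∂κ w, v ∈ A) (hμ : ∀ᵐ w ∂μ, w ∈ A) :
    ∀ᵐ ω ∂chainLaw κ μ, ∀ n, ω n ∈ A := by
  refine ae_all_iff.mpr fun n => ?_
  have := ae_mem_comp_pow hA hκ hμ n
  rw [← chainLaw_map_eval] at this
  exact ae_of_ae_map (measurable_pi_apply n).aemeasurable this

/-- Nothing is assumed on where the chain starts. With `D` the positive diagonal this says that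
chains that have met stay together. -/
theorem ae_chainLaw_forall_mem_succ [IsMarkovKernel κ] [IsProbabilityMeasure μ] {D : Set S}
    (hD : MeasurableSet D) (hκ : ∀ w ∈ D, ∀ᵐ v ∂κ w, v ∈ D) :
    ∀ᵐ ω ∂chainLaw κ μ, ∀ n, ω n ∈ D → ω (n + 1) ∈ D := by
  refine ae_all_iff.mpr fun n => ?_
  have hm : MeasurableSet {q : S × S | q.1 ∈ D → q.2 ∈ D} := by
    have : {q : S × S | q.1 ∈ D → q.2 ∈ D} = (Prod.fst ⁻¹' D)ᶜ ∪ Prod.snd ⁻¹' D := by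
      ext q; simp [imp_iff_not_or]
    rw [this]
    exact (measurable_fst hD).compl.union (measurable_snd hD)
  have h : ∀ᵐ q ∂((chainLaw κ μ).map (fun ω => ω n) ⊗ₘ κ), q.1 ∈ D → q.2 ∈ D := by
    refine Measure.ae_compProd_of_ae_ae hm (Filter.Eventually.of_forall fun w => ?_)
    by_cases hw : w ∈ D
    · filter_upwards [hκ w hw] with v hv _ using hv
    · exact Filter.Eventually.of_forall fun v h => absurd h hw
  rw [← chainLaw_map_pair] at h
  exact ae_of_ae_map (by fun_prop) h

/-- Iterated Lyapunov inequality. The one-step bound is needed only on an absorbing set that carries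
the initial law. -/
theorem lintegral_comp_pow_le {A : Set S} (hA : MeasurableSet A)
    (hκ : ∀ w ∈ A, ∀ᵐ v ∂κ w, v ∈ A) (hμ : ∀ᵐ w ∂μ, w ∈ A) {Φ : S → ℝ≥0∞} (hΦ : Measurable Φ)
    {k : ℝ≥0∞} (hk : ∀ w ∈ A, ∫⁻ v, Φ v ∂κ w ≤ k * Φ w) (n : ℕ) :
    ∫⁻ w, Φ w ∂((κ ^ n) ∘ₘ μ) ≤ k ^ n * ∫⁻ w, Φ w ∂μ := by
  induction n with
  | zero => rw [comp_pow_zero]; simp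
  | succ n ih =>
    rw [comp_pow_succ, Measure.lintegral_bind (Kernel.measurable _).aemeasurable hΦ.aemeasurable]
    calc ∫⁻ w, ∫⁻ v, Φ v ∂κ w ∂((κ ^ n) ∘ₘ μ)
        ≤ ∫⁻ w, k * Φ w ∂((κ ^ n) ∘ₘ μ) :=
          lintegral_mono_ae ((ae_mem_comp_pow hA hκ hμ n).mono hk)
      _ = k * ∫⁻ w, Φ w ∂((κ ^ n) ∘ₘ μ) := lintegral_const_mul _ hΦ
      _ ≤ k ^ (n + 1) * ∫⁻ w, Φ w ∂μ := by
          rw [pow_succ', mul_assoc]; gcongr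

/-- Lumping: if `f` intertwines the kernels on an absorbing set that carries the initial law, the
image of the chain is again a chain. It is applied to the two projections of the coupled pair. -/
theorem chainLaw_map_comp [IsMarkovKernel κ] [IsProbabilityMeasure μ] {κ' : Kernel S' S'}
    [IsMarkovKernel κ'] {f : S → S'} (hf : Measurable f) {A : Set S} (hA : MeasurableSet A)
    (hκ : ∀ w ∈ A, ∀ᵐ v ∂κ w, v ∈ A) (hμ : ∀ᵐ w ∂μ, w ∈ A)
    (h : ∀ w ∈ A, (κ w).map f = κ' (f w)) :
    (chainLaw κ μ).map (fun ω n => f (ω n)) = chainLaw κ' (μ.map f) := by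
  have hF : Measurable fun (ω : ℕ → S) (n : ℕ) => f (ω n) := by fun_prop
  have hp : IsProbabilityMeasure (μ.map f) := Measure.isProbabilityMeasure_map hf.aemeasurable
  have hp' : IsProbabilityMeasure ((chainLaw κ μ).map fun ω n => f (ω n)) :=
    Measure.isProbabilityMeasure_map hF.aemeasurable
  refine eq_chainLaw ?_ fun n => ?_
  · rw [Measure.map_map (by fun_prop) hF]
    have e : (fun ω : ℕ → S' => ω 0) ∘ (fun (ω : ℕ → S) n => f (ω n)) =
        f ∘ fun ω : ℕ → S => ω 0 := rfl
    rw [e, ← Measure.map_map hf (by fun_prop), chainLaw_map_zero]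
  · have hl := measurable_lastCoord (S := S) n
    let F : (Finset.Iic n → S) → (Finset.Iic n → S') := fun h i => f (h i)
    have hFm : Measurable F := by fun_prop
    rw [Measure.map_map (by fun_prop) hF, Measure.map_map (by fun_prop) hF]
    have e : (fun x : ℕ → S' => (Preorder.frestrictLe (π := fun _ => S') n x, x (n + 1))) ∘
        (fun (ω : ℕ → S) n => f (ω n)) = Prod.map F f ∘
          fun x => (Preorder.frestrictLe (π := fun _ => S) n x, x (n + 1)) := rfl
    have e' : Preorder.frestrictLe (π := fun _ => S') n ∘ (fun (ω : ℕ → S) n => f (ω n)) =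
        F ∘ Preorder.frestrictLe (π := fun _ => S) n := rfl
    rw [e, e', ← Measure.map_map (by fun_prop) (by fun_prop), chainLaw_map_frestrictLe_succ,
      ← Measure.map_map hFm (by fun_prop)]
    ext s hs
    rw [Measure.map_apply (by fun_prop) hs, Measure.compProd_apply ((hFm.prodMap hf) hs),
      Measure.compProd_apply hs, lintegral_map (Kernel.measurable_kernel_prodMk_left hs) hFm]
    refine lintegral_congr_ae ?_
    have hmem : ∀ᵐ x ∂(chainLaw κ μ).map (Preorder.frestrictLe (π := fun _ => S) n),
        lastCoord n x ∈ A := by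
      refine (ae_map_iff (by fun_prop) (hl hA)).mpr ?_
      exact (ae_chainLaw_forall_mem hA hκ hμ).mono fun ω hω => hω n
    filter_upwards [hmem] with x hx
    have h1 := h _ hx
    have hs' : MeasurableSet (Prod.mk (F x) ⁻¹' s) := measurable_prodMk_left hs
    calc (κ (lastCoord n x)) (Prod.mk x ⁻¹' (Prod.map F f ⁻¹' s))
        = ((κ (lastCoord n x)).map f) (Prod.mk (F x) ⁻¹' s) := by
          rw [Measure.map_apply hf hs']; rfl
      _ = (κ' (f (lastCoord n x))) (Prod.mk (F x) ⁻¹' s) := by rw [h1]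

end MarkovChains

theorem couplingTime_lt_imp {x y : ℕ → ℝ} {n : ℕ} (h : (n : ℕ∞) < couplingTime x y) :
    x n ≠ y n := by
  intro hn
  exact absurd h (not_lt.mpr (iInf₂_le n hn))

/-! ### The coupled pair of chains -/

section PairKernel

variable {Λ : Measure ℝ} {α : ℝ}

theorem stepKernel_apply [IsFiniteMeasure Λ] (hα : 0 < α) (hL : ∀ t, 0 < t → Λ (Ioo 0 t) ≠ 0) {w : ℝ} (hw : 0 < w) :
    stepKernel Λ α w = Λ[|Ioo 0 (w / α)] := by
  have : w ∈ chargedSet Λ α := hL _ (by positivity)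
  classical
  unfold stepKernel
  rw [Kernel.piecewise_apply, if_pos this]
  rfl

theorem measure_Ioo_eq_add_Ico {s t : ℝ} (hs : 0 < s) (hst : s ≤ t) :
    Λ (Ioo 0 t) = Λ (Ioo 0 s) + Λ (Ico s t) := by
  rw [← measure_union _ measurableSet_Ico, Ioo_union_Ico_eq_Ioo hs hst]
  exact disjoint_left.mpr fun x hx hx' => absurd hx.2 (not_lt.mpr hx'.1)

theorem restrict_Ioo_eq_add_Ico {s t : ℝ} (hs : 0 < s) (hst : s ≤ t) :
    Λ.restrict (Ioo 0 t) = Λ.restrict (Ioo 0 s) + Λ.restrict (Ico s t) := by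
  rw [← Measure.restrict_union _ measurableSet_Ico, Ioo_union_Ico_eq_Ioo hs hst]
  exact disjoint_left.mpr fun x hx hx' => absurd hx.2 (not_lt.mpr hx'.1)

variable [IsProbabilityMeasure Λ]

/-- Both the merging and the non-merging part become unnormalized restrictions of Λ over the common
mass of (0, w₁/α). This removes the truncated subtraction and makes the two marginals visible. -/
theorem orderedPairKernel_apply (hα : 0 < α) (hL : ∀ t, 0 < t → Λ (Ioo 0 t) ≠ 0) {w : ℝ × ℝ}
    (h₂ : 0 < w.2) (h : w.2 ≤ w.1) :
    orderedPairKernel Λ α w = (Λ (Ioo 0 (w.1 / α)))⁻¹ •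
      ((Λ.restrict (Ioo 0 (w.2 / α))).map (fun x => (x, x)) +
        (Λ.restrict (Ico (w.2 / α) (w.1 / α))).prod (Λ[|Ioo 0 (w.2 / α)])) := by
  have ht₂ : 0 < w.2 / α := by positivity
  have ht : w.2 / α ≤ w.1 / α := by gcongr
  have ha := hL _ (ht₂.trans_le ht)
  have hb := hL _ ht₂
  have hab := measure_Ioo_eq_add_Ico (Λ := Λ) ht₂ ht
  have hfa := measure_ne_top Λ (Ioo 0 (w.1 / α))
  have hfb := measure_ne_top Λ (Ioo 0 (w.2 / α))
  have hfc := measure_ne_top Λ (Ico (w.2 / α) (w.1 / α))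
  change jumpRatio Λ α w • (Λ[|Ioo 0 (w.2 / α)]).map (fun x => (x, x)) +
      (1 - jumpRatio Λ α w) •
        (Λ[|Ico (w.2 / α) (w.1 / α)]).prod (Λ[|Ioo 0 (w.2 / α)]) = _
  rw [smul_add]
  unfold jumpRatio
  congr 1
  · rw [ProbabilityTheory.cond, Measure.map_smul, smul_smul, ENNReal.div_eq_inv_mul, mul_assoc,
      ENNReal.mul_inv_cancel hb hfb, mul_one]
  · conv_lhs => rw [ProbabilityTheory.cond, Measure.prod_smul_left, smul_smul]
    -- In the degenerate case the conditional law is the zero measure, and so is the restriction.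
    by_cases hc : Λ (Ico (w.2 / α) (w.1 / α)) = 0
    · have : Λ.restrict (Ico (w.2 / α) (w.1 / α)) = 0 := Measure.restrict_eq_zero.mpr hc
      rw [this]; simp
    · congr 1
      have : 1 - Λ (Ioo 0 (w.2 / α)) / Λ (Ioo 0 (w.1 / α)) =
          Λ (Ico (w.2 / α) (w.1 / α)) / Λ (Ioo 0 (w.1 / α)) := by
        refine ENNReal.sub_eq_of_eq_add (ENNReal.div_ne_top hfb ha) ?_
        rw [← ENNReal.add_div, add_comm, ← hab, ENNReal.div_self ha hfa]
      rw [this, ENNReal.div_eq_inv_mul, mul_assoc, ENNReal.mul_inv_cancel hc hfc, mul_one]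

theorem orderedPairKernel_map_fst (hα : 0 < α) (hL : ∀ t, 0 < t → Λ (Ioo 0 t) ≠ 0) {w : ℝ × ℝ}
    (h₂ : 0 < w.2) (h : w.2 ≤ w.1) :
    (orderedPairKernel Λ α w).map Prod.fst = Λ[|Ioo 0 (w.1 / α)] := by
  have ht₂ : 0 < w.2 / α := by positivity
  have ht : w.2 / α ≤ w.1 / α := by gcongr
  have hp : IsProbabilityMeasure (Λ[|Ioo 0 (w.2 / α)]) := cond_isProbabilityMeasure (hL _ ht₂)
  rw [orderedPairKernel_apply hα hL h₂ h, Measure.map_smul, Measure.map_add _ _ measurable_fst,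
    Measure.map_map measurable_fst (by fun_prop), Measure.map_fst_prod, measure_univ, one_smul]
  change _ • ((Λ.restrict _).map id + _) = _
  rw [Measure.map_id, ← restrict_Ioo_eq_add_Ico ht₂ ht]
  rfl

theorem orderedPairKernel_map_snd (hα : 0 < α) (hL : ∀ t, 0 < t → Λ (Ioo 0 t) ≠ 0) {w : ℝ × ℝ}
    (h₂ : 0 < w.2) (h : w.2 ≤ w.1) :
    (orderedPairKernel Λ α w).map Prod.snd = Λ[|Ioo 0 (w.2 / α)] := by
  have ht₂ : 0 < w.2 / α := by positivity
  have ht : w.2 / α ≤ w.1 / α := by gcongr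
  have hp : IsProbabilityMeasure (Λ[|Ioo 0 (w.2 / α)]) := cond_isProbabilityMeasure (hL _ ht₂)
  rw [orderedPairKernel_apply hα hL h₂ h, Measure.map_smul, Measure.map_add _ _ measurable_snd,
    Measure.map_map measurable_snd (by fun_prop), Measure.map_snd_prod, Measure.restrict_apply_univ]
  change _ • ((Λ.restrict _).map id + _) = _
  have e : Λ.restrict (Ioo 0 (w.2 / α)) = Λ (Ioo 0 (w.2 / α)) • Λ[|Ioo 0 (w.2 / α)] := by
    rw [ProbabilityTheory.cond, smul_smul,
      ENNReal.mul_inv_cancel (hL _ ht₂) (measure_ne_top _ _), one_smul]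
  rw [Measure.map_id, e, ← add_smul, smul_smul, ← measure_Ioo_eq_add_Ico ht₂ ht,
    ENNReal.inv_mul_cancel (hL _ (ht₂.trans_le ht)) (measure_ne_top _ _), one_smul]

theorem ae_orderedPairKernel (hα : 0 < α) (hL : ∀ t, 0 < t → Λ (Ioo 0 t) ≠ 0) {w : ℝ × ℝ}
    (h₂ : 0 < w.2) (h : w.2 ≤ w.1) :
    ∀ᵐ v ∂orderedPairKernel Λ α w, 0 < v.2 ∧ v.2 ≤ v.1 := by
  have ht₂ : 0 < w.2 / α := by positivity
  have hm : MeasurableSet {v : ℝ × ℝ | 0 < v.2 ∧ v.2 ≤ v.1} :=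
    (measurableSet_lt measurable_const measurable_snd).inter
      (measurableSet_le measurable_snd measurable_fst)
  rw [orderedPairKernel_apply hα hL h₂ h]
  refine Measure.ae_smul_measure ?_ _
  rw [ae_add_measure_iff]
  constructor
  · rw [ae_map_iff (by fun_prop) hm]
    filter_upwards [ae_restrict_mem measurableSet_Ioo] with x hx using ⟨hx.1, le_rfl⟩
  · rw [Measure.ae_prod_iff_ae_ae hm]
    filter_upwards [ae_restrict_mem measurableSet_Ico] with x hx
    filter_upwards [ae_cond_mem measurableSet_Ioo] with y hy
    exact ⟨hy.1, hy.2.le.trans hx.1⟩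

theorem pairKernel_apply_of_le (hα : 0 < α) (hL : ∀ t, 0 < t → Λ (Ioo 0 t) ≠ 0) {w : ℝ × ℝ}
    (h₂ : 0 < w.2) (h : w.2 ≤ w.1) : pairKernel Λ α w = orderedPairKernel Λ α w := by
  have hc : w ∈ chargedPairs Λ α :=
    ⟨hL _ (div_pos (h₂.trans_le h) hα), hL _ (div_pos h₂ hα)⟩
  have hle : w ∈ {w : ℝ × ℝ | w.2 / α ≤ w.1 / α} := by
    simp only [mem_ofPred_eq]; gcongr
  classical
  unfold pairKernel
  rw [Kernel.piecewise_apply, if_pos hc, Kernel.piecewise_apply, if_pos hle]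

theorem pairKernel_apply_of_lt (hα : 0 < α) (hL : ∀ t, 0 < t → Λ (Ioo 0 t) ≠ 0) {w : ℝ × ℝ}
    (h₁ : 0 < w.1) (h : w.1 < w.2) :
    pairKernel Λ α w = (orderedPairKernel Λ α w.swap).map Prod.swap := by
  have hc : w ∈ chargedPairs Λ α :=
    ⟨hL _ (div_pos h₁ hα), hL _ (div_pos (h₁.trans h) hα)⟩
  have hle : w ∉ {w : ℝ × ℝ | w.2 / α ≤ w.1 / α} := by
    simp only [mem_ofPred_eq, not_le]; gcongr
  classical
  unfold pairKernel
  rw [Kernel.piecewise_apply, if_pos hc, Kernel.piecewise_apply, if_neg hle,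
    Kernel.map_apply _ measurable_swap, Kernel.comap_apply]

theorem pairKernel_map_fst (hα : 0 < α) (hL : ∀ t, 0 < t → Λ (Ioo 0 t) ≠ 0) {w : ℝ × ℝ}
    (h₁ : 0 < w.1) (h₂ : 0 < w.2) : (pairKernel Λ α w).map Prod.fst = stepKernel Λ α w.1 := by
  rw [stepKernel_apply hα hL h₁]
  rcases le_or_gt w.2 w.1 with h | h
  · rw [pairKernel_apply_of_le hα hL h₂ h, orderedPairKernel_map_fst hα hL h₂ h]
  · rw [pairKernel_apply_of_lt hα hL h₁ h, Measure.map_map measurable_fst measurable_swap]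
    exact orderedPairKernel_map_snd (w := w.swap) hα hL h₁ h.le

theorem pairKernel_map_snd (hα : 0 < α) (hL : ∀ t, 0 < t → Λ (Ioo 0 t) ≠ 0) {w : ℝ × ℝ}
    (h₁ : 0 < w.1) (h₂ : 0 < w.2) : (pairKernel Λ α w).map Prod.snd = stepKernel Λ α w.2 := by
  rw [stepKernel_apply hα hL h₂]
  rcases le_or_gt w.2 w.1 with h | h
  · rw [pairKernel_apply_of_le hα hL h₂ h, orderedPairKernel_map_snd hα hL h₂ h]
  · rw [pairKernel_apply_of_lt hα hL h₁ h, Measure.map_map measurable_snd measurable_swap]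
    exact orderedPairKernel_map_fst (w := w.swap) hα hL h₁ h.le

/-- The state space `(0, ∞)²` of the coupled pair. -/
def posPairs : Set (ℝ × ℝ) := {w | 0 < w.1 ∧ 0 < w.2}

theorem measurableSet_posPairs : MeasurableSet posPairs :=
  (measurableSet_lt measurable_const measurable_fst).inter
    (measurableSet_lt measurable_const measurable_snd)

/-- The ordered pairs in `(0, ∞)²`. -/
def orderedPairs : Set (ℝ × ℝ) := {w | 0 < w.2 ∧ w.2 ≤ w.1}

theorem measurableSet_orderedPairs : MeasurableSet orderedPairs :=
  (measurableSet_lt measurable_const measurable_snd).inter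
    (measurableSet_le measurable_snd measurable_fst)

theorem ae_pairKernel_mem_orderedPairs (hα : 0 < α) (hL : ∀ t, 0 < t → Λ (Ioo 0 t) ≠ 0) :
    ∀ w ∈ orderedPairs, ∀ᵐ v ∂pairKernel Λ α w, v ∈ orderedPairs := fun w hw => by
  rw [pairKernel_apply_of_le hα hL hw.1 hw.2]
  exact ae_orderedPairKernel hα hL hw.1 hw.2

theorem ae_pairKernel_mem_posPairs (hα : 0 < α) (hL : ∀ t, 0 < t → Λ (Ioo 0 t) ≠ 0) :
    ∀ w ∈ posPairs, ∀ᵐ v ∂pairKernel Λ α w, v ∈ posPairs := fun w hw => by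
  rcases le_or_gt w.2 w.1 with h | h
  · rw [pairKernel_apply_of_le hα hL hw.2 h]
    filter_upwards [ae_orderedPairKernel hα hL hw.2 h] with v hv
    exact ⟨hv.1.trans_le hv.2, hv.1⟩
  · rw [pairKernel_apply_of_lt hα hL hw.1 h, ae_map_iff (p := (· ∈ posPairs)) (by fun_prop)
      measurableSet_posPairs]
    filter_upwards [ae_orderedPairKernel (w := w.swap) hα hL hw.1 h.le] with v hv
    exact ⟨hv.1, hv.1.trans_le hv.2⟩

/-! ### A Lyapunov function that vanishes on the diagonal -/

/-- A function of the smaller coordinate, set to zero on the diagonal. -/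
noncomputable def offDiagFun (H : ℝ → ℝ≥0∞) (w : ℝ × ℝ) : ℝ≥0∞ :=
  {w : ℝ × ℝ | w.1 ≠ w.2}.indicator (fun w => H (min w.1 w.2)) w

theorem measurableSet_offDiag : MeasurableSet {w : ℝ × ℝ | w.1 ≠ w.2} :=
  (measurableSet_eq_fun measurable_fst measurable_snd).compl

theorem measurable_offDiagFun {H : ℝ → ℝ≥0∞} (hH : Measurable H) : Measurable (offDiagFun H) :=
  (hH.comp (measurable_fst.min measurable_snd)).indicator measurableSet_offDiag

theorem offDiagFun_swap (H : ℝ → ℝ≥0∞) (w : ℝ × ℝ) : offDiagFun H w.swap = offDiagFun H w := by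
  unfold offDiagFun
  by_cases h : w.1 = w.2
  · rw [indicator_of_notMem (by simp [h]), indicator_of_notMem (by simp [h])]
  · rw [indicator_of_mem (by simp [Ne.symm h]), indicator_of_mem (by simp [h])]
    simp [min_comm]

/-- Only the non-merging part contributes, and there the second coordinate is the smaller one and
has law Λ(· | (0, w₂/α)). The weight of this part is 1 - Λ((0, w₂/α))/Λ((0, w₁/α)), and the
denominator is at most 1; thus the bound depends on the smaller coordinate alone. -/
theorem lintegral_offDiagFun_orderedPairKernel_le (hα : 0 < α) (hL : ∀ t, 0 < t → Λ (Ioo 0 t) ≠ 0)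
    {H : ℝ → ℝ≥0∞} (hH : Measurable H) {w : ℝ × ℝ} (h₂ : 0 < w.2) (h : w.2 ≤ w.1) :
    ∫⁻ v, offDiagFun H v ∂orderedPairKernel Λ α w ≤
      (1 - Λ (Ioo 0 (w.2 / α))) * ∫⁻ x, H x ∂Λ[|Ioo 0 (w.2 / α)] := by
  have ht₂ : 0 < w.2 / α := by positivity
  have ht : w.2 / α ≤ w.1 / α := by gcongr
  have ha := hL _ (ht₂.trans_le ht)
  have hfa := measure_ne_top Λ (Ioo 0 (w.1 / α))
  have hm := measurable_offDiagFun hH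
  rw [orderedPairKernel_apply hα hL h₂ h, lintegral_smul_measure, lintegral_add_measure,
    lintegral_map hm (by fun_prop)]
  have e1 : ∀ x : ℝ, offDiagFun H (x, x) = 0 := fun x => indicator_of_notMem (by simp) _
  simp only [e1, lintegral_zero, zero_add]
  have hab := measure_Ioo_eq_add_Ico (Λ := Λ) ht₂ ht
  calc (Λ (Ioo 0 (w.1 / α)))⁻¹ • ∫⁻ v, offDiagFun H v
          ∂(Λ.restrict (Ico (w.2 / α) (w.1 / α))).prod (Λ[|Ioo 0 (w.2 / α)])
      ≤ (Λ (Ioo 0 (w.1 / α)))⁻¹ • ∫⁻ v, H v.2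
          ∂(Λ.restrict (Ico (w.2 / α) (w.1 / α))).prod (Λ[|Ioo 0 (w.2 / α)]) := by
        rw [smul_eq_mul, smul_eq_mul]
        gcongr 1
        refine lintegral_mono_ae ?_
        have hms : MeasurableSet {v : ℝ × ℝ | v.2 ≤ v.1} :=
          measurableSet_le measurable_snd measurable_fst
        have : ∀ᵐ v ∂(Λ.restrict (Ico (w.2 / α) (w.1 / α))).prod (Λ[|Ioo 0 (w.2 / α)]),
            v.2 ≤ v.1 := by
          rw [Measure.ae_prod_iff_ae_ae hms]
          filter_upwards [ae_restrict_mem measurableSet_Ico] with x hx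
          filter_upwards [ae_cond_mem measurableSet_Ioo] with y hy
          exact hy.2.le.trans hx.1
        filter_upwards [this] with v hv
        refine (indicator_le_self _ _ _).trans ?_
        simp [min_eq_right hv]
    _ = (Λ (Ioo 0 (w.1 / α)))⁻¹ * Λ (Ico (w.2 / α) (w.1 / α)) *
          ∫⁻ x, H x ∂Λ[|Ioo 0 (w.2 / α)] := by
        rw [lintegral_prod _ (by fun_prop)]
        simp only [lintegral_const, Measure.restrict_apply_univ, smul_eq_mul]
        ring
    _ ≤ (1 - Λ (Ioo 0 (w.2 / α))) * ∫⁻ x, H x ∂Λ[|Ioo 0 (w.2 / α)] := by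
        gcongr
        refine ENNReal.le_sub_of_add_le_right (measure_ne_top _ _) ?_
        have h1 : Λ (Ioo 0 (w.2 / α)) ≤ (Λ (Ioo 0 (w.1 / α)))⁻¹ * Λ (Ioo 0 (w.2 / α)) := by
          refine le_mul_of_one_le_left (by simp) ?_
          exact ENNReal.one_le_inv.mpr prob_le_one
        calc _ ≤ (Λ (Ioo 0 (w.1 / α)))⁻¹ * Λ (Ico (w.2 / α) (w.1 / α)) +
              (Λ (Ioo 0 (w.1 / α)))⁻¹ * Λ (Ioo 0 (w.2 / α)) := by gcongr
          _ = 1 := by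
            rw [← mul_add, add_comm (Λ (Ico _ _)), ← hab, ENNReal.inv_mul_cancel ha hfa]

theorem lintegral_offDiagFun_orderedPairKernel_diag (hα : 0 < α)
    (hL : ∀ t, 0 < t → Λ (Ioo 0 t) ≠ 0) {H : ℝ → ℝ≥0∞} (hH : Measurable H) {w : ℝ × ℝ}
    (h₂ : 0 < w.2) (h : w.1 = w.2) : ∫⁻ v, offDiagFun H v ∂orderedPairKernel Λ α w = 0 := by
  rw [orderedPairKernel_apply hα hL h₂ h.ge, lintegral_smul_measure, lintegral_add_measure,
    lintegral_map (measurable_offDiagFun hH) (by fun_prop)]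
  have e1 : ∀ x : ℝ, offDiagFun H (x, x) = 0 := fun x => indicator_of_notMem (by simp) _
  simp [e1, h]

/-- A one-dimensional inequality for the smaller coordinate suffices for the pair: by symmetry
either coordinate may be the smaller one, and from the diagonal the pair never leaves it. -/
theorem lintegral_offDiagFun_pairKernel_le (hα : 0 < α) (hL : ∀ t, 0 < t → Λ (Ioo 0 t) ≠ 0)
    {H : ℝ → ℝ≥0∞} (hH : Measurable H) {k : ℝ≥0∞}
    (hk : ∀ w, 0 < w → (1 - Λ (Ioo 0 (w / α))) * ∫⁻ x, H x ∂Λ[|Ioo 0 (w / α)] ≤ k * H w) :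
    ∀ w ∈ posPairs, ∫⁻ v, offDiagFun H v ∂pairKernel Λ α w ≤ k * offDiagFun H w := fun w hw => by
  rcases lt_trichotomy w.1 w.2 with h | h | h
  · rw [pairKernel_apply_of_lt hα hL hw.1 h,
      lintegral_map (measurable_offDiagFun hH) measurable_swap]
    simp only [offDiagFun_swap]
    refine (lintegral_offDiagFun_orderedPairKernel_le (w := w.swap) hα hL hH hw.1 h.le).trans ?_
    refine (hk w.1 hw.1).trans ?_
    rw [offDiagFun, indicator_of_mem (by exact h.ne), min_eq_left h.le]
  · rw [pairKernel_apply_of_le hα hL hw.2 h.ge,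
      lintegral_offDiagFun_orderedPairKernel_diag hα hL hH hw.2 h]
    exact zero_le
  · rw [pairKernel_apply_of_le hα hL hw.2 h.le]
    refine (lintegral_offDiagFun_orderedPairKernel_le hα hL hH hw.2 h.le).trans ?_
    refine (hk w.2 hw.2).trans ?_
    rw [offDiagFun, indicator_of_mem (by exact h.ne'), min_eq_right h.le]

theorem ae_pairKernel_diag (hα : 0 < α) (hL : ∀ t, 0 < t → Λ (Ioo 0 t) ≠ 0) :
    ∀ w ∈ posPairs ∩ {w | w.1 = w.2},
      ∀ᵐ v ∂pairKernel Λ α w, v ∈ posPairs ∩ {w | w.1 = w.2} := fun w hw => by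
  have h1 := ae_pairKernel_mem_posPairs hα hL w hw.1
  have h0 := lintegral_offDiagFun_orderedPairKernel_diag hα hL (H := fun _ => 1) measurable_const
    hw.1.2 hw.2
  rw [← pairKernel_apply_of_le hα hL hw.1.2 (le_of_eq hw.2.symm),
    lintegral_eq_zero_iff (measurable_offDiagFun measurable_const)] at h0
  filter_upwards [h1, h0] with v hv hv0
  refine ⟨hv, ?_⟩
  by_contra hne
  have hne' : v.1 ≠ v.2 := hne
  simp [offDiagFun, hne'] at hv0

end PairKernel

/-! ### Laws with a density of pantograph type -/

/-- The law `Λ` has a density of the form `a(x) Λ((0, x / α))` on `(0, ∞)`, where `a` is positive,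
nonincreasing and decays exponentially. -/
structure IsPantographLaw (Λ : Measure ℝ) (α : ℝ) (a : ℝ → ℝ≥0∞) (D b : ℝ) : Prop where
  eq_withDensity : Λ = (volume.restrict (Ioi 0)).withDensity fun x => a x * Λ (Ioo 0 (x / α))
  antitone : Antitone a
  ne_zero : ∀ x, a x ≠ 0
  pos_const : 0 < D
  pos_rate : 0 < b
  le_exp : ∀ x, 0 < x → a x ≤ ENNReal.ofReal (D * Real.exp (-b * x))

namespace IsPantographLaw

variable {Λ : Measure ℝ} {α : ℝ} {a : ℝ → ℝ≥0∞} {D b : ℝ}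

theorem le_const (h : IsPantographLaw Λ α a D b) {x : ℝ} (hx : 0 < x) : a x ≤ ENNReal.ofReal D := by
  refine (h.le_exp x hx).trans (ENNReal.ofReal_le_ofReal ?_)
  have : Real.exp (-b * x) ≤ 1 := Real.exp_le_one_iff.mpr (by nlinarith [h.pos_rate])
  nlinarith [h.pos_const]

theorem measurable_density (h : IsPantographLaw Λ α a D b) :
    Measurable fun x => a x * Λ (Ioo 0 (x / α)) :=
  h.antitone.measurable.mul (measurable_measure_Ioo_div Λ α)

theorem setLIntegral_eq (h : IsPantographLaw Λ α a D b) {s : Set ℝ} (hs : MeasurableSet s)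
    (hs0 : s ⊆ Ioi 0) {f : ℝ → ℝ≥0∞} (hf : Measurable f) :
    ∫⁻ x in s, f x ∂Λ = ∫⁻ x in s, a x * Λ (Ioo 0 (x / α)) * f x := by
  conv_lhs => rw [h.eq_withDensity]
  rw [setLIntegral_withDensity_eq_setLIntegral_mul _ h.measurable_density hf hs,
    Measure.restrict_restrict hs, inter_eq_left.mpr hs0]
  rfl

theorem measure_eq (h : IsPantographLaw Λ α a D b) {s : Set ℝ} (hs : MeasurableSet s)
    (hs0 : s ⊆ Ioi 0) : Λ s = ∫⁻ x in s, a x * Λ (Ioo 0 (x / α)) := by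
  have := h.setLIntegral_eq hs hs0 (f := fun _ => 1) measurable_const
  simpa using this

theorem measure_Iic (h : IsPantographLaw Λ α a D b) : Λ (Iic 0) = 0 := by
  rw [h.eq_withDensity, withDensity_apply _ measurableSet_Iic,
    Measure.restrict_restrict measurableSet_Iic]
  have : Iic (0 : ℝ) ∩ Ioi 0 = ∅ := by ext x; simp
  simp [this]

theorem ae_pos (h : IsPantographLaw Λ α a D b) : ∀ᵐ x ∂Λ, 0 < x := by
  rw [ae_iff]
  simp only [not_lt]
  exact h.measure_Iic

/-- If Λ does not charge (0, t), its density vanishes almost everywhere there; as `a` is never zero,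
Λ((0, x/α)) = 0 for some x arbitrarily close to t. A null interval at 0 therefore expands by almost
a factor 1/α. -/
theorem measure_Ioo_eq_zero_of_lt (h : IsPantographLaw Λ α a D b) (hα : 0 < α) {t s : ℝ}
    (h0 : Λ (Ioo 0 t) = 0) (hs : s < t / α) : Λ (Ioo 0 s) = 0 := by
  rcases le_or_gt s 0 with hs0 | hs0
  · simp [Ioo_eq_empty (not_lt.mpr hs0)]
  rw [h.measure_eq measurableSet_Ioo fun x hx => hx.1,
    lintegral_eq_zero_iff h.measurable_density] at h0
  have hst : α * s < t := by rwa [lt_div_iff₀ hα, mul_comm] at hs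
  have hne : (volume.restrict (Ioo 0 t)) (Ioo (α * s) t) ≠ 0 := by
    rw [Measure.restrict_apply measurableSet_Ioo, inter_eq_left.mpr
      (Ioo_subset_Ioo_left (by positivity)), Real.volume_Ioo]
    simpa using hst
  have hx : ∃ x ∈ Ioo (α * s) t, a x * Λ (Ioo 0 (x / α)) = 0 := by
    by_contra hcon
    push Not at hcon
    refine hne (measure_mono_null (fun x hx => ?_) h0)
    exact hcon x hx
  obtain ⟨x, hx, hx0⟩ := hx
  have := (mul_eq_zero.mp hx0).resolve_left (h.ne_zero x)
  refine measure_mono_null (Ioo_subset_Ioo_right ?_) this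
  rw [le_div_iff₀ hα, mul_comm]
  exact hx.1.le

/-- Otherwise a null interval could be enlarged by a fixed factor γ in (1, 1/α) over and over until
it exhausts (0, ∞), against total mass one. -/
theorem measure_Ioo_ne_zero [IsProbabilityMeasure Λ] (h : IsPantographLaw Λ α a D b)
    (hα₀ : 0 < α) (hα₁ : α < 1) : ∀ t, 0 < t → Λ (Ioo 0 t) ≠ 0 := by
  intro t ht h0
  obtain ⟨γ, hγ1, hγ⟩ : ∃ γ : ℝ, 1 < γ ∧ γ < 1 / α := by
    refine exists_between ?_
    rw [lt_div_iff₀ hα₀]; linarith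
  have key : ∀ n : ℕ, Λ (Ioo 0 (t * γ ^ n)) = 0 := by
    intro n
    induction n with
    | zero => simpa using h0
    | succ n ih =>
      refine h.measure_Ioo_eq_zero_of_lt hα₀ ih ?_
      calc t * γ ^ (n + 1) = t * γ ^ n * γ := by ring
        _ < t * γ ^ n * (1 / α) := by gcongr
        _ = t * γ ^ n / α := by ring
  have hU : (Ioi 0 : Set ℝ) ⊆ ⋃ n : ℕ, Ioo 0 (t * γ ^ n) := by
    intro x hx
    obtain ⟨n, hn⟩ := pow_unbounded_of_one_lt (x / t) hγ1
    refine mem_iUnion.mpr ⟨n, hx, ?_⟩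
    rw [div_lt_iff₀ ht] at hn
    linarith
  have h1 : Λ (Ioi 0) = 0 := measure_mono_null hU (measure_iUnion_null key)
  have h2 : Λ univ = 0 := by
    rw [← Iic_union_Ioi (a := (0 : ℝ))]
    exact measure_union_null h.measure_Iic h1
  simp at h2

/-! ### Negative moments near the origin and the drift inequality -/

theorem lintegral_rpow_Ioo {θ s : ℝ} (hθ : θ < 1) (hs : 0 < s) :
    ∫⁻ x in Ioo 0 s, ENNReal.ofReal (x ^ (-θ)) = ENNReal.ofReal (s ^ (1 - θ) / (1 - θ)) := by
  have hi : IntegrableOn (fun x : ℝ => x ^ (-θ)) (Ioo 0 s) := by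
    have := (intervalIntegral.intervalIntegrable_rpow' (a := 0) (b := s) (r := -θ) (by linarith)).1
    exact this.mono_set Ioo_subset_Ioc_self
  rw [← ofReal_integral_eq_lintegral_ofReal hi]
  · congr 1
    rw [← integral_Ioc_eq_integral_Ioo, ← intervalIntegral.integral_of_le hs.le,
      integral_rpow (Or.inl (by linarith)), Real.zero_rpow (by linarith)]
    rw [show -θ + 1 = 1 - θ by ring, sub_zero]
  · filter_upwards [ae_restrict_mem measurableSet_Ioo] with x hx
    exact Real.rpow_nonneg hx.1.le _

/-- The factor Λ((0, s/α)) is kept on purpose: with s = αt it cancels the normalization of Λ(· | (0,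
t)), leaving a contribution of order t^{1-θ}. -/
theorem setLIntegral_rpow_le (h : IsPantographLaw Λ α a D b) (hα : 0 < α) {θ s : ℝ} (hθ : θ < 1)
    (hs : 0 < s) : ∫⁻ x in Ioo 0 s, ENNReal.ofReal (x ^ (-θ)) ∂Λ ≤
      ENNReal.ofReal (D * (s ^ (1 - θ) / (1 - θ))) * Λ (Ioo 0 (s / α)) := by
  have hm : Measurable fun x : ℝ => ENNReal.ofReal (x ^ (-θ)) := by fun_prop
  rw [h.setLIntegral_eq measurableSet_Ioo (fun x hx => hx.1) hm]
  calc ∫⁻ x in Ioo 0 s, a x * Λ (Ioo 0 (x / α)) * ENNReal.ofReal (x ^ (-θ))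
      ≤ ∫⁻ x in Ioo 0 s, ENNReal.ofReal D * Λ (Ioo 0 (s / α)) * ENNReal.ofReal (x ^ (-θ)) := by
        refine setLIntegral_mono' measurableSet_Ioo fun x hx => ?_
        gcongr
        · exact h.le_const hx.1
        · exact hx.2.le
    _ = ENNReal.ofReal D * Λ (Ioo 0 (s / α)) * ENNReal.ofReal (s ^ (1 - θ) / (1 - θ)) := by
        rw [lintegral_const_mul _ hm, lintegral_rpow_Ioo hθ hs]
    _ = _ := by
        rw [ENNReal.ofReal_mul h.pos_const.le]; ring

/-- The mass that `Λ` gives to `[β t, t)` is at least a fixed fraction of the one it gives to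
`(0, β t)`. -/
theorem measureReal_Ioo_mul_le [IsProbabilityMeasure Λ] (h : IsPantographLaw Λ α a D b)
    (hα : 0 < α) {β t : ℝ} (hβ₀ : 0 < β) (hβ₁ : β < 1) (ht₀ : 0 < t) (ht₁ : t ≤ 1) :
    (a 1).toReal * (1 - β) / (D * β) * Λ.real (Ioo 0 (β * t)) ≤ Λ.real (Ico (β * t) t) := by
  have hD := h.pos_const
  have ha1 : a 1 ≠ ⊤ := ((h.le_const one_pos).trans_lt ENNReal.ofReal_lt_top).ne
  have hβt : 0 < β * t := by positivity
  have hup : Λ (Ioo 0 (β * t)) ≤ ENNReal.ofReal (D * (β * t)) * Λ (Ioo 0 (β * t / α)) := by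
    rw [h.measure_eq measurableSet_Ioo fun x hx => hx.1]
    calc ∫⁻ x in Ioo 0 (β * t), a x * Λ (Ioo 0 (x / α))
        ≤ ∫⁻ x in Ioo 0 (β * t), ENNReal.ofReal D * Λ (Ioo 0 (β * t / α)) := by
          refine setLIntegral_mono' measurableSet_Ioo fun x hx => ?_
          gcongr
          · exact h.le_const hx.1
          · exact hx.2.le
      _ = _ := by
          rw [lintegral_const, Measure.restrict_apply_univ, Real.volume_Ioo, sub_zero,
            ENNReal.ofReal_mul hD.le]
          ring
  -- On [βt, t) both factors of the density are bounded below: `a` by its value at 1, since t ≤ 1,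
  -- and the mass by its value at the left end. At that same point the mass bounds the density on
  -- (0, βt) from above, so it cancels in the comparison.
  have hlow : a 1 * ENNReal.ofReal ((1 - β) * t) * Λ (Ioo 0 (β * t / α)) ≤ Λ (Ico (β * t) t) := by
    rw [h.measure_eq measurableSet_Ico fun x hx => hβt.trans_le hx.1]
    calc a 1 * ENNReal.ofReal ((1 - β) * t) * Λ (Ioo 0 (β * t / α))
        = ∫⁻ x in Ico (β * t) t, a 1 * Λ (Ioo 0 (β * t / α)) := by
          rw [lintegral_const, Measure.restrict_apply_univ, Real.volume_Ico,
            show t - β * t = (1 - β) * t by ring]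
          ring
      _ ≤ _ := by
          refine setLIntegral_mono' measurableSet_Ico fun x hx => ?_
          gcongr
          · exact h.antitone (hx.2.le.trans ht₁)
          · exact hx.1
  have hup' : Λ.real (Ioo 0 (β * t)) ≤ D * (β * t) * Λ.real (Ioo 0 (β * t / α)) := by
    have := ENNReal.toReal_mono (by finiteness) hup
    rwa [ENNReal.toReal_mul, ENNReal.toReal_ofReal (by positivity)] at this
  have hlow' : (a 1).toReal * ((1 - β) * t) * Λ.real (Ioo 0 (β * t / α)) ≤
      Λ.real (Ico (β * t) t) := by
    have := ENNReal.toReal_mono (by finiteness) hlow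
    rwa [ENNReal.toReal_mul, ENNReal.toReal_mul, ENNReal.toReal_ofReal
      (mul_nonneg (by linarith) ht₀.le)] at this
  refine le_trans ?_ hlow'
  calc (a 1).toReal * (1 - β) / (D * β) * Λ.real (Ioo 0 (β * t))
      ≤ (a 1).toReal * (1 - β) / (D * β) * (D * (β * t) * Λ.real (Ioo 0 (β * t / α))) := by
        have : 0 ≤ (a 1).toReal * (1 - β) / (D * β) :=
          div_nonneg (mul_nonneg ENNReal.toReal_nonneg (by linarith)) (by positivity)
        gcongr
    _ = (a 1).toReal * ((1 - β) * t) * Λ.real (Ioo 0 (β * t / α)) := by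
        field_simp

theorem lintegral_cond_eq [IsFiniteMeasure Λ] (s : Set ℝ) (f : ℝ → ℝ≥0∞) :
    ∫⁻ x, f x ∂Λ[|s] = (Λ s)⁻¹ * ∫⁻ x in s, f x ∂Λ := by
  rw [ProbabilityTheory.cond, lintegral_smul_measure, smul_eq_mul]

/-- Geometric drift of the chain away from `0`. -/
theorem exists_drift [IsProbabilityMeasure Λ] (h : IsPantographLaw Λ α a D b) (hα₀ : 0 < α)
    (hα₁ : α < 1) {θ : ℝ} (hθ₀ : 0 < θ) (hθ₁ : θ ≤ 1 / 2) :
    ∃ ρ : ℝ, 0 < ρ ∧ ρ < 1 ∧ ∃ C : ℝ, 0 < C ∧ ∀ w, 0 < w →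
      ∫⁻ x, ENNReal.ofReal (x ^ (-θ)) ∂Λ[|Ioo 0 (w / α)] ≤
        ENNReal.ofReal (ρ * w ^ (-θ) + C) := by
  have hL := h.measure_Ioo_ne_zero hα₀ hα₁
  have hD := h.pos_const
  have ha1 : a 1 ≠ ⊤ := ((h.le_const one_pos).trans_lt ENNReal.ofReal_lt_top).ne
  have hm : Measurable fun x : ℝ => ENNReal.ofReal (x ^ (-θ)) := by fun_prop
  -- With t = w/α, the interval (0, t) is cut at αt = w and βt. Beyond βt > w the function x^{-θ} is
  -- below w^{-θ} by the factor q.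
  obtain ⟨β, hαβ, hβ₁⟩ := exists_between hα₁
  have hβ₀ : 0 < β := hα₀.trans hαβ
  obtain ⟨η, hη⟩ : ∃ η, η = (a 1).toReal * (1 - β) / (D * β) := ⟨_, rfl⟩
  have hη₀ : 0 < η := by
    rw [hη]
    have := ENNReal.toReal_pos (h.ne_zero 1) ha1
    have : 0 < 1 - β := by linarith
    positivity
  obtain ⟨q, hq⟩ : ∃ q, q = (α / β) ^ θ := ⟨_, rfl⟩
  have hq₀ : 0 < q := by rw [hq]; positivity
  have hq₁ : q < 1 := by
    rw [hq]; exact Real.rpow_lt_one (by positivity) ((div_lt_one hβ₀).mpr hαβ) hθ₀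
  -- Of the mass of (0, t), at most the share 1/(1 + η) lies in (0, βt), where the weight is 1; the
  -- rest has weight q. The average weight is therefore at most ρ₁.
  obtain ⟨ρ₁, hρ₁⟩ : ∃ ρ₁, ρ₁ = q + (1 - q) / (1 + η) := ⟨_, rfl⟩
  have hρ₁₀ : 0 < ρ₁ := by
    rw [hρ₁]; have : 0 < 1 - q := by linarith
    positivity
  have hρ₁₁ : ρ₁ < 1 := by
    have : (1 - q) / (1 + η) < 1 - q := div_lt_self (by linarith) (by linarith)
    rw [hρ₁]; linarith
  -- Below t₀ the interval (0, αt), where x^{-θ} exceeds w^{-θ}, contributes at most (1 - ρ₁)/2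
  -- times w^{-θ}, which brings the rate to (1 + ρ₁)/2. The bound t₀ ≤ 1 is what the mass comparison
  -- requires.
  obtain ⟨t₀, ht₀⟩ : ∃ t₀, t₀ = min 1 ((1 - ρ₁) / (4 * D * α)) := ⟨_, rfl⟩
  have ht₀p : 0 < t₀ := by
    rw [ht₀]
    have : 0 < 1 - ρ₁ := by linarith
    positivity
  have ht₀1 : t₀ ≤ 1 := ht₀ ▸ min_le_left _ _
  have ht₀2 : 2 * D * α * t₀ ≤ (1 - ρ₁) / 2 := by
    have : t₀ ≤ (1 - ρ₁) / (4 * D * α) := ht₀ ▸ min_le_right _ _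
    rw [le_div_iff₀ (by positivity)] at this
    linarith
  have hl₀ : 0 < Λ.real (Ioo 0 t₀) := ENNReal.toReal_pos (hL _ ht₀p) (measure_ne_top _ _)
  refine ⟨(1 + ρ₁) / 2, by linarith, by linarith, (2 * D + 1) / Λ.real (Ioo 0 t₀), by positivity,
    fun w hw => ?_⟩
  obtain ⟨t, ht⟩ : ∃ t, t = w / α := ⟨_, rfl⟩
  have htp : 0 < t := by rw [ht]; positivity
  have hwt : α * t = w := by rw [ht]; field_simp
  rw [← ht, lintegral_cond_eq]
  have hLt := hL t htp
  have hlt : 0 < Λ.real (Ioo 0 t) := ENNReal.toReal_pos hLt (measure_ne_top _ _)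
  suffices hs : ∫⁻ x in Ioo 0 t, ENNReal.ofReal (x ^ (-θ)) ∂Λ ≤
      ENNReal.ofReal (((1 + ρ₁) / 2 * w ^ (-θ) + (2 * D + 1) / Λ.real (Ioo 0 t₀)) *
        Λ.real (Ioo 0 t)) by
    rw [← ENNReal.div_eq_inv_mul]
    refine ENNReal.div_le_of_le_mul (hs.trans ?_)
    rw [ENNReal.ofReal_mul (by positivity), ofReal_measureReal]
  rcases le_or_gt t t₀ with htt | htt
  · have hβt : 0 < β * t := by positivity
    have hαβt : α * t ≤ β * t := by gcongr
    have hβtt : β * t ≤ t := by nlinarith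
    have hwp : 0 < w ^ (-θ) := by positivity
    have e1 : ∫⁻ x in Ioo 0 (α * t), ENNReal.ofReal (x ^ (-θ)) ∂Λ ≤
        ENNReal.ofReal (2 * D * α * t * w ^ (-θ) * Λ.real (Ioo 0 t)) := by
      refine (h.setLIntegral_rpow_le hα₀ (by linarith) (by positivity)).trans ?_
      rw [mul_div_cancel_left₀ _ hα₀.ne', hwt]
      rw [← ofReal_measureReal, ← ENNReal.ofReal_mul (by
        have : 0 < 1 - θ := by linarith
        positivity)]
      refine ENNReal.ofReal_le_ofReal ?_
      refine mul_le_mul_of_nonneg_right ?_ hlt.le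
      have e : w ^ (1 - θ) = w * w ^ (-θ) := by
        rw [show (1 - θ) = 1 + (-θ) by ring, Real.rpow_add hw, Real.rpow_one]
      have h1 : w * w ^ (-θ) / (1 - θ) ≤ 2 * (w * w ^ (-θ)) := by
        rw [div_le_iff₀ (by linarith)]
        nlinarith [mul_pos hw hwp]
      calc D * (w ^ (1 - θ) / (1 - θ)) ≤ D * (2 * (w * w ^ (-θ))) := by rw [e]; gcongr
        _ = 2 * D * (α * t) * w ^ (-θ) := by rw [hwt]; ring
        _ = 2 * D * α * t * w ^ (-θ) := by ring
    have e2 : ∫⁻ x in Ico (α * t) (β * t), ENNReal.ofReal (x ^ (-θ)) ∂Λ ≤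
        ENNReal.ofReal (w ^ (-θ) * Λ.real (Ioo 0 (β * t))) := by
      calc ∫⁻ x in Ico (α * t) (β * t), ENNReal.ofReal (x ^ (-θ)) ∂Λ
          ≤ ∫⁻ x in Ico (α * t) (β * t), ENNReal.ofReal (w ^ (-θ)) ∂Λ := by
            refine setLIntegral_mono' measurableSet_Ico fun x hx => ?_
            refine ENNReal.ofReal_le_ofReal ?_
            refine Real.rpow_le_rpow_of_nonpos hw ?_ (by linarith)
            rw [← hwt]; exact hx.1
        _ ≤ _ := by
            rw [lintegral_const, Measure.restrict_apply_univ, ENNReal.ofReal_mul hwp.le,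
              ofReal_measureReal]
            have hsub : Ico (α * t) (β * t) ⊆ Ioo 0 (β * t) := fun x hx =>
              ⟨(by positivity : (0 : ℝ) < α * t).trans_le hx.1, hx.2⟩
            gcongr
    have e3 : ∫⁻ x in Ico (β * t) t, ENNReal.ofReal (x ^ (-θ)) ∂Λ ≤
        ENNReal.ofReal (q * w ^ (-θ) * Λ.real (Ico (β * t) t)) := by
      calc ∫⁻ x in Ico (β * t) t, ENNReal.ofReal (x ^ (-θ)) ∂Λ
          ≤ ∫⁻ x in Ico (β * t) t, ENNReal.ofReal (q * w ^ (-θ)) ∂Λ := by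
            refine setLIntegral_mono' measurableSet_Ico fun x hx => ?_
            refine ENNReal.ofReal_le_ofReal ?_
            refine (Real.rpow_le_rpow_of_nonpos hβt hx.1 (by linarith)).trans (le_of_eq ?_)
            rw [hq, ← hwt, Real.mul_rpow hβ₀.le htp.le, Real.mul_rpow hα₀.le htp.le,
              Real.div_rpow hα₀.le hβ₀.le, Real.rpow_neg hβ₀.le, Real.rpow_neg hα₀.le]
            have := Real.rpow_pos_of_pos hα₀ θ
            field_simp
        _ = _ := by
            rw [lintegral_const, Measure.restrict_apply_univ,
              ENNReal.ofReal_mul (p := q * w ^ (-θ)) (by positivity), ofReal_measureReal]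
    have hsplit : Ioo 0 t = Ioo 0 (α * t) ∪ (Ico (α * t) (β * t) ∪ Ico (β * t) t) := by
      rw [Ico_union_Ico_eq_Ico hαβt hβtt, Ioo_union_Ico_eq_Ioo (by positivity) (hαβt.trans hβtt)]
    have hkey := h.measureReal_Ioo_mul_le hα₀ hβ₀ hβ₁ htp (htt.trans ht₀1)
    rw [← hη] at hkey
    have hadd : Λ.real (Ioo 0 t) = Λ.real (Ioo 0 (β * t)) + Λ.real (Ico (β * t) t) := by
      unfold Measure.real
      rw [measure_Ioo_eq_add_Ico hβt hβtt, ENNReal.toReal_add (by finiteness) (by finiteness)]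
    calc ∫⁻ x in Ioo 0 t, ENNReal.ofReal (x ^ (-θ)) ∂Λ
        ≤ ENNReal.ofReal (2 * D * α * t * w ^ (-θ) * Λ.real (Ioo 0 t)) +
          (ENNReal.ofReal (w ^ (-θ) * Λ.real (Ioo 0 (β * t))) +
            ENNReal.ofReal (q * w ^ (-θ) * Λ.real (Ico (β * t) t))) := by
          rw [hsplit]
          refine (lintegral_union_le _ _ _).trans (add_le_add (hsplit ▸ e1) ?_)
          exact (lintegral_union_le _ _ _).trans (add_le_add e2 e3)
      _ = ENNReal.ofReal (2 * D * α * t * w ^ (-θ) * Λ.real (Ioo 0 t) +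
          (w ^ (-θ) * Λ.real (Ioo 0 (β * t)) + q * w ^ (-θ) * Λ.real (Ico (β * t) t))) := by
          rw [ENNReal.ofReal_add (by positivity) (by positivity),
            ENNReal.ofReal_add (by positivity) (by positivity)]
      _ ≤ _ := by
          refine ENNReal.ofReal_le_ofReal ?_
          obtain ⟨ℓ, hℓ⟩ : ∃ ℓ, ℓ = Λ.real (Ioo 0 (β * t)) := ⟨_, rfl⟩
          obtain ⟨m, hm'⟩ : ∃ m, m = Λ.real (Ico (β * t) t) := ⟨_, rfl⟩
          rw [← hℓ, ← hm'] at hadd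
          rw [← hℓ, ← hm'] at hkey ⊢
          have hT : 2 * D * α * t ≤ (1 - ρ₁) / 2 := by
            refine le_trans ?_ ht₀2
            gcongr
          have hρm : ℓ + q * m ≤ ρ₁ * Λ.real (Ioo 0 t) := by
            rw [hadd, hρ₁]
            have : ℓ ≤ (ℓ + m) / (1 + η) := by
              rw [le_div_iff₀ (by linarith)]; linarith
            have h1q : 0 < 1 - q := by linarith
            calc ℓ + q * m = q * (ℓ + m) + (1 - q) * ℓ := by ring
              _ ≤ q * (ℓ + m) + (1 - q) * ((ℓ + m) / (1 + η)) := by gcongr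
              _ = _ := by ring
          have hC : 0 ≤ (2 * D + 1) / Λ.real (Ioo 0 t₀) * Λ.real (Ioo 0 t) := by positivity
          calc 2 * D * α * t * w ^ (-θ) * Λ.real (Ioo 0 t) +
                (w ^ (-θ) * ℓ + q * w ^ (-θ) * m)
              = 2 * D * α * t * (w ^ (-θ) * Λ.real (Ioo 0 t)) + w ^ (-θ) * (ℓ + q * m) := by ring
            _ ≤ (1 - ρ₁) / 2 * (w ^ (-θ) * Λ.real (Ioo 0 t)) +
                w ^ (-θ) * (ρ₁ * Λ.real (Ioo 0 t)) := by gcongr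
            _ ≤ _ := by linarith
  -- For t > t₀ the normalization is at least Λ((0, t₀)), and the moment of Λ itself is at most 2D +
  -- 1, so the additive constant covers everything.
  · have e1 : ∫⁻ x in Ioo 0 1, ENNReal.ofReal (x ^ (-θ)) ∂Λ ≤ ENNReal.ofReal (2 * D) := by
      refine (h.setLIntegral_rpow_le hα₀ (by linarith) one_pos).trans ?_
      refine (mul_le_of_le_one_right zero_le prob_le_one).trans (ENNReal.ofReal_le_ofReal ?_)
      rw [Real.one_rpow, mul_comm 2 D]
      gcongr
      rw [div_le_iff₀ (by linarith)]; linarith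
    have e2 : ∫⁻ x in Ici 1, ENNReal.ofReal (x ^ (-θ)) ∂Λ ≤ ENNReal.ofReal 1 := by
      calc ∫⁻ x in Ici 1, ENNReal.ofReal (x ^ (-θ)) ∂Λ ≤ ∫⁻ x in Ici 1, ENNReal.ofReal 1 ∂Λ := by
            refine setLIntegral_mono' measurableSet_Ici fun x hx => ?_
            exact ENNReal.ofReal_le_ofReal (Real.rpow_le_one_of_one_le_of_nonpos hx (by linarith))
        _ ≤ _ := by
            rw [lintegral_const]
            exact mul_le_of_le_one_right zero_le
              (by rw [Measure.restrict_apply_univ]; exact prob_le_one)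
    calc ∫⁻ x in Ioo 0 t, ENNReal.ofReal (x ^ (-θ)) ∂Λ
        ≤ ∫⁻ x in Ioo 0 1 ∪ Ici 1, ENNReal.ofReal (x ^ (-θ)) ∂Λ := by
          refine lintegral_mono_set fun x hx => ?_
          rcases lt_or_ge x 1 with h1 | h1
          · exact Or.inl ⟨hx.1, h1⟩
          · exact Or.inr h1
      _ ≤ ENNReal.ofReal (2 * D) + ENNReal.ofReal 1 :=
          (lintegral_union_le _ _ _).trans (add_le_add e1 e2)
      _ = ENNReal.ofReal (2 * D + 1) := by rw [ENNReal.ofReal_add (by positivity) zero_le_one]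
      _ ≤ _ := by
          refine ENNReal.ofReal_le_ofReal ?_
          have hmono : Λ.real (Ioo 0 t₀) ≤ Λ.real (Ioo 0 t) :=
            measureReal_mono (Ioo_subset_Ioo_right htt.le)
          have h1 : 2 * D + 1 ≤ (2 * D + 1) / Λ.real (Ioo 0 t₀) * Λ.real (Ioo 0 t) := by
            rw [div_mul_eq_mul_div, le_div_iff₀ hl₀]
            gcongr
          have h2 : 0 ≤ (1 + ρ₁) / 2 * w ^ (-θ) * Λ.real (Ioo 0 t) := by positivity
          linarith

end IsPantographLaw

/-! ### Setwise limits and quantile couplings -/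

section MeasureLemmas

open Filter Topology

/-- Domination by the finite measure ν permits dominated convergence in the sum over a disjoint
family, which makes the limit countably additive. -/
theorem exists_setwise_limit {S : Type*} [MeasurableSpace S] {ν : Measure S} [IsFiniteMeasure ν]
    {μ : ℕ → Measure S} [∀ n, IsProbabilityMeasure (μ n)] (hle : ∀ n, μ n ≤ ν)
    (hlim : ∀ A, MeasurableSet A → ∃ l, Tendsto (fun n => μ n A) atTop (𝓝 l)) :
    ∃ π : Measure S, IsProbabilityMeasure π ∧ π ≤ ν ∧
      ∀ A, MeasurableSet A → Tendsto (fun n => μ n A) atTop (𝓝 (π A)) := by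
  choose! l hl using hlim
  have hempty : l ∅ = 0 := by
    refine tendsto_nhds_unique (hl ∅ MeasurableSet.empty) ?_
    simp
  have hUnion : ∀ f : ℕ → Set S, (∀ i, MeasurableSet (f i)) → Pairwise (Function.onFun Disjoint f) →
      l (⋃ i, f i) = ∑' i, l (f i) := by
    intro f hf hd
    refine tendsto_nhds_unique (hl _ (MeasurableSet.iUnion hf)) ?_
    simp only [measure_iUnion hd hf, ← lintegral_count]
    refine tendsto_lintegral_of_dominated_convergence (fun i => ν (f i))
      (fun n => measurable_of_countable _)
      (fun n => Eventually.of_forall fun i => hle n (f i)) ?_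
      (Eventually.of_forall fun i => hl _ (hf i))
    rw [lintegral_count, ← measure_iUnion hd hf]
    exact measure_ne_top _ _
  let π : Measure S := Measure.ofMeasurable (fun A _ => l A) hempty (fun f hf hd => hUnion f hf hd)
  have hπ : ∀ A, MeasurableSet A → π A = l A := fun A hA => Measure.ofMeasurable_apply A hA
  refine ⟨π, ⟨?_⟩, ?_, fun A hA => by rw [hπ A hA]; exact hl A hA⟩
  · rw [hπ _ MeasurableSet.univ]
    refine tendsto_nhds_unique (hl univ MeasurableSet.univ) ?_
    simp
  · refine Measure.le_iff.mpr fun A hA => ?_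
    rw [hπ A hA]
    exact le_of_tendsto' (hl A hA) fun n => hle n A

/-- Layer cake formula: the integral is that of the masses of superlevel sets over levels in (0, 1],
and these masses converge and are at most 1. -/
theorem tendsto_lintegral_of_setwise {S : Type*} [MeasurableSpace S] {μ : ℕ → Measure S}
    {π : Measure S} [∀ n, IsProbabilityMeasure (μ n)] [IsProbabilityMeasure π]
    (h : ∀ A, MeasurableSet A → Tendsto (fun n => μ n A) atTop (𝓝 (π A)))
    {f : S → ℝ≥0∞} (hf : Measurable f) (hf1 : ∀ x, f x ≤ 1) :
    Tendsto (fun n => ∫⁻ x, f x ∂μ n) atTop (𝓝 (∫⁻ x, f x ∂π)) := by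
  have e : ∀ ν : Measure S, ∫⁻ x, f x ∂ν = ∫⁻ t in Ioi (0 : ℝ), ν {x | t ≤ (f x).toReal} := by
    intro ν
    rw [← lintegral_eq_lintegral_meas_le ν (Eventually.of_forall fun x => ENNReal.toReal_nonneg)
      hf.ennreal_toReal.aemeasurable]
    refine lintegral_congr fun x => ?_
    rw [ENNReal.ofReal_toReal ((hf1 x).trans_lt ENNReal.one_lt_top).ne]
  simp only [e]
  have hmeas : ∀ ν : Measure S, Measurable fun t : ℝ => ν {x | t ≤ (f x).toReal} := fun ν =>
    Antitone.measurable fun s t hst => measure_mono fun x hx => hst.trans hx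
  refine tendsto_lintegral_of_dominated_convergence ((Iic (1 : ℝ)).indicator fun _ => 1)
    (fun n => hmeas _) (fun n => Eventually.of_forall fun t => ?_) ?_
    (Eventually.of_forall fun t => h _ (hf.ennreal_toReal measurableSet_Ici))
  · by_cases ht : t ≤ 1
    · rw [indicator_of_mem (by exact ht)]; exact prob_le_one
    · rw [indicator_of_notMem (by exact ht)]
      have : {x | t ≤ (f x).toReal} = ∅ := by
        ext x
        simp only [mem_ofPred_eq, mem_empty_iff_false, iff_false, not_le]
        refine lt_of_le_of_lt ?_ (not_le.mp ht)
        exact ENNReal.toReal_mono ENNReal.one_ne_top (hf1 x)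
      simp [this]
  · rw [lintegral_indicator measurableSet_Iic, lintegral_const, one_mul,
      Measure.restrict_apply_univ, Measure.restrict_apply measurableSet_Iic, Iic_inter_Ioi,
      Real.volume_Ioc]
    exact ENNReal.ofReal_ne_top

/-! ### Quantile coupling and the coupling inequality -/

/-- The quantile function of a law on the line. -/
noncomputable def quantile (μ : Measure ℝ) (u : ℝ) : ℝ := sInf {x | u ≤ cdf μ x}

theorem quantile_le_iff {μ : Measure ℝ} {u : ℝ} (hu : u ∈ Ioo (0 : ℝ) 1) {x : ℝ} :
    quantile μ u ≤ x ↔ u ≤ cdf μ x := by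
  have hne : {x | u ≤ cdf μ x}.Nonempty := by
    obtain ⟨x, hx⟩ := ((tendsto_cdf_atTop μ).eventually (lt_mem_nhds hu.2)).exists
    exact ⟨x, hx.le⟩
  have hbdd : BddBelow {x | u ≤ cdf μ x} := by
    obtain ⟨z, hz⟩ := ((tendsto_cdf_atBot μ).eventually (gt_mem_nhds hu.1)).exists
    refine ⟨z, fun y hy => ?_⟩
    by_contra hlt
    exact absurd hy (not_le.mpr ((monotone_cdf μ (not_le.mp hlt).le).trans_lt hz))
  constructor
  · intro hle
    have hev : ∀ y, x < y → u ≤ cdf μ y := by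
      intro y hy
      obtain ⟨z, hz, hzy⟩ := exists_lt_of_csInf_lt hne (hle.trans_lt hy)
      exact (show u ≤ cdf μ z from hz).trans (monotone_cdf μ hzy.le)
    have hc := (cdf μ).right_continuous x
    have : Tendsto (cdf μ) (𝓝[>] x) (𝓝 (cdf μ x)) :=
      hc.tendsto.mono_left (nhdsWithin_mono _ Ioi_subset_Ici_self)
    refine ge_of_tendsto this ?_
    filter_upwards [self_mem_nhdsWithin] with y hy using hev y hy
  · exact fun h => csInf_le hbdd h

/-- Both quantile functions are evaluated at the same uniform variable; a larger distribution
function has a smaller quantile function. -/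
theorem quantile_coupling {μ ν : Measure ℝ} [IsProbabilityMeasure μ] [IsProbabilityMeasure ν]
    (h : ∀ t, μ (Iic t) ≤ ν (Iic t)) :
    ∃ γ : Measure (ℝ × ℝ), IsProbabilityMeasure γ ∧ γ.map Prod.fst = μ ∧ γ.map Prod.snd = ν ∧
      ∀ᵐ w ∂γ, w.2 ≤ w.1 := by
  let P : Measure ℝ := volume.restrict (Ioo 0 1)
  have hP : IsProbabilityMeasure P := ⟨by simp [P]⟩
  have hmem : ∀ᵐ u ∂P, u ∈ Ioo (0 : ℝ) 1 := ae_restrict_mem measurableSet_Ioo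
  have hmono : ∀ ρ : Measure ℝ, MonotoneOn (quantile ρ) (Ioo 0 1) := fun ρ u hu v hv huv =>
    (quantile_le_iff hu).mpr (huv.trans ((quantile_le_iff hv).mp le_rfl))
  have hq : ∀ ρ : Measure ℝ, AEMeasurable (quantile ρ) P := fun ρ =>
    aemeasurable_restrict_of_monotoneOn measurableSet_Ioo (hmono ρ)
  have hlaw : ∀ ρ : Measure ℝ, IsProbabilityMeasure ρ → P.map (quantile ρ) = ρ := by
    intro ρ hρ
    have : IsProbabilityMeasure (P.map (quantile ρ)) := Measure.isProbabilityMeasure_map (hq ρ)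
    refine Measure.ext_of_Iic _ _ fun x => ?_
    rw [Measure.map_apply_of_aemeasurable (hq ρ) measurableSet_Iic, ← ofReal_cdf ρ]
    have e : (quantile ρ ⁻¹' Iic x : Set ℝ) =ᵐ[P] Iic (cdf ρ x) := by
      filter_upwards [hmem] with u hu
      exact propext (quantile_le_iff hu)
    rw [measure_congr e, Measure.restrict_apply measurableSet_Iic]
    have hc0 := cdf_nonneg ρ x
    have hc1 := cdf_le_one ρ x
    refine le_antisymm ?_ ?_
    · refine (measure_mono (t := Ioc 0 (cdf ρ x)) fun u hu => ⟨hu.2.1, hu.1⟩).trans ?_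
      rw [Real.volume_Ioc, sub_zero]
    · have : Ioo 0 (cdf ρ x) ⊆ Iic (cdf ρ x) ∩ Ioo 0 1 := fun u hu =>
        ⟨hu.2.le, hu.1, hu.2.trans_le hc1⟩
      refine le_trans ?_ (measure_mono this)
      rw [Real.volume_Ioo, sub_zero]
  have hpair : AEMeasurable (fun u => (quantile μ u, quantile ν u)) P := (hq μ).prodMk (hq ν)
  refine ⟨P.map fun u => (quantile μ u, quantile ν u), Measure.isProbabilityMeasure_map hpair,
    ?_, ?_, ?_⟩
  · rw [AEMeasurable.map_map_of_aemeasurable measurable_fst.aemeasurable hpair]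
    exact hlaw μ inferInstance
  · rw [AEMeasurable.map_map_of_aemeasurable measurable_snd.aemeasurable hpair]
    exact hlaw ν inferInstance
  · rw [ae_map_iff hpair (measurableSet_le measurable_snd measurable_fst)]
    filter_upwards [hmem] with u hu
    rw [quantile_le_iff hu]
    have h1 : u ≤ cdf μ (quantile μ u) := (quantile_le_iff hu).mp le_rfl
    refine h1.trans ?_
    have := h (quantile μ u)
    rw [← ofReal_cdf, ← ofReal_cdf, ENNReal.ofReal_le_ofReal_iff (cdf_nonneg _ _)] at this
    exact this

theorem map_fst_le_map_snd_add (γ : Measure (ℝ × ℝ)) {A : Set ℝ} (hA : MeasurableSet A) :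
    γ.map Prod.fst A ≤ γ.map Prod.snd A + γ {w | w.1 ≠ w.2} := by
  rw [Measure.map_apply measurable_fst hA, Measure.map_apply measurable_snd hA]
  refine (measure_mono fun w hw => ?_).trans (measure_union_le _ _)
  by_cases h : w.1 = w.2
  · left; simpa [← h] using hw
  · right; exact h

theorem map_snd_le_map_fst_add (γ : Measure (ℝ × ℝ)) {A : Set ℝ} (hA : MeasurableSet A) :
    γ.map Prod.snd A ≤ γ.map Prod.fst A + γ {w | w.1 ≠ w.2} := by
  rw [Measure.map_apply measurable_fst hA, Measure.map_apply measurable_snd hA]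
  refine (measure_mono fun w hw => ?_).trans (measure_union_le _ _)
  by_cases h : w.1 = w.2
  · left; simpa [h] using hw
  · right; exact h

theorem abs_map_fst_sub_map_snd_le (γ : Measure (ℝ × ℝ)) [IsFiniteMeasure γ] {A : Set ℝ}
    (hA : MeasurableSet A) :
    |(γ.map Prod.fst).real A - (γ.map Prod.snd).real A| ≤ γ.real {w | w.1 ≠ w.2} := by
  have h1 := ENNReal.toReal_mono (by finiteness) (map_fst_le_map_snd_add γ hA)
  have h2 := ENNReal.toReal_mono (by finiteness) (map_snd_le_map_fst_add γ hA)
  rw [ENNReal.toReal_add (by finiteness) (by finiteness)] at h1 h2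
  rw [abs_le]
  unfold Measure.real
  constructor <;> linarith

theorem comp_pow_map {S S' : Type*} [MeasurableSpace S] [MeasurableSpace S'] {κ : Kernel S S}
    {μ : Measure S} [IsMarkovKernel κ] [IsProbabilityMeasure μ] {κ' : Kernel S' S'}
    [IsMarkovKernel κ'] {f : S → S'} (hf : Measurable f) {A : Set S} (hA : MeasurableSet A)
    (hκ : ∀ w ∈ A, ∀ᵐ v ∂κ w, v ∈ A) (hμ : ∀ᵐ w ∂μ, w ∈ A)
    (h : ∀ w ∈ A, (κ w).map f = κ' (f w)) (n : ℕ) :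
    ((κ ^ n) ∘ₘ μ).map f = (κ' ^ n) ∘ₘ (μ.map f) := by
  have hp : IsProbabilityMeasure (μ.map f) := Measure.isProbabilityMeasure_map hf.aemeasurable
  rw [← chainLaw_map_eval, ← chainLaw_map_eval, ← chainLaw_map_comp hf hA hκ hμ h,
    Measure.map_map hf (by fun_prop), Measure.map_map (by fun_prop) (by fun_prop)]
  rfl

end MeasureLemmas

/-! ### Geometric coupling and the stationary law -/

namespace IsPantographLaw

open Filter Topology

variable {Λ : Measure ℝ} {α : ℝ} {a : ℝ → ℝ≥0∞} {D b : ℝ} [IsProbabilityMeasure Λ]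

/-- For small w the drift alone contracts, since w^{-θ} outweighs the constants. For the remaining w
the factor 1 - Λ((0, w/α)) is at most 1 - ε, and a large B lets this gain absorb the additive
constant of the drift. -/
theorem exists_contraction (h : IsPantographLaw Λ α a D b) (hα₀ : 0 < α)
    (hα₁ : α < 1) {θ : ℝ} (hθ₀ : 0 < θ) (hθ₁ : θ ≤ 1 / 2) :
    ∃ B : ℝ, 0 < B ∧ ∃ κ : ℝ, 0 < κ ∧ κ < 1 ∧ ∀ w, 0 < w →
      (1 - Λ (Ioo 0 (w / α))) *
          ∫⁻ x, (ENNReal.ofReal (x ^ (-θ)) + ENNReal.ofReal B) ∂Λ[|Ioo 0 (w / α)] ≤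
        ENNReal.ofReal κ * (ENNReal.ofReal (w ^ (-θ)) + ENNReal.ofReal B) := by
  have hL := h.measure_Ioo_ne_zero hα₀ hα₁
  obtain ⟨ρ, hρ₀, hρ₁, C, hC, hdrift⟩ := h.exists_drift hα₀ hα₁ hθ₀ hθ₁
  -- `R` separates the two regimes for v = w^{-θ}: it gives C + ρR = R - C, so drift wins by C at v
  -- = R. The condition v ≤ R means w ≥ R^{-1/θ}, whence the choice of ε as a mass.
  obtain ⟨R, hR⟩ : ∃ R, R = 2 * C / (1 - ρ) := ⟨_, rfl⟩
  have h1ρ : 0 < 1 - ρ := by linarith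
  have hRp : 0 < R := by rw [hR]; positivity
  have hRC : R * (1 - ρ) = 2 * C := by rw [hR]; field_simp
  obtain ⟨ε, hε⟩ : ∃ ε, ε = Λ.real (Ioo 0 (R ^ (-θ⁻¹) / α)) := ⟨_, rfl⟩
  have hεp : 0 < ε := by
    rw [hε]; exact ENNReal.toReal_pos (hL _ (by positivity)) (measure_ne_top _ _)
  have hε1 : ε ≤ 1 := by rw [hε]; exact measureReal_le_one
  -- This makes C equal to half of εB, so that C + (1 - ε)B = (1 - ε/2)B.
  obtain ⟨B, hB⟩ : ∃ B, B = 2 * C / ε := ⟨_, rfl⟩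
  have hBp : 0 < B := by rw [hB]; positivity
  have hBC : B * ε = 2 * C := by rw [hB]; field_simp
  -- The factor for which the drift bound is an equality at v = R; since ρ ≤ κ₁ the bound persists
  -- for all larger v.
  obtain ⟨κ₁, hκ₁⟩ : ∃ κ₁, κ₁ = (C + B + ρ * R) / (R + B) := ⟨_, rfl⟩
  have hκ₁m : κ₁ * (R + B) = C + B + ρ * R := by rw [hκ₁]; field_simp
  have hκ₁lt : κ₁ < 1 := by rw [hκ₁, div_lt_one (by positivity)]; nlinarith
  have hκ₁ρ : ρ ≤ κ₁ := by rw [hκ₁, le_div_iff₀ (by positivity)]; nlinarith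
  refine ⟨B, hBp, max κ₁ (1 - ε / 2), lt_max_of_lt_right (by linarith),
    max_lt hκ₁lt (by linarith), fun w hw => ?_⟩
  have hp : IsProbabilityMeasure (Λ[|Ioo 0 (w / α)]) :=
    cond_isProbabilityMeasure (hL _ (by positivity))
  obtain ⟨v, hv⟩ : ∃ v, v = w ^ (-θ) := ⟨_, rfl⟩
  have hvp : 0 < v := by rw [hv]; positivity
  have hl1 : Λ.real (Ioo 0 (w / α)) ≤ 1 := measureReal_le_one
  have e1 : (1 : ℝ≥0∞) - Λ (Ioo 0 (w / α)) = ENNReal.ofReal (1 - Λ.real (Ioo 0 (w / α))) := by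
    rw [ENNReal.ofReal_sub _ measureReal_nonneg, ofReal_measureReal, ENNReal.ofReal_one]
  have e2 : ∫⁻ x, (ENNReal.ofReal (x ^ (-θ)) + ENNReal.ofReal B) ∂Λ[|Ioo 0 (w / α)] ≤
      ENNReal.ofReal (ρ * v + C + B) := by
    rw [lintegral_add_right _ measurable_const, lintegral_const, measure_univ, mul_one,
      ENNReal.ofReal_add (by positivity) hBp.le, hv]
    gcongr
    exact hdrift w hw
  rw [← hv, e1, ← ENNReal.ofReal_add hvp.le hBp.le, ← ENNReal.ofReal_mul (hρ₀.le.trans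
    (hκ₁ρ.trans (le_max_left _ _)))]
  refine (mul_le_mul_right e2 _).trans ?_
  rw [← ENNReal.ofReal_mul (by linarith)]
  refine ENNReal.ofReal_le_ofReal ?_
  have hm1 := le_max_left κ₁ (1 - ε / 2)
  have hm2 := le_max_right κ₁ (1 - ε / 2)
  rcases le_or_gt v R with hvR | hvR
  · have hεl : ε ≤ Λ.real (Ioo 0 (w / α)) := by
      rw [hε]
      refine measureReal_mono (Ioo_subset_Ioo_right ?_)
      gcongr
      have : w = v ^ (-θ⁻¹) := by
        rw [hv, ← Real.rpow_mul hw.le]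
        rw [neg_mul_neg, mul_inv_cancel₀ hθ₀.ne', Real.rpow_one]
      rw [this]
      exact Real.rpow_le_rpow_of_nonpos hvp hvR (by simpa using hθ₀.le)
    calc (1 - Λ.real (Ioo 0 (w / α))) * (ρ * v + C + B)
        ≤ (1 - ε) * (ρ * v + C + B) := by gcongr
      _ ≤ κ₁ * v + (1 - ε / 2) * B := by
          have h2 : 0 ≤ ρ * v := by positivity
          nlinarith
      _ ≤ max κ₁ (1 - ε / 2) * v + max κ₁ (1 - ε / 2) * B := by gcongr
      _ = _ := by ring
  · calc (1 - Λ.real (Ioo 0 (w / α))) * (ρ * v + C + B) ≤ 1 * (ρ * v + C + B) := by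
          gcongr
          linarith [measureReal_nonneg (μ := Λ) (s := Ioo 0 (w / α))]
      _ ≤ κ₁ * (v + B) := by nlinarith
      _ ≤ _ := by gcongr

/-- The contracted function is at least `B` off the diagonal and at most 1 + B times the integrand
on the right, so iterating the contraction bounds the mass off the diagonal. -/
theorem exists_offDiag_decay (h : IsPantographLaw Λ α a D b) (hα₀ : 0 < α)
    (hα₁ : α < 1) {θ : ℝ} (hθ₀ : 0 < θ) (hθ₁ : θ ≤ 1 / 2) :
    ∃ c : ℝ, 0 < c ∧ ∃ lam : ℝ, 0 < lam ∧ ∀ μ : Measure (ℝ × ℝ),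
      (∀ᵐ w ∂μ, w ∈ posPairs) → ∀ n : ℕ,
        ((pairKernel Λ α ^ n) ∘ₘ μ) {w | w.1 ≠ w.2} ≤
          ENNReal.ofReal (c * Real.exp (-lam * n)) *
            ∫⁻ w, ENNReal.ofReal ((min w.1 w.2) ^ (-θ) + 1) ∂μ := by
  have hL := h.measure_Ioo_ne_zero hα₀ hα₁
  obtain ⟨B, hB, κ, hκ₀, hκ₁, hk⟩ := h.exists_contraction hα₀ hα₁ hθ₀ hθ₁
  have hH : Measurable fun x : ℝ => ENNReal.ofReal (x ^ (-θ)) + ENNReal.ofReal B := by fun_prop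
  have hlog : Real.log κ < 0 := Real.log_neg hκ₀ hκ₁
  refine ⟨(1 + B) / B, by positivity, -Real.log κ, by linarith, fun μ hμ n => ?_⟩
  have hkn : Real.exp (-(-Real.log κ) * n) = κ ^ n := by
    rw [neg_neg, mul_comm, Real.exp_nat_mul, Real.exp_log hκ₀]
  have key := lintegral_comp_pow_le measurableSet_posPairs
    (ae_pairKernel_mem_posPairs hα₀ hL) hμ (measurable_offDiagFun hH)
    (lintegral_offDiagFun_pairKernel_le hα₀ hL hH hk) n
  have hlow : ENNReal.ofReal B * ((pairKernel Λ α ^ n) ∘ₘ μ) {w | w.1 ≠ w.2} ≤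
      ∫⁻ w, offDiagFun (fun x : ℝ => ENNReal.ofReal (x ^ (-θ)) + ENNReal.ofReal B) w
        ∂((pairKernel Λ α ^ n) ∘ₘ μ) := by
    rw [← setLIntegral_const, ← lintegral_indicator measurableSet_offDiag]
    refine lintegral_mono fun w => ?_
    unfold offDiagFun
    refine indicator_le_indicator' fun _ => ?_
    exact le_add_self
  have hup : ∫⁻ w, offDiagFun (fun x : ℝ => ENNReal.ofReal (x ^ (-θ)) + ENNReal.ofReal B) w ∂μ ≤
      ENNReal.ofReal (1 + B) * ∫⁻ w, ENNReal.ofReal ((min w.1 w.2) ^ (-θ) + 1) ∂μ := by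
    rw [← lintegral_const_mul _ (by fun_prop)]
    refine lintegral_mono_ae ?_
    filter_upwards [hμ] with w hw
    refine (indicator_le_self _ _ _).trans ?_
    have hm : 0 < min w.1 w.2 := lt_min hw.1 hw.2
    have hv : 0 < (min w.1 w.2) ^ (-θ) := by positivity
    beta_reduce
    rw [← ENNReal.ofReal_add hv.le hB.le, ← ENNReal.ofReal_mul (by positivity)]
    refine ENNReal.ofReal_le_ofReal ?_
    nlinarith [mul_pos hB hv]
  have hB0 : ENNReal.ofReal B ≠ 0 := by simpa using hB
  calc ((pairKernel Λ α ^ n) ∘ₘ μ) {w | w.1 ≠ w.2}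
      = (ENNReal.ofReal B)⁻¹ *
          (ENNReal.ofReal B * ((pairKernel Λ α ^ n) ∘ₘ μ) {w | w.1 ≠ w.2}) := by
        rw [← mul_assoc, ENNReal.inv_mul_cancel hB0 ENNReal.ofReal_ne_top, one_mul]
    _ ≤ (ENNReal.ofReal B)⁻¹ * (ENNReal.ofReal κ ^ n * (ENNReal.ofReal (1 + B) *
          ∫⁻ w, ENNReal.ofReal ((min w.1 w.2) ^ (-θ) + 1) ∂μ)) := by
        exact mul_le_mul_right (hlow.trans (key.trans (mul_le_mul_right hup _))) _
    _ = _ := by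
        rw [hkn, ENNReal.ofReal_mul (by positivity), ENNReal.ofReal_div_of_pos hB,
          ENNReal.ofReal_pow hκ₀.le, ENNReal.div_eq_inv_mul]
        ring

/-- The initial law may have no negative moment: the geometric decay holds from each starting point,
and probabilities are dominated by 1. -/
theorem tendsto_offDiag (h : IsPantographLaw Λ α a D b) (hα₀ : 0 < α) (hα₁ : α < 1)
    {μ : Measure (ℝ × ℝ)} [IsProbabilityMeasure μ] (hμ : ∀ᵐ w ∂μ, w ∈ posPairs) :
    Tendsto (fun n : ℕ => ((pairKernel Λ α ^ n) ∘ₘ μ) {w | w.1 ≠ w.2}) atTop (𝓝 0) := by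
  obtain ⟨c, hc, lam, hlam, hdecay⟩ := h.exists_offDiag_decay hα₀ hα₁ (θ := 1 / 2) (by norm_num)
    le_rfl
  have e : ∀ n : ℕ, ((pairKernel Λ α ^ n) ∘ₘ μ) {w | w.1 ≠ w.2} =
      ∫⁻ w, (pairKernel Λ α ^ n) w {w | w.1 ≠ w.2} ∂μ := fun n =>
    Measure.bind_apply measurableSet_offDiag (Kernel.aemeasurable _)
  simp only [e]
  rw [← lintegral_zero (μ := μ)]
  refine tendsto_lintegral_of_dominated_convergence (fun _ => 1)
    (fun n => Kernel.measurable_coe _ measurableSet_offDiag)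
    (fun n => Eventually.of_forall fun w => prob_le_one) (by simp) ?_
  filter_upwards [hμ] with w hw
  have hb : ∀ n : ℕ, (pairKernel Λ α ^ n) w {w | w.1 ≠ w.2} ≤
      ENNReal.ofReal (c * Real.exp (-lam * n)) *
        ENNReal.ofReal ((min w.1 w.2) ^ (-(1 / 2) : ℝ) + 1) := by
    intro n
    have := hdecay (Measure.dirac w)
      ((ae_dirac_iff measurableSet_posPairs).mpr hw) n
    rwa [Measure.dirac_bind (Kernel.measurable _), lintegral_dirac' _ (by fun_prop)] at this
  refine tendsto_of_tendsto_of_tendsto_of_le_of_le tendsto_const_nhds ?_ (fun n => zero_le) hb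
  have h1 : Tendsto (fun n : ℕ => c * Real.exp (-lam * n)) atTop (𝓝 (c * 0)) := by
    refine Tendsto.const_mul _ (Real.tendsto_exp_atBot.comp ?_)
    exact tendsto_natCast_atTop_atTop.const_mul_atTop_of_neg (by linarith)
  have h2 := ENNReal.Tendsto.mul_const (ENNReal.tendsto_ofReal h1)
    (b := ENNReal.ofReal ((min w.1 w.2) ^ (-(1 / 2) : ℝ) + 1)) (Or.inr ENNReal.ofReal_ne_top)
  simpa using h2

/-! ### Domination by `Λ` along the chain -/

/-- The reciprocal of the mass that `Λ` gives to `(0, w / α)`. -/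
noncomputable def invMass (Λ : Measure ℝ) (α w : ℝ) : ℝ≥0∞ := (Λ (Ioo 0 (w / α)))⁻¹

omit [IsProbabilityMeasure Λ] in
theorem measurable_invMass : Measurable (invMass Λ α) := (measurable_measure_Ioo_div Λ α).inv

omit [IsProbabilityMeasure Λ] in
-- The factor Λ((0, x/α)) in the density of Λ cancels the reciprocal mass.
theorem setLIntegral_invMass_le (h : IsPantographLaw Λ α a D b) {s : Set ℝ}
    (hs : MeasurableSet s) (hs0 : s ⊆ Ioi 0) :
    ∫⁻ x in s, invMass Λ α x ∂Λ ≤ ∫⁻ x in s, a x := by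
  rw [h.setLIntegral_eq hs hs0 measurable_invMass]
  refine lintegral_mono fun x => ?_
  rw [mul_assoc]
  exact mul_le_of_le_one_right zero_le (ENNReal.mul_inv_le_one _)

omit [IsProbabilityMeasure Λ] in
theorem lintegral_invMass_ne_top (h : IsPantographLaw Λ α a D b) :
    ∫⁻ x, invMass Λ α x ∂Λ ≠ ⊤ := by
  have e : ∫⁻ x, invMass Λ α x ∂Λ = ∫⁻ x in Ioi 0, invMass Λ α x ∂Λ := by
    rw [Measure.restrict_eq_self_of_ae_mem (s := Ioi 0) h.ae_pos]
  rw [e]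
  refine ((h.setLIntegral_invMass_le measurableSet_Ioi subset_rfl).trans
    (setLIntegral_mono' measurableSet_Ioi fun x hx => h.le_exp x hx)).trans_lt ?_ |>.ne
  have hi := (exp_neg_integrableOn_Ioi 0 h.pos_rate).const_mul D
  exact hi.lintegral_lt_top

/-- For w/α ≤ 1/(2D), the cancellation leaves an integral of `a` over (0, w/α), at most D w/α ≤ 1/2,
multiplied by the normalization, which is the reciprocal mass at w. For larger w the normalization
is bounded. -/
theorem exists_drift_invMass (h : IsPantographLaw Λ α a D b) (hα₀ : 0 < α) (hα₁ : α < 1) :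
    ∃ C : ℝ≥0∞, C ≠ ⊤ ∧ ∀ w, 0 < w →
      ∫⁻ x, invMass Λ α x ∂stepKernel Λ α w ≤ 2⁻¹ * invMass Λ α w + C := by
  have hL := h.measure_Ioo_ne_zero hα₀ hα₁
  have hD := h.pos_const
  refine ⟨(Λ (Ioo 0 (1 / (2 * D))))⁻¹ * ∫⁻ x, invMass Λ α x ∂Λ,
    ENNReal.mul_ne_top (ENNReal.inv_ne_top.mpr (hL _ (by positivity)))
      h.lintegral_invMass_ne_top, fun w hw => ?_⟩
  rw [stepKernel_apply hα₀ hL hw, lintegral_cond_eq]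
  rcases le_or_gt (w / α) (1 / (2 * D)) with hle | hlt
  · refine le_add_right ?_
    rw [mul_comm]
    refine mul_le_mul_left ?_ _
    refine (h.setLIntegral_invMass_le measurableSet_Ioo fun x hx => hx.1).trans ?_
    calc ∫⁻ x in Ioo 0 (w / α), a x ≤ ∫⁻ x in Ioo 0 (w / α), ENNReal.ofReal D :=
          setLIntegral_mono' measurableSet_Ioo fun x hx => h.le_const hx.1
      _ = ENNReal.ofReal (D * (w / α)) := by
          rw [setLIntegral_const, Real.volume_Ioo, sub_zero, ENNReal.ofReal_mul hD.le]
      _ ≤ ENNReal.ofReal 2⁻¹ := by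
          refine ENNReal.ofReal_le_ofReal ?_
          rw [le_div_iff₀ (by positivity)] at hle
          linarith
      _ = 2⁻¹ := by rw [ENNReal.ofReal_inv_of_pos two_pos]; norm_num
  · refine le_add_left ?_
    refine mul_le_mul' (ENNReal.inv_le_inv.mpr (measure_mono (Ioo_subset_Ioo_right hlt.le))) ?_
    exact setLIntegral_le_lintegral _ _

/-- From w, the step law is Λ restricted and divided by a mass, hence at most the reciprocal mass
times Λ. -/
theorem step_comp_le (h : IsPantographLaw Λ α a D b) (hα₀ : 0 < α) (hα₁ : α < 1)
    {μ : Measure ℝ} (hμ : ∀ᵐ w ∂μ, 0 < w) :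
    stepKernel Λ α ∘ₘ μ ≤ (∫⁻ w, invMass Λ α w ∂μ) • Λ := by
  have hL := h.measure_Ioo_ne_zero hα₀ hα₁
  refine Measure.le_iff.mpr fun A hA => ?_
  rw [Measure.bind_apply hA (Kernel.aemeasurable _), Measure.smul_apply, smul_eq_mul,
    ← lintegral_mul_const _ measurable_invMass]
  refine lintegral_mono_ae ?_
  filter_upwards [hμ] with w hw
  rw [stepKernel_apply hα₀ hL hw, cond_apply measurableSet_Ioo]
  unfold invMass
  gcongr
  exact inter_subset_right

theorem ae_stepKernel_pos (h : IsPantographLaw Λ α a D b) (hα₀ : 0 < α) (hα₁ : α < 1) :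
    ∀ w ∈ Ioi (0 : ℝ), ∀ᵐ v ∂stepKernel Λ α w, v ∈ Ioi (0 : ℝ) := fun w hw => by
  rw [stepKernel_apply hα₀ (h.measure_Ioo_ne_zero hα₀ hα₁) hw]
  filter_upwards [ae_cond_mem measurableSet_Ioo] with x hx using hx.1

omit [IsProbabilityMeasure Λ] in
theorem smul_measure_mono {c c' : ℝ≥0∞} (hc : c ≤ c') : c • Λ ≤ c' • Λ :=
  Measure.le_iff.mpr fun A _ => by
    rw [Measure.smul_apply, Measure.smul_apply, smul_eq_mul, smul_eq_mul]
    gcongr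

/-- The drift keeps the mean reciprocal mass bounded in n, and one further step turns that mean into
a bound by Λ. Domination at time 0 is assumed, and it also makes the initial mean finite. -/
theorem exists_comp_pow_le (h : IsPantographLaw Λ α a D b) (hα₀ : 0 < α) (hα₁ : α < 1)
    {F : Measure ℝ} [IsProbabilityMeasure F] (hF : ∀ᵐ w ∂F, 0 < w) {z : ℝ≥0∞} (hz : z ≠ ⊤) (hFz : F ≤ z • Λ) :
    ∃ K : ℝ≥0∞, K ≠ ⊤ ∧ ∀ n : ℕ, (stepKernel Λ α ^ n) ∘ₘ F ≤ K • Λ := by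
  obtain ⟨C, hC, hdrift⟩ := h.exists_drift_invMass hα₀ hα₁
  have hpos := ae_mem_comp_pow measurableSet_Ioi (h.ae_stepKernel_pos hα₀ hα₁) hF
  have hfin : ∫⁻ w, invMass Λ α w ∂F ≠ ⊤ := by
    refine ne_top_of_le_ne_top ?_ (lintegral_mono' hFz le_rfl)
    rw [lintegral_smul_measure]
    exact ENNReal.mul_ne_top hz h.lintegral_invMass_ne_top
  have hg : ∀ n : ℕ, ∫⁻ w, invMass Λ α w ∂((stepKernel Λ α ^ n) ∘ₘ F) ≤
      ∫⁻ w, invMass Λ α w ∂F + 2 * C := by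
    intro n
    induction n with
    | zero => rw [comp_pow_zero]; exact le_self_add
    | succ n ih =>
      rw [comp_pow_succ, Measure.lintegral_bind (Kernel.aemeasurable _)
        measurable_invMass.aemeasurable]
      calc ∫⁻ w, ∫⁻ x, invMass Λ α x ∂stepKernel Λ α w ∂((stepKernel Λ α ^ n) ∘ₘ F)
          ≤ ∫⁻ w, (2⁻¹ * invMass Λ α w + C) ∂((stepKernel Λ α ^ n) ∘ₘ F) := by
            refine lintegral_mono_ae ?_
            filter_upwards [hpos n] with w hw using hdrift w hw
        _ ≤ 2⁻¹ * (∫⁻ w, invMass Λ α w ∂F + 2 * C) + C := by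
            rw [lintegral_add_right _ measurable_const, lintegral_const_mul _ measurable_invMass,
              lintegral_const]
            gcongr
            rw [measure_univ, mul_one]
        _ ≤ _ := by
            rw [mul_add, ← mul_assoc, ENNReal.inv_mul_cancel two_ne_zero (by simp), one_mul,
              add_assoc, ← two_mul]
            gcongr
            exact mul_le_of_le_one_left zero_le (by simp)
  refine ⟨max z (∫⁻ w, invMass Λ α w ∂F + 2 * C), ?_, fun n => ?_⟩
  · exact max_lt hz.lt_top (ENNReal.add_lt_top.mpr ⟨hfin.lt_top, by finiteness⟩) |>.ne
  · cases n with
    | zero =>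
      rw [comp_pow_zero]
      exact hFz.trans (smul_measure_mono (le_max_left _ _))
    | succ n =>
      rw [comp_pow_succ]
      refine (h.step_comp_le hα₀ hα₁ (hpos n)).trans ?_
      exact smul_measure_mono ((hg n).trans (le_max_right _ _))

end IsPantographLaw

/-! ### The stationary law and the monotone coupling -/

/-- On a Hahn decomposition the positive and the negative part each have mass at most ε; hence the
factor 2. -/
theorem totalVariation_univ_le {S : Type*} [MeasurableSpace S] (μ ν : Measure S)
    [IsFiniteMeasure μ] [IsFiniteMeasure ν] {ε : ℝ}
    (h : ∀ A, MeasurableSet A → |μ.real A - ν.real A| ≤ ε) :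
    (μ.toSignedMeasure - ν.toSignedMeasure).totalVariation univ ≤ ENNReal.ofReal (2 * ε) := by
  obtain ⟨i, hi₁, hi₂, hi₃, hp, hn⟩ :=
    (μ.toSignedMeasure - ν.toSignedMeasure).toJordanDecomposition_spec
  have e : (μ.toSignedMeasure - ν.toSignedMeasure).totalVariation.real univ =
      (μ.real i - ν.real i) - (μ.real iᶜ - ν.real iᶜ) := by
    rw [SignedMeasure.totalVariation, measureReal_add_apply, hp, hn,
      SignedMeasure.toMeasureOfZeroLE_real_apply _ hi₂ hi₁ MeasurableSet.univ,
      SignedMeasure.toMeasureOfLEZero_real_apply _ hi₃ hi₁.compl MeasurableSet.univ,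
      inter_univ, inter_univ, Measure.toSignedMeasure_sub_apply hi₁,
      Measure.toSignedMeasure_sub_apply hi₁.compl]
    ring
  rw [← ofReal_measureReal (measure_ne_top _ _), e]
  refine ENNReal.ofReal_le_ofReal ?_
  have h1 := abs_le.mp (h i hi₁)
  have h2 := abs_le.mp (h iᶜ hi₁.compl)
  linarith [h1.2, h2.1]

/-- Not having met by time n implies being apart at time n. Persistence after meeting plays no role
in this direction. -/
theorem chainLaw_couplingTime_le (κ : Kernel (ℝ × ℝ) (ℝ × ℝ)) [IsMarkovKernel κ]
    (μ : Measure (ℝ × ℝ)) [IsProbabilityMeasure μ] (n : ℕ) :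
    chainLaw κ μ {ω | (n : ℕ∞) < couplingTime (fun k => (ω k).1) (fun k => (ω k).2)} ≤
      ((κ ^ n) ∘ₘ μ) {w | w.1 ≠ w.2} := by
  rw [← chainLaw_map_eval, Measure.map_apply (measurable_pi_apply n) measurableSet_offDiag]
  exact measure_mono fun ω hω => couplingTime_lt_imp hω

theorem couplingTime_le_imp {x y : ℕ → ℝ} {n : ℕ} (h : couplingTime x y ≤ n) :
    ∃ k ≤ n, x k = y k := by
  by_contra hcon
  push Not at hcon
  have : ((n + 1 : ℕ) : ℕ∞) ≤ couplingTime x y := by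
    refine le_iInf₂ fun k hk => ?_
    have : n < k := by
      by_contra hle
      exact hcon k (not_lt.mp hle) hk
    exact_mod_cast this
  have h2 := this.trans h
  exact absurd (by exact_mod_cast h2 : n + 1 ≤ n) (by omega)

namespace IsPantographLaw

open Filter Topology

variable {Λ : Measure ℝ} {α : ℝ} {a : ℝ → ℝ≥0∞} {D b : ℝ} [IsProbabilityMeasure Λ]

theorem exists_couplingTime_bound (h : IsPantographLaw Λ α a D b) (hα₀ : 0 < α) (hα₁ : α < 1)
    (θ : ℝ) (hθ : 0 < θ) : ∃ c : ℝ, 0 < c ∧ ∃ lam : ℝ, 0 < lam ∧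
      ∀ (n : ℕ) (w₁ w₂ : ℝ), 0 < w₁ → 0 < w₂ →
        chainLaw (pairKernel Λ α) (Measure.dirac (w₁, w₂))
            {ω | (n : ℕ∞) < couplingTime (fun k => (ω k).1) (fun k => (ω k).2)} ≤
          ENNReal.ofReal (c * ((min w₁ w₂) ^ (-θ) + 1) * Real.exp (-lam * n)) := by
  -- The decay is available only for exponents at most 1/2. Lowering the exponent costs nothing, as
  -- m^{-θ'} ≤ m^{-θ} + 1 for θ' ≤ θ and m > 0.
  obtain ⟨c, hc, lam, hlam, hdecay⟩ := h.exists_offDiag_decay hα₀ hα₁ (θ := min θ (1 / 2))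
    (by positivity) (min_le_right _ _)
  refine ⟨c * 2, by positivity, lam, hlam, fun n w₁ w₂ h₁ h₂ => ?_⟩
  refine (chainLaw_couplingTime_le _ _ n).trans ((hdecay _
    ((ae_dirac_iff measurableSet_posPairs).mpr ⟨h₁, h₂⟩) n).trans ?_)
  rw [lintegral_dirac' _ (by fun_prop), ← ENNReal.ofReal_mul (by positivity)]
  refine ENNReal.ofReal_le_ofReal ?_
  have hm : 0 < min w₁ w₂ := lt_min h₁ h₂
  have hv : 0 < (min w₁ w₂) ^ (-θ) := by positivity
  have key : (min w₁ w₂) ^ (-min θ (1 / 2)) ≤ (min w₁ w₂) ^ (-θ) + 1 := by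
    rcases le_or_gt 1 (min w₁ w₂) with h1 | h1
    · have := Real.rpow_le_one_of_one_le_of_nonpos h1
        (z := -min θ (1 / 2)) (by simp; positivity)
      linarith
    · have := Real.rpow_le_rpow_of_exponent_ge hm h1.le
        (y := -min θ (1 / 2)) (z := -θ) (by simp)
      linarith
  have he := Real.exp_pos (-lam * n)
  calc c * Real.exp (-lam * n) * ((min w₁ w₂) ^ (-min θ (1 / 2)) + 1)
      ≤ c * Real.exp (-lam * n) * (2 * ((min w₁ w₂) ^ (-θ) + 1)) := by
        gcongr; linarith
    _ = _ := by ring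

theorem ae_couplingTime_lt_top (h : IsPantographLaw Λ α a D b) (hα₀ : 0 < α) (hα₁ : α < 1)
    (μ : Measure (ℝ × ℝ)) [IsProbabilityMeasure μ] (hμ : ∀ᵐ w ∂μ, 0 < w.1 ∧ 0 < w.2) :
    ∀ᵐ ω ∂(chainLaw (pairKernel Λ α) μ),
      couplingTime (fun k => (ω k).1) (fun k => (ω k).2) < ⊤ := by
  rw [ae_iff]
  refine le_antisymm ?_ zero_le
  refine ge_of_tendsto' (h.tendsto_offDiag hα₀ hα₁ (μ := μ) hμ) fun n => ?_
  refine le_trans (measure_mono fun ω hω => ?_) (chainLaw_couplingTime_le _ _ n)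
  have hω' : ¬ couplingTime (fun k => (ω k).1) (fun k => (ω k).2) < ⊤ := hω
  rw [not_lt, top_le_iff] at hω'
  change (n : ℕ∞) < _
  rw [hω']
  exact ENat.natCast_lt_top n

theorem pairKernel_pow_map_fst (h : IsPantographLaw Λ α a D b) (hα₀ : 0 < α) (hα₁ : α < 1)
    {μ : Measure (ℝ × ℝ)} [IsProbabilityMeasure μ] (hμ : ∀ᵐ w ∂μ, w ∈ posPairs) (n : ℕ) :
    ((pairKernel Λ α ^ n) ∘ₘ μ).map Prod.fst = (stepKernel Λ α ^ n) ∘ₘ (μ.map Prod.fst) :=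
  have hL := h.measure_Ioo_ne_zero hα₀ hα₁
  comp_pow_map measurable_fst measurableSet_posPairs (ae_pairKernel_mem_posPairs hα₀ hL) hμ
    (fun _ hw => pairKernel_map_fst hα₀ hL hw.1 hw.2) n

theorem pairKernel_pow_map_snd (h : IsPantographLaw Λ α a D b) (hα₀ : 0 < α) (hα₁ : α < 1)
    {μ : Measure (ℝ × ℝ)} [IsProbabilityMeasure μ] (hμ : ∀ᵐ w ∂μ, w ∈ posPairs) (n : ℕ) :
    ((pairKernel Λ α ^ n) ∘ₘ μ).map Prod.snd = (stepKernel Λ α ^ n) ∘ₘ (μ.map Prod.snd) :=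
  have hL := h.measure_Ioo_ne_zero hα₀ hα₁
  comp_pow_map measurable_snd measurableSet_posPairs (ae_pairKernel_mem_posPairs hα₀ hL) hμ
    (fun _ hw => pairKernel_map_snd hα₀ hL hw.1 hw.2) n

/-- The chains started from the marginals of a law on `(0, ∞)²` are as close at time `n` as the
probability that the coupled pair has not met by then. -/
theorem abs_comp_pow_sub_le (h : IsPantographLaw Λ α a D b) (hα₀ : 0 < α) (hα₁ : α < 1)
    {μ : Measure (ℝ × ℝ)} [IsProbabilityMeasure μ] (hμ : ∀ᵐ w ∂μ, w ∈ posPairs) (n : ℕ)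
    {A : Set ℝ} (hA : MeasurableSet A) :
    |((stepKernel Λ α ^ n) ∘ₘ (μ.map Prod.fst)).real A -
        ((stepKernel Λ α ^ n) ∘ₘ (μ.map Prod.snd)).real A| ≤
      ((pairKernel Λ α ^ n) ∘ₘ μ).real {w | w.1 ≠ w.2} := by
  rw [← h.pairKernel_pow_map_fst hα₀ hα₁ hμ, ← h.pairKernel_pow_map_snd hα₀ hα₁ hμ]
  exact abs_map_fst_sub_map_snd_le _ hA

theorem ae_posPairs_prod {μ ν : Measure ℝ} [SFinite μ] [SFinite ν] (hμ : ∀ᵐ w ∂μ, 0 < w)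
    (hν : ∀ᵐ w ∂ν, 0 < w) : ∀ᵐ w ∂μ.prod ν, w ∈ posPairs := by
  refine (Measure.ae_prod_iff_ae_ae (p := (· ∈ posPairs)) measurableSet_posPairs).mpr ?_
  filter_upwards [hμ] with x hx
  filter_upwards [hν] with y hy using ⟨hx, hy⟩

/-- The coupled pair started from the product law keeps both marginals fixed, while the probability
of being apart tends to zero. -/
theorem eq_of_invariant (h : IsPantographLaw Λ α a D b) (hα₀ : 0 < α) (hα₁ : α < 1)
    {π π' : Measure ℝ} [IsProbabilityMeasure π] [IsProbabilityMeasure π']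
    (hpos : ∀ᵐ w ∂π, 0 < w) (hpos' : ∀ᵐ w ∂π', 0 < w)
    (hinv : stepKernel Λ α ∘ₘ π = π) (hinv' : stepKernel Λ α ∘ₘ π' = π') : π' = π := by
  have hpow : ∀ ρ : Measure ℝ, stepKernel Λ α ∘ₘ ρ = ρ → ∀ n : ℕ,
      (stepKernel Λ α ^ n) ∘ₘ ρ = ρ := by
    intro ρ hρ n
    induction n with
    | zero => exact comp_pow_zero _ _
    | succ n ih => rw [comp_pow_succ, ih, hρ]
  have hpp := ae_posPairs_prod hpos' hpos
  have ht := h.tendsto_offDiag hα₀ hα₁ hpp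
  have ht' := (ENNReal.tendsto_toReal ENNReal.zero_ne_top).comp ht
  refine Measure.ext fun A hA => ?_
  have hb : |π'.real A - π.real A| ≤ 0 := by
    refine ge_of_tendsto' ht' fun n => ?_
    have := h.abs_comp_pow_sub_le hα₀ hα₁ hpp n hA
    rw [Measure.map_fst_prod, Measure.map_snd_prod, measure_univ, measure_univ, one_smul,
      one_smul, hpow _ hinv, hpow _ hinv'] at this
    exact this
  have := sub_eq_zero.mp (abs_nonpos_iff.mp hb)
  rwa [Measure.real, Measure.real, ENNReal.toReal_eq_toReal_iff' (measure_ne_top _ _)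
    (measure_ne_top _ _)] at this

theorem lintegral_rpow_ne_top (h : IsPantographLaw Λ α a D b) (hα₀ : 0 < α) :
    ∫⁻ x, ENNReal.ofReal (x ^ (-(1 / 2) : ℝ)) ∂Λ ≠ ⊤ := by
  have e : ∫⁻ x, ENNReal.ofReal (x ^ (-(1 / 2) : ℝ)) ∂Λ =
      ∫⁻ x in Ioi 0, ENNReal.ofReal (x ^ (-(1 / 2) : ℝ)) ∂Λ := by
    rw [Measure.restrict_eq_self_of_ae_mem (s := Ioi 0) h.ae_pos]
  rw [e, ← Ioo_union_Ici_eq_Ioi (show (0 : ℝ) < 1 from one_pos)]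
  refine ((lintegral_union_le _ _ _).trans (add_le_add
    (h.setLIntegral_rpow_le hα₀ (by norm_num) one_pos)
    (setLIntegral_mono' (g := fun _ => 1) measurableSet_Ici fun x hx => ?_))).trans_lt ?_ |>.ne
  · rw [← ENNReal.ofReal_one]
    exact ENNReal.ofReal_le_ofReal
      (Real.rpow_le_one_of_one_le_of_nonpos hx (by norm_num))
  · rw [setLIntegral_const]
    exact ENNReal.add_lt_top.mpr ⟨by finiteness, by finiteness⟩

/-- A coupling of two laws dominated by a multiple of `Λ` integrates the Lyapunov function. -/
theorem lintegral_min_rpow_ne_top (h : IsPantographLaw Λ α a D b) (hα₀ : 0 < α)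
    {γ : Measure (ℝ × ℝ)} [IsProbabilityMeasure γ] (hγ : ∀ᵐ w ∂γ, w ∈ posPairs) {K : ℝ≥0∞}
    (hK : K ≠ ⊤) (h₁ : γ.map Prod.fst ≤ K • Λ) (h₂ : γ.map Prod.snd ≤ K • Λ) :
    ∫⁻ w, ENNReal.ofReal ((min w.1 w.2) ^ (-(1 / 2) : ℝ) + 1) ∂γ ≠ ⊤ := by
  have hm : Measurable fun x : ℝ => ENNReal.ofReal (x ^ (-(1 / 2) : ℝ)) := by fun_prop
  have hV : ∀ ρ : Measure ℝ, ρ ≤ K • Λ → ∫⁻ x, ENNReal.ofReal (x ^ (-(1 / 2) : ℝ)) ∂ρ < ⊤ := by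
    intro ρ hρ
    refine (lintegral_mono' hρ le_rfl).trans_lt ?_
    rw [lintegral_smul_measure]
    exact (ENNReal.mul_ne_top hK (h.lintegral_rpow_ne_top hα₀)).lt_top
  have i1 := hV _ h₁
  have i2 := hV _ h₂
  rw [lintegral_map hm measurable_fst] at i1
  rw [lintegral_map hm measurable_snd] at i2
  refine (lt_of_le_of_lt (lintegral_mono_ae (g := fun w : ℝ × ℝ =>
    ENNReal.ofReal (w.1 ^ (-(1 / 2) : ℝ)) + ENNReal.ofReal (w.2 ^ (-(1 / 2) : ℝ)) + 1) ?_) ?_).ne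
  · filter_upwards [hγ] with w hw
    have p1 : 0 < w.1 := hw.1
    have p2 : 0 < w.2 := hw.2
    rw [← ENNReal.ofReal_one, ← ENNReal.ofReal_add (by positivity) (by positivity),
      ← ENNReal.ofReal_add (by positivity) (by positivity)]
    refine ENNReal.ofReal_le_ofReal ?_
    have q1 : 0 < w.1 ^ (-(1 / 2) : ℝ) := by positivity
    have q2 : 0 < w.2 ^ (-(1 / 2) : ℝ) := by positivity
    rcases min_choice w.1 w.2 with e | e <;> rw [e] <;> linarith
  · rw [lintegral_add_right _ measurable_const, lintegral_add_left (by fun_prop)]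
    refine ENNReal.add_lt_top.mpr ⟨ENNReal.add_lt_top.mpr ⟨i1, i2⟩, by simp⟩

/-- Coupling F with its one-step image compares times n and n + 1 at a geometric rate, so masses of
sets converge. Domination by `K • Λ` makes the limit a measure and supplies the moment needed for
the rate. The order hypothesis on F is used only for the last conclusion. -/
theorem exists_stationary (h : IsPantographLaw Λ α a D b) (hα₀ : 0 < α) (hα₁ : α < 1)
    {F : Measure ℝ} [IsProbabilityMeasure F] (hF : ∀ᵐ w ∂F, 0 < w) {z : ℝ≥0∞} (hz : z ≠ ⊤)
    (hFz : F ≤ z • Λ) (hst : ∀ t, F (Iic t) ≤ (stepKernel Λ α ∘ₘ F) (Iic t)) :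
    ∃ (π : Measure ℝ) (_ : IsProbabilityMeasure π), stepKernel Λ α ∘ₘ π = π ∧
      (∃ K : ℝ≥0∞, K ≠ ⊤ ∧ F ≤ K • Λ ∧ π ≤ K • Λ) ∧ ∀ t, F (Iic t) ≤ π (Iic t) := by
  have hL := h.measure_Ioo_ne_zero hα₀ hα₁
  obtain ⟨K, hK, hdom⟩ := h.exists_comp_pow_le hα₀ hα₁ hF hz hFz
  have hpos := ae_mem_comp_pow measurableSet_Ioi (h.ae_stepKernel_pos hα₀ hα₁) hF
  have hfin : IsFiniteMeasure (K • Λ) := ⟨by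
    rw [Measure.smul_apply, measure_univ, smul_eq_mul, mul_one]; exact hK.lt_top⟩
  have hF1 : (stepKernel Λ α ^ 1 : Kernel ℝ ℝ) ∘ₘ F = stepKernel Λ α ∘ₘ F := by rw [pow_one]
  have hpos1 : ∀ᵐ w ∂(stepKernel Λ α ∘ₘ F), 0 < w := hF1 ▸ hpos 1
  have hdom0 : F ≤ K • Λ := by rw [← comp_pow_zero (stepKernel Λ α) F]; exact hdom 0
  have hdom1 : stepKernel Λ α ∘ₘ F ≤ K • Λ := hF1 ▸ hdom 1
  have hsucc : ∀ n : ℕ, (stepKernel Λ α ^ (n + 1)) ∘ₘ F =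
      (stepKernel Λ α ^ n) ∘ₘ (stepKernel Λ α ∘ₘ F) := fun n => by
    rw [pow_succ, Measure.comp_assoc]; rfl
  obtain ⟨c, hc, lam, hlam, hdecay⟩ := h.exists_offDiag_decay hα₀ hα₁ (θ := 1 / 2) (by norm_num)
    le_rfl
  -- The independent coupling suffices for the Cauchy estimate; order is irrelevant here.
  have hpp := ae_posPairs_prod hF hpos1
  have hcauchy : ∀ A, MeasurableSet A →
      ∃ l, Tendsto (fun n : ℕ => ((stepKernel Λ α ^ n) ∘ₘ F) A) atTop (𝓝 l) := by
    intro A hA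
    have hI := h.lintegral_min_rpow_ne_top hα₀ hpp hK
      (by rwa [Measure.map_fst_prod, measure_univ, one_smul])
      (by rwa [Measure.map_snd_prod, measure_univ, one_smul])
    set I := ∫⁻ w, ENNReal.ofReal ((min w.1 w.2) ^ (-(1 / 2) : ℝ) + 1)
      ∂(F.prod (stepKernel Λ α ∘ₘ F)) with hIdef
    have hdist : ∀ n : ℕ, dist (((stepKernel Λ α ^ n) ∘ₘ F).real A)
        (((stepKernel Λ α ^ (n + 1)) ∘ₘ F).real A) ≤ c * I.toReal * (Real.exp (-lam)) ^ n := by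
      intro n
      have h1 := h.abs_comp_pow_sub_le hα₀ hα₁ hpp n hA
      rw [Measure.map_fst_prod, Measure.map_snd_prod, measure_univ, measure_univ, one_smul,
        one_smul, ← hsucc] at h1
      refine h1.trans ?_
      have h2 := ENNReal.toReal_mono (ENNReal.mul_ne_top ENNReal.ofReal_ne_top hI) (hdecay _ hpp n)
      rw [ENNReal.toReal_mul, ENNReal.toReal_ofReal (by positivity)] at h2
      refine h2.trans (le_of_eq ?_)
      rw [← Real.exp_nat_mul, mul_comm (-lam)]
      ring
    have hcs : CauchySeq fun n : ℕ => ((stepKernel Λ α ^ n) ∘ₘ F).real A :=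
      cauchySeq_of_le_geometric _ _ (Real.exp_lt_one_iff.mpr (by linarith)) hdist
    obtain ⟨l, hl⟩ := cauchySeq_tendsto_of_complete hcs
    refine ⟨ENNReal.ofReal l, ?_⟩
    have := ENNReal.tendsto_ofReal hl
    simpa [ofReal_measureReal] using this
  obtain ⟨π, hπ, hπK, hlim⟩ := exists_setwise_limit hdom hcauchy
  refine ⟨π, hπ, ?_, ⟨K, hK, hdom0, hπK⟩, ?_⟩
  · refine Measure.ext fun A hA => ?_
    refine tendsto_nhds_unique ?_ ((tendsto_add_atTop_iff_nat 1).mpr (hlim A hA))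
    rw [Measure.bind_apply hA (Kernel.aemeasurable _)]
    have := tendsto_lintegral_of_setwise hlim (Kernel.measurable_coe (stepKernel Λ α) hA)
      fun x => prob_le_one
    refine this.congr fun n => ?_
    rw [comp_pow_succ, Measure.bind_apply hA (Kernel.aemeasurable _)]
  · intro t
    -- Now an ordered coupling of F and its image is started. Since the pair kernel preserves order,
    -- F pⁿ (Iic t) is nondecreasing in n, and the inequality passes to the limit.
    obtain ⟨γ, hγ, hγ1, hγ2, hγle⟩ := quantile_coupling hst
    have hγpos : ∀ᵐ w ∂γ, w ∈ orderedPairs := by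
      have h2 : ∀ᵐ w ∂γ, 0 < w.2 := ae_of_ae_map measurable_snd.aemeasurable (hγ2 ▸ hpos1)
      filter_upwards [hγle, h2] with w hw hw2 using ⟨hw2, hw⟩
    have hγpp : ∀ᵐ w ∂γ, w ∈ posPairs := by
      filter_upwards [hγpos] with w hw using ⟨hw.1.trans_le hw.2, hw.1⟩
    have hmono : ∀ n : ℕ, ((stepKernel Λ α ^ n) ∘ₘ F) (Iic t) ≤
        ((stepKernel Λ α ^ (n + 1)) ∘ₘ F) (Iic t) := by
      intro n
      have ho := ae_mem_comp_pow measurableSet_orderedPairs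
        (ae_pairKernel_mem_orderedPairs hα₀ hL) hγpos n
      have e1 := h.pairKernel_pow_map_fst hα₀ hα₁ hγpp n
      have e2 := h.pairKernel_pow_map_snd hα₀ hα₁ hγpp n
      rw [hγ1] at e1
      rw [hγ2] at e2
      rw [hsucc, ← e1, ← e2, Measure.map_apply measurable_fst measurableSet_Iic,
        Measure.map_apply measurable_snd measurableSet_Iic]
      refine measure_mono_ae ?_
      filter_upwards [ho] with w hw hw1
      exact hw.2.trans hw1
    refine ge_of_tendsto' (hlim _ measurableSet_Iic) fun n => ?_
    have := monotone_nat_of_le_succ hmono (Nat.zero_le n)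
    rwa [comp_pow_zero] at this

/-- The processes are the coordinates of the coupled pair started from a quantile coupling of F and
π. One bound on the probability of being apart at time n controls both the coupling time and the
distance to π. -/
theorem exists_monotone_coupling (h : IsPantographLaw Λ α a D b) (hα₀ : 0 < α) (hα₁ : α < 1)
    {F π : Measure ℝ} [IsProbabilityMeasure F] [IsProbabilityMeasure π] {K : ℝ≥0∞} (hK : K ≠ ⊤)
    (hF : F ≤ K • Λ) (hπ : π ≤ K • Λ) (hinv : stepKernel Λ α ∘ₘ π = π)
    (hst : ∀ t, F (Iic t) ≤ π (Iic t)) :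
    ∃ c : ℝ, 0 < c ∧ ∃ lam : ℝ, 0 < lam ∧
      (∃ (Ω : Type) (_ : MeasurableSpace Ω) (P : Measure Ω) (_ : IsProbabilityMeasure P)
          (W W' : ℕ → Ω → ℝ),
        (∀ n, Measurable (W n)) ∧ (∀ n, Measurable (W' n)) ∧
        P.map (fun ω n => W n ω) = chainLaw (stepKernel Λ α) F ∧
        P.map (fun ω n => W' n ω) = chainLaw (stepKernel Λ α) π ∧
        (∀ᵐ ω ∂P, ∀ n, W' n ω ≤ W n ω) ∧
        (∀ᵐ ω ∂P, ∀ n : ℕ, couplingTime (fun k => W k ω) (fun k => W' k ω) ≤ n →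
          W n ω = W' n ω) ∧
        (∀ n : ℕ, P {ω | (n : ℕ∞) < couplingTime (fun k => W k ω) (fun k => W' k ω)} ≤
          ENNReal.ofReal (c * Real.exp (-lam * n)))) ∧
      ∀ n : ℕ, (((stepKernel Λ α ^ n) ∘ₘ F).toSignedMeasure -
          π.toSignedMeasure).totalVariation univ ≤
        ENNReal.ofReal (2 * c * Real.exp (-lam * n)) := by
  have hL := h.measure_Ioo_ne_zero hα₀ hα₁
  obtain ⟨γ, hγ, hγ1, hγ2, hγle⟩ := quantile_coupling hst
  have hπpos : ∀ᵐ w ∂π, 0 < w :=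
    (Measure.absolutelyContinuous_of_le hπ).trans
      Measure.smul_absolutelyContinuous |>.ae_le h.ae_pos
  have hγpos : ∀ᵐ w ∂γ, w ∈ orderedPairs := by
    have h2 : ∀ᵐ w ∂γ, 0 < w.2 := ae_of_ae_map measurable_snd.aemeasurable (hγ2 ▸ hπpos)
    filter_upwards [hγle, h2] with w hw hw2 using ⟨hw2, hw⟩
  have hγpp : ∀ᵐ w ∂γ, w ∈ posPairs := by
    filter_upwards [hγpos] with w hw using ⟨hw.1.trans_le hw.2, hw.1⟩
  obtain ⟨c, hc, lam, hlam, hdecay⟩ := h.exists_offDiag_decay hα₀ hα₁ (θ := 1 / 2) (by norm_num)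
    le_rfl
  have hI := h.lintegral_min_rpow_ne_top hα₀ hγpp hK (by rwa [hγ1]) (by rwa [hγ2])
  set I := ∫⁻ w, ENNReal.ofReal ((min w.1 w.2) ^ (-(1 / 2) : ℝ) + 1) ∂γ with hIdef
  have hbound : ∀ n : ℕ, ((pairKernel Λ α ^ n) ∘ₘ γ) {w | w.1 ≠ w.2} ≤
      ENNReal.ofReal (c * (I.toReal + 1) * Real.exp (-lam * n)) := by
    intro n
    refine (hdecay γ hγpp n).trans ?_
    conv_lhs => rw [← hIdef, ← ENNReal.ofReal_toReal hI, ← ENNReal.ofReal_mul (by positivity)]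
    refine ENNReal.ofReal_le_ofReal ?_
    have : 0 ≤ c * Real.exp (-lam * n) := by positivity
    nlinarith
  refine ⟨c * (I.toReal + 1), by positivity, lam, hlam, ⟨ℕ → ℝ × ℝ, inferInstance,
    chainLaw (pairKernel Λ α) γ, inferInstance, fun n ω => (ω n).1, fun n ω => (ω n).2,
    fun n => by fun_prop, fun n => by fun_prop, ?_, ?_, ?_, ?_, ?_⟩, ?_⟩
  · rw [chainLaw_map_comp measurable_fst measurableSet_posPairs
      (ae_pairKernel_mem_posPairs hα₀ hL) hγpp
      (fun _ hw => pairKernel_map_fst hα₀ hL hw.1 hw.2), hγ1]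
  · rw [chainLaw_map_comp measurable_snd measurableSet_posPairs
      (ae_pairKernel_mem_posPairs hα₀ hL) hγpp
      (fun _ hw => pairKernel_map_snd hα₀ hL hw.1 hw.2), hγ2]
  · filter_upwards [ae_chainLaw_forall_mem measurableSet_orderedPairs
      (ae_pairKernel_mem_orderedPairs hα₀ hL) hγpos] with ω hω n using (hω n).2
  -- The diagonal of the positive quadrant is absorbing, so agreement at one time propagates to all
  -- later times.
  · have hD : MeasurableSet (posPairs ∩ {w : ℝ × ℝ | w.1 = w.2}) :=
      measurableSet_posPairs.inter (measurableSet_eq_fun measurable_fst measurable_snd)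
    filter_upwards [ae_chainLaw_forall_mem measurableSet_posPairs
      (ae_pairKernel_mem_posPairs hα₀ hL) hγpp,
      ae_chainLaw_forall_mem_succ hD (ae_pairKernel_diag hα₀ hL)] with ω hpos hω n hn
    obtain ⟨k, hkn, hk⟩ := couplingTime_le_imp hn
    have : ω n ∈ posPairs ∩ {w : ℝ × ℝ | w.1 = w.2} := by
      induction n, hkn using Nat.le_induction with
      | base => exact ⟨hpos k, hk⟩
      | succ m hm ih =>
        refine hω m (ih ?_)
        exact (iInf₂_le k hk).trans (by exact_mod_cast hm)
    exact this.2
  · exact fun n => (chainLaw_couplingTime_le _ _ n).trans (hbound n)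
  · intro n
    rw [mul_assoc]
    refine totalVariation_univ_le _ _ fun A hA => ?_
    have h1 := h.abs_comp_pow_sub_le hα₀ hα₁ hγpp n hA
    have hpow : (stepKernel Λ α ^ n) ∘ₘ π = π := by
      induction n with
      | zero => exact comp_pow_zero _ _
      | succ n ih =>
        rw [comp_pow_succ, ih (h.abs_comp_pow_sub_le hα₀ hα₁ hγpp n hA), hinv]
    rw [hγ1, hγ2, hpow] at h1
    refine h1.trans ?_
    have := ENNReal.toReal_mono ENNReal.ofReal_ne_top (hbound n)
    rwa [ENNReal.toReal_ofReal (by positivity)] at this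

end IsPantographLaw

/-! ### First-passage times on the tree -/

section Tree

variable {d : ℕ} {α : ℝ}

/-- The configuration seen from the child `i` of the root. -/
def subtree (U : List (Fin d) → ℝ) (i : Fin d) : List (Fin d) → ℝ := fun x => U (i :: x)

theorem hitTime_nil (U : List (Fin d) → ℝ) : hitTime α U [] = ENNReal.ofReal (U []) := by
  simp [hitTime]

theorem hitTime_cons (hα : 0 < α) (U : List (Fin d) → ℝ) (i : Fin d) (x : List (Fin d)) :
    hitTime α U (i :: x) =
      ENNReal.ofReal (U []) + ENNReal.ofReal α * hitTime α (subtree U i) x := by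
  unfold hitTime
  rw [List.length_cons, Finset.sum_range_succ', Finset.mul_sum, add_comm]
  congr 1
  · simp
  · refine Finset.sum_congr rfl fun k _ => ?_
    rw [← ENNReal.ofReal_mul hα.le, ← mul_assoc, ← pow_succ']
    rfl

theorem hitTime_ne_top (U : List (Fin d) → ℝ) (x : List (Fin d)) : hitTime α U x ≠ ⊤ := by
  unfold hitTime
  exact ENNReal.sum_ne_top.mpr fun _ _ => ENNReal.ofReal_ne_top

theorem hitTime_nil_le (U : List (Fin d) → ℝ) (x : List (Fin d)) :
    hitTime α U [] ≤ hitTime α U x := by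
  unfold hitTime
  rw [Finset.sum_range_succ' _ x.length]
  simp

theorem hitTime_take_le (U : List (Fin d) → ℝ) (x : List (Fin d)) (n : ℕ) :
    hitTime α U (x.take n) ≤ hitTime α U x := by
  unfold hitTime
  have h : ∀ k ∈ Finset.range ((x.take n).length + 1), (x.take n).take k = x.take k := by
    intro k hk
    rw [Finset.mem_range, List.length_take] at hk
    rw [List.take_take, min_eq_left (by omega)]
  rw [Finset.sum_congr rfl fun k hk => by rw [h k hk]]
  refine Finset.sum_le_sum_of_subset (Finset.range_mono ?_)
  rw [List.length_take]; omega

/-- The earliest time at which generation `n` gets wet. -/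
noncomputable def levelMin (α : ℝ) (U : List (Fin d) → ℝ) (n : ℕ) : ℝ≥0∞ :=
  ⨅ y ∈ {y : List (Fin d) | y.length = n}, hitTime α U y

/-- The limit of the times at which the successive generations get wet. -/
noncomputable def escapeTime (α : ℝ) (U : List (Fin d) → ℝ) : ℝ≥0∞ := ⨆ n, levelMin α U n

theorem levelMin_zero (U : List (Fin d) → ℝ) : levelMin α U 0 = ENNReal.ofReal (U []) := by
  unfold levelMin
  refine le_antisymm ?_ ?_
  · rw [← hitTime_nil (α := α)]
    exact iInf₂_le_of_le ([] : List (Fin d)) (by rfl) le_rfl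
  · refine le_iInf₂ fun y hy => ?_
    rw [List.length_eq_zero_iff.mp hy, hitTime_nil]

theorem levelMin_le (U : List (Fin d) → ℝ) (x : List (Fin d)) :
    levelMin α U x.length ≤ hitTime α U x := by
  unfold levelMin
  exact iInf₂_le_of_le x (by rfl) le_rfl

theorem levelMin_succ (hα : 0 < α) (U : List (Fin d) → ℝ) (n : ℕ) :
    levelMin α U (n + 1) =
      ENNReal.ofReal (U []) + ⨅ i, ENNReal.ofReal α * levelMin α (subtree U i) n := by
  have hα0 : ENNReal.ofReal α ≠ 0 := by simpa using hα
  unfold levelMin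
  refine le_antisymm ?_ ?_
  · simp only [ENNReal.mul_iInf_of_ne hα0 ENNReal.ofReal_ne_top, ENNReal.add_iInf]
    refine le_iInf fun i => le_iInf₂ fun z hz => ?_
    rw [← hitTime_cons hα]
    have hz' : z.length = n := hz
    exact iInf₂_le (i :: z) (by simp [hz'])
  · refine le_iInf₂ fun y hy => ?_
    match y, hy with
    | i :: z, hz =>
      rw [hitTime_cons hα]
      gcongr
      refine iInf_le_of_le i ?_
      gcongr
      exact iInf₂_le z (by simpa using hz)

theorem levelMin_mono (U : List (Fin d) → ℝ) : Monotone (levelMin α U) := by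
  refine monotone_nat_of_le_succ fun n => le_iInf₂ fun y hy => ?_
  refine (iInf₂_le (y.take n) ?_).trans (hitTime_take_le U y n)
  have : y.length = n + 1 := hy
  simp [this]

/-- The recursion for generation minima passes to the limit because these minima increase with the
generation and there are finitely many children, so supremum and infimum commute. -/
theorem escapeTime_eq [NeZero d] (hα : 0 < α) (U : List (Fin d) → ℝ) :
    escapeTime α U =
      ENNReal.ofReal (U []) + ⨅ i, ENNReal.ofReal α * escapeTime α (subtree U i) := by
  have e : escapeTime α U = ⨆ n, levelMin α U (n + 1) :=
    ((levelMin_mono U).iSup_nat_add 1).symm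
  rw [e]
  simp only [levelMin_succ hα, escapeTime, ENNReal.mul_iSup]
  rw [← ENNReal.add_iSup]
  congr 1
  exact iSup_iInf_of_monotone fun i m n hmn => mul_le_mul_right (levelMin_mono _ hmn) _

theorem timeToInfinity_cons (hα : 0 < α) (U : List (Fin d) → ℝ) (i : Fin d) (x : List (Fin d)) :
    timeToInfinity α U (i :: x) = ENNReal.ofReal α * timeToInfinity α (subtree U i) x := by
  have hα0 : ENNReal.ofReal α ≠ 0 := by simpa using hα
  have hsub : ∀ z, hitTime α U (i :: z) - hitTime α U (i :: x) =
      ENNReal.ofReal α * (hitTime α (subtree U i) z - hitTime α (subtree U i) x) := by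
    intro z
    rw [hitTime_cons hα, hitTime_cons hα,
      ENNReal.add_sub_add_eq_sub_left ENNReal.ofReal_ne_top,
      ENNReal.mul_sub fun _ _ => ENNReal.ofReal_ne_top]
  unfold timeToInfinity
  rw [ENNReal.mul_iSup]
  congr 1
  ext n
  simp only [ENNReal.mul_iInf_of_ne hα0 ENNReal.ofReal_ne_top]
  refine le_antisymm ?_ ?_
  · refine le_iInf₂ fun z hz => ?_
    rw [← hsub]
    refine iInf₂_le (i :: z) ⟨(List.prefix_cons_inj i).mpr hz.1, ?_⟩
    have := hz.2
    simp only [List.length_cons]; omega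
  · refine le_iInf₂ fun y hy => ?_
    obtain ⟨t, rfl⟩ := hy.1
    rw [List.cons_append, hsub]
    refine iInf₂_le (x ++ t) ⟨List.prefix_append x t, ?_⟩
    have := hy.2
    simp only [List.length_cons, List.length_append, List.cons_append] at this ⊢
    omega

theorem escapeTime_eq_add (U : List (Fin d) → ℝ) :
    escapeTime α U = ENNReal.ofReal (U []) + timeToInfinity α U [] := by
  unfold escapeTime timeToInfinity levelMin
  rw [ENNReal.add_iSup]
  congr 1
  ext n
  simp only [ENNReal.add_iInf]
  have hs : {y : List (Fin d) | [] <+: y ∧ y.length = ([] : List (Fin d)).length + n} =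
      {y : List (Fin d) | y.length = n} := by
    ext y; simp
  rw [hs]
  refine iInf_congr fun y => iInf_congr fun _ => ?_
  rw [← hitTime_nil (α := α), add_tsub_cancel_of_le (hitTime_nil_le U y)]

theorem timeToInfinity_nil [NeZero d] (hα : 0 < α) (U : List (Fin d) → ℝ) :
    timeToInfinity α U [] = ⨅ i, ENNReal.ofReal α * escapeTime α (subtree U i) := by
  have h := (escapeTime_eq_add (α := α) U).symm.trans (escapeTime_eq hα U)
  exact (ENNReal.add_right_inj ENNReal.ofReal_ne_top).mp h

/-! ### The explosion time -/

theorem finite_setOf_length_eq (n : ℕ) : {y : List (Fin d) | y.length = n}.Finite :=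
  List.finite_length_eq _ n

theorem exists_hitTime_eq_levelMin [NeZero d] (U : List (Fin d) → ℝ) (n : ℕ) :
    ∃ y : List (Fin d), y.length = n ∧ hitTime α U y = levelMin α U n := by
  have hne : {y : List (Fin d) | y.length = n}.Nonempty := ⟨List.replicate n 0, by simp⟩
  obtain ⟨y, hy, hmin⟩ := (finite_setOf_length_eq n).exists_minimalFor (hitTime α U) _ hne
  refine ⟨y, hy, le_antisymm (le_iInf₂ fun z hz => ?_) (iInf₂_le y hy)⟩
  rcases le_total (hitTime α U y) (hitTime α U z) with h | h
  · exact h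
  · exact hmin hz h

/-- At the escape time the fastest vertex of every generation is wet, so infinitely many vertices
are. At any earlier time the wet vertices lie in boundedly many generations, so they are finite in
number. -/
theorem explosionTime_eq [NeZero d] (U : List (Fin d) → ℝ) :
    explosionTime α U = escapeTime α U := by
  refine le_antisymm (iSup_le fun n => sInf_le ?_) (le_of_forall_lt fun t ht => ?_)
  · choose y hy hyt using exists_hitTime_eq_levelMin (α := α) U
    have hinj : Function.Injective y := fun m k hmk => by rw [← hy m, ← hy k, hmk]
    have hsub : range y ⊆ wetSet α U (escapeTime α U) := by
      rintro _ ⟨k, rfl⟩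
      change hitTime α U (y k) ≤ _
      rw [hyt]
      exact le_iSup (levelMin α U) k
    have : (wetSet α U (escapeTime α U)).encard = ⊤ :=
      ((infinite_range_of_injective hinj).mono hsub).encard_eq
    change (n : ℕ∞) ≤ _
    rw [this]
    exact le_top
  · obtain ⟨s, hts, hs⟩ := exists_between ht
    obtain ⟨n, hn⟩ := lt_iSup_iff.mp hs
    have hfin : (wetSet α U s).Finite := by
      refine (List.finite_length_lt (Fin d) n).subset fun x hx => ?_
      by_contra hlen
      have hlen' : n ≤ x.length := not_lt.mp hlen
      have h1 : levelMin α U x.length ≤ hitTime α U x := levelMin_le U x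
      exact absurd hn (not_lt.mpr (((levelMin_mono U hlen').trans h1).trans hx))
    -- The time needed for one vertex more than are wet at time s is at least s.
    refine hts.trans_le (le_trans ?_ (le_iSup _ (hfin.toFinset.card + 1)))
    refine le_sInf fun r hr => ?_
    by_contra hlt
    have hsub : wetSet α U r ⊆ wetSet α U s := fun x hx => le_trans hx (not_le.mp hlt).le
    have h1 := (show ((hfin.toFinset.card + 1 : ℕ) : ℕ∞) ≤ _ from hr).trans (encard_le_encard hsub)
    rw [hfin.encard_eq_coe_toFinset_card] at h1
    have : hfin.toFinset.card + 1 ≤ hfin.toFinset.card := by exact_mod_cast h1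
    omega

theorem isLineOfDescent_iff [NeZero d] (U : List (Fin d) → ℝ) (r : ℕ → Fin d) :
    IsLineOfDescent α U r ↔
      ∀ n : ℕ, hitTime α U (List.ofFn fun i : Fin n => r i) < escapeTime α U := by
  unfold IsLineOfDescent infiniteCluster
  rw [explosionTime_eq]
  rfl

/-! ### The backbone -/

/-- The child `i` of the root is the one through which the fastest way to infinity goes. -/
def IsFastestChild (α : ℝ) (U : List (Fin d) → ℝ) (i : Fin d) : Prop :=
  ∀ j, j ≠ i → escapeTime α (subtree U i) < escapeTime α (subtree U j)

theorem IsFastestChild.eq {U : List (Fin d) → ℝ} {i j : Fin d} (hi : IsFastestChild α U i)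
    (hj : IsFastestChild α U j) : i = j := by
  by_contra h
  exact lt_asymm (hi j (Ne.symm h)) (hj i h)

/-- The configuration seen from the vertex `x`. -/
def subtreeAt (U : List (Fin d) → ℝ) (x : List (Fin d)) : List (Fin d) → ℝ := fun y => U (x ++ y)

/-- A fastest child exists, and the time to infinity from it is positive and finite. -/
def HasFastestChild (α : ℝ) (U : List (Fin d) → ℝ) : Prop :=
  ∃ i, IsFastestChild α U i ∧ 0 < escapeTime α (subtree U i) ∧ escapeTime α (subtree U i) ≠ ⊤

/-- Every vertex has a fastest child. -/
def IsRegularConfig (α : ℝ) (U : List (Fin d) → ℝ) : Prop :=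
  ∀ x, HasFastestChild α (subtreeAt U x)

theorem IsRegularConfig.subtree {U : List (Fin d) → ℝ} (h : IsRegularConfig α U) (i : Fin d) :
    IsRegularConfig α (subtree U i) := fun x => h (i :: x)

theorem IsRegularConfig.hasFastestChild {U : List (Fin d) → ℝ} (h : IsRegularConfig α U) :
    HasFastestChild α U := h []

theorem IsFastestChild.iInf_eq {U : List (Fin d) → ℝ} {i : Fin d} (hi : IsFastestChild α U i) :
    ⨅ j, ENNReal.ofReal α * escapeTime α (_root_.subtree U j) =
      ENNReal.ofReal α * escapeTime α (_root_.subtree U i) := by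
  refine le_antisymm (iInf_le _ i) (le_iInf fun j => ?_)
  by_cases h : j = i
  · rw [h]
  · gcongr
    exact (hi j h).le

theorem IsFastestChild.escapeTime_eq [NeZero d] (hα : 0 < α) {U : List (Fin d) → ℝ} {i : Fin d}
    (hi : IsFastestChild α U i) : escapeTime α U =
      ENNReal.ofReal (U []) + ENNReal.ofReal α * escapeTime α (_root_.subtree U i) := by
  rw [_root_.escapeTime_eq hα, hi.iInf_eq]

theorem hitTime_ofFn_succ (hα : 0 < α) (U : List (Fin d) → ℝ) (r : ℕ → Fin d) (n : ℕ) :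
    hitTime α U (List.ofFn fun i : Fin (n + 1) => r i) = ENNReal.ofReal (U []) +
      ENNReal.ofReal α *
        hitTime α (subtree U (r 0)) (List.ofFn fun i : Fin n => r (i + 1)) := by
  rw [List.ofFn_succ, hitTime_cons hα]
  rfl

theorem IsFastestChild.hitTime_lt_iff [NeZero d] (hα : 0 < α) {U : List (Fin d) → ℝ} {i : Fin d}
    (hi : IsFastestChild α U i) (r : ℕ → Fin d) (n : ℕ) :
    hitTime α U (List.ofFn fun i : Fin (n + 1) => r i) < escapeTime α U ↔
      hitTime α (_root_.subtree U (r 0)) (List.ofFn fun i : Fin n => r (i + 1)) <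
        escapeTime α (_root_.subtree U i) := by
  have hα0 : ENNReal.ofReal α ≠ 0 := by simpa using hα
  rw [hitTime_ofFn_succ hα, hi.escapeTime_eq hα,
    ENNReal.add_lt_add_iff_left ENNReal.ofReal_ne_top,
    ENNReal.mul_lt_mul_iff_right hα0 ENNReal.ofReal_ne_top]

/-- All vertices of the line get wet before the escape time. Seen from the first child on the line,
they bound each generation minimum by the escape time of the fastest child, so the first child has
no larger escape time and must be the fastest. -/
theorem IsFastestChild.isLineOfDescent_imp [NeZero d] (hα : 0 < α) {U : List (Fin d) → ℝ}
    {i : Fin d} (hi : IsFastestChild α U i) {r : ℕ → Fin d} (hr : IsLineOfDescent α U r) :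
    r 0 = i ∧ IsLineOfDescent α (_root_.subtree U i) fun n => r (n + 1) := by
  rw [isLineOfDescent_iff] at hr
  have h : ∀ n : ℕ, hitTime α (_root_.subtree U (r 0)) (List.ofFn fun i : Fin n => r (i + 1)) <
      escapeTime α (_root_.subtree U i) := fun n => (hi.hitTime_lt_iff hα r n).mp (hr (n + 1))
  have h0 : r 0 = i := by
    by_contra hne
    refine absurd (hi _ hne) (not_lt.mpr (iSup_le fun n => ?_))
    refine le_trans (iInf₂_le _ ?_) (h n).le
    simp
  refine ⟨h0, ?_⟩
  rw [isLineOfDescent_iff]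
  rw [h0] at h
  exact h

open Classical in
/-- The fastest child of the root, if there is one. -/
noncomputable def fastestChild [NeZero d] (α : ℝ) (U : List (Fin d) → ℝ) : Fin d :=
  if h : HasFastestChild α U then h.choose else 0

theorem IsFastestChild.eq_fastestChild [NeZero d] {U : List (Fin d) → ℝ}
    (h : HasFastestChild α U) {i : Fin d} (hi : IsFastestChild α U i) : fastestChild α U = i := by
  unfold fastestChild
  rw [dif_pos h]
  exact h.choose_spec.1.eq hi

/-- The path that follows the fastest children. -/
noncomputable def fastestPath [NeZero d] (α : ℝ) (U : List (Fin d) → ℝ) (n : ℕ) : Fin d :=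
  fastestChild α ((fun V => subtree V (fastestChild α V))^[n] U)

theorem fastestPath_succ [NeZero d] (U : List (Fin d) → ℝ) (n : ℕ) :
    fastestPath α U (n + 1) = fastestPath α (subtree U (fastestChild α U)) n := rfl

/-- Passing to the fastest child reduces the claim for generation n to the root, where it says that
the remaining time to infinity is positive. -/
theorem IsRegularConfig.isLineOfDescent_fastestPath [NeZero d] (hα : 0 < α)
    {U : List (Fin d) → ℝ} (h : IsRegularConfig α U) :
    IsLineOfDescent α U (fastestPath α U) := by
  rw [isLineOfDescent_iff]
  intro n
  induction n generalizing U with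
  | zero =>
    obtain ⟨i, hi, hpos, -⟩ := h.hasFastestChild
    have hα0 : ENNReal.ofReal α ≠ 0 := by simpa using hα
    rw [List.ofFn_zero, hitTime_nil, hi.escapeTime_eq hα]
    exact ENNReal.lt_add_right ENNReal.ofReal_ne_top (mul_ne_zero hα0 hpos.ne')
  | succ n ih =>
    obtain ⟨i, hi, -⟩ := h.hasFastestChild
    have e := hi.eq_fastestChild h.hasFastestChild
    rw [hi.hitTime_lt_iff hα]
    have e0 : fastestPath α U 0 = i := e
    rw [e0]
    simp only [fastestPath_succ, e]
    exact ih (h.subtree i)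

theorem IsRegularConfig.eq_fastestPath [NeZero d] (hα : 0 < α) {U : List (Fin d) → ℝ}
    (h : IsRegularConfig α U) {r : ℕ → Fin d} (hr : IsLineOfDescent α U r) :
    r = fastestPath α U := by
  ext n : 1
  induction n generalizing U r with
  | zero =>
    obtain ⟨i, hi, -⟩ := h.hasFastestChild
    exact (hi.isLineOfDescent_imp hα hr).1.trans (hi.eq_fastestChild h.hasFastestChild).symm
  | succ n ih =>
    obtain ⟨i, hi, -⟩ := h.hasFastestChild
    rw [fastestPath_succ, hi.eq_fastestChild h.hasFastestChild]
    exact ih (h.subtree i) (hi.isLineOfDescent_imp hα hr).2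

theorem IsRegularConfig.backbone_eq [NeZero d] (hα : 0 < α) {U : List (Fin d) → ℝ}
    (h : IsRegularConfig α U) (n : ℕ) :
    backbone α U n = List.ofFn fun i : Fin n => fastestPath α U i := by
  have hu : ∃! r : ℕ → Fin d, IsLineOfDescent α U r :=
    ⟨_, h.isLineOfDescent_fastestPath hα, fun r hr => h.eq_fastestPath hα hr⟩
  unfold backbone
  rw [dif_pos hu, h.eq_fastestPath hα hu.choose_spec.1]

theorem backbone_zero (U : List (Fin d) → ℝ) : backbone α U 0 = [] := by
  unfold backbone
  split_ifs <;> simp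

theorem backboneTime_zero (U : List (Fin d) → ℝ) :
    backboneTime α 0 U = (timeToInfinity α U []).toReal / α := by
  unfold backboneTime
  rw [backbone_zero, zero_add, pow_one]

/-- The backbone continues as the backbone of the subtree of its first vertex, and the scale factor
α of that subtree is absorbed by the normalization. -/
theorem IsRegularConfig.backboneTime_succ [NeZero d] (hα : 0 < α) {U : List (Fin d) → ℝ}
    (h : IsRegularConfig α U) {i : Fin d} (hi : IsFastestChild α U i) (n : ℕ) :
    backboneTime α (n + 1) U = backboneTime α n (_root_.subtree U i) := by
  have e := hi.eq_fastestChild h.hasFastestChild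
  have hb : backbone α U (n + 1) = i :: backbone α (_root_.subtree U i) n := by
    rw [h.backbone_eq hα, (h.subtree i).backbone_eq hα, List.ofFn_succ]
    congr 1
    simp only [Fin.val_succ, fastestPath_succ, e]
  unfold backboneTime
  rw [hb, timeToInfinity_cons hα, ENNReal.toReal_mul, ENNReal.toReal_ofReal hα.le]
  field_simp
  ring

theorem IsFastestChild.backboneTime_zero [NeZero d] (hα : 0 < α) {U : List (Fin d) → ℝ}
    {i : Fin d} (hi : IsFastestChild α U i) :
    backboneTime α 0 U = (escapeTime α (_root_.subtree U i)).toReal := by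
  rw [_root_.backboneTime_zero, timeToInfinity_nil hα, hi.iInf_eq, ENNReal.toReal_mul,
    ENNReal.toReal_ofReal hα.le]
  field_simp

/-! ### Measurability -/

theorem measurable_hitTime (x : List (Fin d)) :
    Measurable fun U : List (Fin d) → ℝ => hitTime α U x := by
  unfold hitTime
  fun_prop

theorem measurable_levelMin (n : ℕ) :
    Measurable fun U : List (Fin d) → ℝ => levelMin α U n := by
  unfold levelMin
  exact Measurable.biInf _ (to_countable _) fun y _ => measurable_hitTime y

theorem measurable_escapeTime :
    Measurable fun U : List (Fin d) → ℝ => escapeTime α U := by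
  unfold escapeTime
  exact Measurable.iSup fun n => measurable_levelMin n

theorem measurable_timeToInfinity (x : List (Fin d)) :
    Measurable fun U : List (Fin d) → ℝ => timeToInfinity α U x := by
  unfold timeToInfinity
  exact Measurable.iSup fun n => Measurable.biInf _ (to_countable _) fun y _ =>
    (measurable_hitTime y).sub (measurable_hitTime x)

theorem measurable_backboneTime_zero :
    Measurable fun U : List (Fin d) → ℝ => backboneTime α 0 U := by
  simp only [backboneTime_zero]
  exact (measurable_timeToInfinity []).ennreal_toReal.div_const α

theorem measurable_subtree (i : Fin d) :
    Measurable fun U : List (Fin d) → ℝ => subtree U i := by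
  unfold subtree
  fun_prop

theorem measurableSet_isFastestChild (i : Fin d) :
    MeasurableSet {U : List (Fin d) → ℝ | IsFastestChild α U i} := by
  have : {U : List (Fin d) → ℝ | IsFastestChild α U i} =
      ⋂ j, ⋂ (_ : j ≠ i), {U | escapeTime α (subtree U i) < escapeTime α (subtree U j)} := by
    ext U; simp [IsFastestChild]
  rw [this]
  exact MeasurableSet.iInter fun j => MeasurableSet.iInter fun _ =>
    measurableSet_lt (measurable_escapeTime.comp (measurable_subtree i))
      (measurable_escapeTime.comp (measurable_subtree j))

end Tree

/-! ### The law of the percolation configuration -/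

section RootSplitting

variable {d : ℕ} {α : ℝ}

/-- The configuration with value `u` at the root and the configurations `ω i` above its
children. -/
def joinTree (q : ℝ × (Fin d → List (Fin d) → ℝ)) : List (Fin d) → ℝ
  | [] => q.1
  | i :: x => q.2 i x

theorem measurable_joinTree : Measurable (joinTree (d := d)) := by
  refine measurable_pi_lambda _ fun x => ?_
  cases x with
  | nil => exact measurable_fst
  | cons i x =>
    exact (measurable_pi_apply x).comp ((measurable_pi_apply i).comp measurable_snd)

theorem map_joinTree :
    ((expMeasure 1).prod (Measure.pi fun _ : Fin d => percLaw d)).map joinTree = percLaw d := by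
  classical
  refine Measure.eq_infinitePi _ fun s t' ht' => ?_
  -- Factors outside `s` are set to the whole line, so that the box also constrains the root
  -- trivially when the root is not in `s`.
  obtain ⟨t, htdef⟩ : ∃ t : List (Fin d) → Set ℝ, t = fun x => if x ∈ s then t' x else univ :=
    ⟨_, rfl⟩
  have hts : ∀ x ∈ s, t x = t' x := fun x hx => by rw [htdef]; exact if_pos hx
  have htn : ∀ x, x ∉ s → t x = univ := fun x hx => by rw [htdef]; exact if_neg hx
  have ht : ∀ x, MeasurableSet (t x) := by
    intro x
    by_cases hx : x ∈ s
    · rw [hts x hx]; exact ht' x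
    · rw [htn x hx]; exact MeasurableSet.univ
  have hpi : Set.pi (↑s) t' = Set.pi (↑s) t := by
    refine Set.pi_congr rfl fun x hx => (hts x hx).symm
  have hprod : ∏ x ∈ s, (expMeasure 1) (t' x) = ∏ x ∈ s, (expMeasure 1) (t x) :=
    Finset.prod_congr rfl fun x hx => by rw [hts x hx]
  rw [hpi, hprod]
  let c : Fin d → Finset (List (Fin d)) := fun i =>
    s.preimage (fun x => i :: x) (fun x _ y _ hxy => (List.cons_inj_right i).mp hxy)
  have hpre : joinTree ⁻¹' (Set.pi (↑s) t) =
      t [] ×ˢ Set.pi univ fun i => Set.pi (↑(c i)) fun x => t (i :: x) := by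
    ext q
    simp only [mem_preimage, Set.mem_pi, mem_prod, mem_univ, true_implies]
    constructor
    · intro h
      refine ⟨?_, fun i x hx => h (i :: x) (Finset.mem_preimage.mp hx)⟩
      by_cases h0 : [] ∈ s
      · exact h [] h0
      · rw [htn _ h0]; trivial
    · rintro ⟨h0, h1⟩ x hx
      cases x with
      | nil => exact h0
      | cons i x => exact h1 i x (Finset.mem_preimage.mpr hx)
  rw [Measure.map_apply measurable_joinTree
    (MeasurableSet.pi (Finset.countable_toSet s) fun x _ => ht x), hpre, Measure.prod_prod,
    Measure.pi_pi]
  have hbox : ∀ i, percLaw d (Set.pi (↑(c i)) fun x => t (i :: x)) =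
      ∏ x ∈ c i, (expMeasure 1) (t (i :: x)) := fun i =>
    Measure.infinitePi_pi _ fun x _ => ht (i :: x)
  simp only [hbox]
  have hsub : s ⊆ insert [] (Finset.univ.biUnion fun i => (c i).image fun x => i :: x) := by
    intro x hx
    cases x with
    | nil => simp
    | cons i x =>
      exact Finset.mem_insert_of_mem (Finset.mem_biUnion.mpr ⟨i, Finset.mem_univ _,
        Finset.mem_image.mpr ⟨x, Finset.mem_preimage.mpr hx, rfl⟩⟩)
  rw [Finset.prod_subset hsub fun x _ hx => by rw [htn x hx, measure_univ],
    Finset.prod_insert (by simp), Finset.prod_biUnion]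
  · congr 1
    refine Finset.prod_congr rfl fun i _ => ?_
    rw [Finset.prod_image fun x _ y _ hxy => (List.cons_inj_right i).mp hxy]
  · intro i _ j _ hij
    rw [Function.onFun, Finset.disjoint_left]
    intro x hx hy
    obtain ⟨y, -, rfl⟩ := Finset.mem_image.mp hx
    obtain ⟨z, -, hz⟩ := Finset.mem_image.mp hy
    exact hij (List.cons.inj hz).1.symm

/-- The value at the root and the configurations above the children. -/
def splitTree (U : List (Fin d) → ℝ) : ℝ × (Fin d → List (Fin d) → ℝ) :=
  (U [], fun i => subtree U i)

theorem measurePreserving_splitTree : MeasurePreserving (splitTree (d := d)) (percLaw d)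
    ((expMeasure 1).prod (Measure.pi fun _ : Fin d => percLaw d)) := by
  have hm : Measurable (splitTree (d := d)) :=
    (measurable_pi_apply _).prodMk (measurable_pi_lambda _ fun i => measurable_subtree i)
  refine ⟨hm, ?_⟩
  conv_lhs => rw [← map_joinTree, Measure.map_map hm measurable_joinTree]
  exact Measure.map_id

theorem measurePreserving_root :
    MeasurePreserving (fun U : List (Fin d) → ℝ => U []) (percLaw d) (expMeasure 1) :=
  measurePreserving_fst.comp measurePreserving_splitTree

theorem measurePreserving_subtrees :
    MeasurePreserving (fun (U : List (Fin d) → ℝ) i => subtree U i) (percLaw d)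
      (Measure.pi fun _ : Fin d => percLaw d) :=
  measurePreserving_snd.comp measurePreserving_splitTree

theorem measurePreserving_subtree (i : Fin d) :
    MeasurePreserving (fun U : List (Fin d) → ℝ => subtree U i) (percLaw d) (percLaw d) :=
  (measurePreserving_eval (fun _ : Fin d => percLaw d) i).comp measurePreserving_subtrees

/-- The value at the root is independent of the configurations above the children. -/
theorem lintegral_root {S : Type*} [MeasurableSpace S] {k : (Fin d → List (Fin d) → ℝ) → S}
    (hk : Measurable k) {Φ : ℝ × S → ℝ≥0∞} (hΦ : Measurable Φ) :
    ∫⁻ U, Φ (U [], k fun i => subtree U i) ∂percLaw d =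
      ∫⁻ U, ∫⁻ u, Φ (u, k fun i => subtree U i) ∂expMeasure 1 ∂percLaw d := by
  have h1 : Measurable fun q : ℝ × (Fin d → List (Fin d) → ℝ) => Φ (q.1, k q.2) := by fun_prop
  have e1 := measurePreserving_splitTree.lintegral_comp h1
  have e2 := (measurePreserving_subtrees (d := d)).lintegral_comp
    (f := fun ω => ∫⁻ u, Φ (u, k ω) ∂expMeasure 1)
    (Measurable.lintegral_prod_left' (f := fun q : ℝ × (Fin d → List (Fin d) → ℝ) =>
      Φ (q.1, k q.2)) h1)
  rw [lintegral_prod_symm _ h1.aemeasurable] at e1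
  exact e1.trans e2.symm

/-- The probability that the first generation escapes to infinity only after time `v`. -/
noncomputable def survival (d : ℕ) (α v : ℝ) : ℝ≥0∞ :=
  percLaw d {U | ENNReal.ofReal v < escapeTime α U}

theorem survival_antitone : Antitone (survival d α) := fun _ _ h =>
  measure_mono fun _ hU => (ENNReal.ofReal_le_ofReal h).trans_lt hU

/-- Given the subtree of child i, the other d - 1 subtrees are independent and each must escape
later. Finiteness is needed since `survival` takes a real argument. -/
theorem lintegral_isFastestChild (hfin : ∀ᵐ U ∂percLaw d, escapeTime α U ≠ ⊤) (i : Fin d)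
    {ψ : (List (Fin d) → ℝ) → ℝ≥0∞} (hψ : Measurable ψ) :
    ∫⁻ U, {U | IsFastestChild α U i}.indicator (fun U => ψ (subtree U i)) U ∂percLaw d =
      ∫⁻ U, ψ U * survival d α (escapeTime α U).toReal ^ (d - 1) ∂percLaw d := by
  obtain ⟨m, rfl⟩ : ∃ m, d = m + 1 := ⟨d - 1, by have := i.pos; omega⟩
  let X := List (Fin (m + 1)) → ℝ
  let A : Set (X × (Fin m → X)) := {q | ∀ k, escapeTime α q.1 < escapeTime α (q.2 k)}
  have hA : MeasurableSet A := by
    have : A = ⋂ k, {q | escapeTime α q.1 < escapeTime α (q.2 k)} := by ext q; simp [A]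
    rw [this]
    exact MeasurableSet.iInter fun k => measurableSet_lt
      (measurable_escapeTime.comp measurable_fst)
      (measurable_escapeTime.comp ((measurable_pi_apply k).comp measurable_snd))
  have hf : Measurable (A.indicator fun q => ψ q.1) := (hψ.comp measurable_fst).indicator hA
  have hmp := (measurePreserving_piFinSuccAbove (fun _ : Fin (m + 1) => percLaw (m + 1)) i).comp
    (measurePreserving_subtrees (d := m + 1))
  have e := hmp.lintegral_comp hf
  have e' : ∫⁻ U, {U | IsFastestChild α U i}.indicator (fun U => ψ (subtree U i)) U
      ∂percLaw (m + 1) = ∫⁻ q, A.indicator (fun q => ψ q.1) q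
        ∂((percLaw (m + 1)).prod (Measure.pi fun _ : Fin m => percLaw (m + 1))) := by
    rw [← e]
    refine lintegral_congr fun U => ?_
    have hiff : U ∈ {U | IsFastestChild α U i} ↔
        ((MeasurableEquiv.piFinSuccAbove (fun _ => X) i) ∘ fun (U : X) i => subtree U i) U ∈ A := by
      constructor
      · intro h k
        exact h (i.succAbove k) (Fin.succAbove_ne i k)
      · intro h j hj
        obtain ⟨k, rfl⟩ := Fin.exists_succAbove_eq hj
        exact h k
    by_cases h : U ∈ {U | IsFastestChild α U i}
    · rw [indicator_of_mem h]
      exact (indicator_of_mem (hiff.mp h) (fun q : X × (Fin m → X) => ψ q.1)).symm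
    · rw [indicator_of_notMem h]
      exact (indicator_of_notMem (fun h' => h (hiff.mpr h')) _).symm
  rw [e', lintegral_prod _ hf.aemeasurable]
  refine lintegral_congr_ae ?_
  filter_upwards [hfin] with x hx
  have : ∀ y : Fin m → X, A.indicator (fun q => ψ q.1) (x, y) =
      (Set.pi univ fun _ => {U | escapeTime α x < escapeTime α U}).indicator
        (fun _ => ψ x) y := by
    intro y
    by_cases h : (x, y) ∈ A
    · rw [indicator_of_mem h, indicator_of_mem (s := Set.pi univ fun _ =>
        {U | escapeTime α x < escapeTime α U}) (Set.mem_univ_pi.mpr h)]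
    · rw [indicator_of_notMem h, indicator_of_notMem (s := Set.pi univ fun _ =>
        {U | escapeTime α x < escapeTime α U}) (fun h' => h (Set.mem_univ_pi.mp h'))]
  simp only [this]
  rw [lintegral_indicator (MeasurableSet.univ_pi fun _ =>
    measurableSet_lt measurable_const measurable_escapeTime), setLIntegral_const,
    Measure.pi_pi, Finset.prod_const, Finset.card_univ, Fintype.card_fin]
  unfold survival
  rw [ENNReal.ofReal_toReal hx, Nat.add_sub_cancel]

end RootSplitting

/-! ### Finiteness of the escape time -/

section Moments

theorem lintegral_expMeasure {f : ℝ → ℝ≥0∞} (hf : Measurable f) :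
    ∫⁻ x, f x ∂expMeasure 1 = ∫⁻ x in Ioi 0, ENNReal.ofReal (Real.exp (-x)) * f x := by
  have e : expMeasure 1 = volume.withDensity (exponentialPDF 1) := rfl
  have hm : Measurable (exponentialPDF 1) := (measurable_exponentialPDFReal 1).ennreal_ofReal
  rw [e, lintegral_withDensity_eq_lintegral_mul _ hm hf, setLIntegral_congr Ioi_ae_eq_Ici,
    ← lintegral_indicator measurableSet_Ici]
  refine lintegral_congr fun x => ?_
  by_cases hx : 0 ≤ x
  · rw [indicator_of_mem (by exact hx), Pi.mul_apply, exponentialPDF_of_nonneg hx]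
    simp
  · rw [indicator_of_notMem (by exact hx), Pi.mul_apply,
      exponentialPDF_of_neg (not_le.mp hx), zero_mul]

theorem ae_expMeasure_pos : ∀ᵐ x ∂expMeasure 1, 0 < x := by
  have hs : MeasurableSet {x : ℝ | ¬0 < x} := measurableSet_Ioi.compl
  rw [ae_iff, ← lintegral_indicator_one hs, lintegral_expMeasure (measurable_one.indicator hs),
    setLIntegral_congr_fun (g := fun _ => 0) measurableSet_Ioi, lintegral_zero]
  intro x hx
  have hx' : 0 < x := hx
  simp [hx']

variable {d : ℕ} {α : ℝ}

theorem ae_root_pos : ∀ᵐ U ∂percLaw d, 0 < U [] :=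
  measurePreserving_root.quasiMeasurePreserving.ae ae_expMeasure_pos

theorem lintegral_exp_expMeasure_ne_top (hα₁ : α < 1) :
    ∫⁻ u, ENNReal.ofReal (Real.exp (α * max u 0)) ∂expMeasure 1 ≠ ⊤ := by
  rw [lintegral_expMeasure (by fun_prop)]
  have h := (exp_neg_integrableOn_Ioi 0 (b := 1 - α) (by linarith)).lintegral_lt_top
  refine ne_top_of_le_ne_top h.ne (setLIntegral_mono' measurableSet_Ioi fun x hx => ?_)
  have hx' : 0 < x := hx
  rw [← ENNReal.ofReal_mul (Real.exp_pos _).le, ← Real.exp_add, max_eq_left hx'.le]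
  refine ENNReal.ofReal_le_ofReal (Real.exp_le_exp.mpr ?_)
  linarith

/-- Hölder's inequality with exponent 1/p against the constant 1. -/
theorem lintegral_rpow_le_rpow_lintegral {S : Type*} [MeasurableSpace S] {μ : Measure S}
    [IsProbabilityMeasure μ] {f : S → ℝ≥0∞} (hf : Measurable f) {p : ℝ} (hp₀ : 0 < p)
    (hp₁ : p < 1) : ∫⁻ x, f x ^ p ∂μ ≤ (∫⁻ x, f x ∂μ) ^ p := by
  have hc : (p⁻¹).HolderConjugate (Real.conjExponent p⁻¹) :=
    Real.HolderConjugate.conjExponent ((one_lt_inv₀ hp₀).mpr hp₁)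
  have h := ENNReal.lintegral_mul_le_Lp_mul_Lq μ hc (f := fun x => f x ^ p) (g := 1)
    (hf.pow_const p).aemeasurable aemeasurable_one
  simpa [← ENNReal.rpow_mul, mul_inv_cancel₀ hp₀.ne'] using h

theorem levelMin_ne_top [NeZero d] (U : List (Fin d) → ℝ) (n : ℕ) : levelMin α U n ≠ ⊤ := by
  obtain ⟨y, -, hy⟩ := exists_hitTime_eq_levelMin (α := α) U n
  rw [← hy]
  exact hitTime_ne_top U y

/-- The exponential moments of the passage times to the successive generations are bounded, by a
recursion on the generation. -/
theorem exists_lintegral_exp_levelMin_le [NeZero d] (hα₀ : 0 < α) (hα₁ : α < 1) :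
    ∃ M : ℝ≥0∞, M ≠ ⊤ ∧ ∀ n, ∫⁻ U : List (Fin d) → ℝ,
      ENNReal.ofReal (Real.exp (α * (levelMin α U n).toReal)) ∂percLaw d ≤ M := by
  obtain ⟨K, hKdef⟩ : ∃ K, K = ∫⁻ u, ENNReal.ofReal (Real.exp (α * max u 0)) ∂expMeasure 1 :=
    ⟨_, rfl⟩
  have hK : K ≠ ⊤ := hKdef ▸ lintegral_exp_expMeasure_ne_top hα₁
  have hK1 : 1 ≤ K := by
    rw [hKdef]
    calc (1 : ℝ≥0∞) = ∫⁻ _, 1 ∂expMeasure 1 := by simp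
      _ ≤ _ := lintegral_mono fun u => by
        rw [← ENNReal.ofReal_one]
        exact ENNReal.ofReal_le_ofReal (Real.one_le_exp (by positivity))
  have hq : 0 < 1 - α := by linarith
  have hKM : K ≤ K ^ (1 / (1 - α)) := by
    conv_lhs => rw [← ENNReal.rpow_one K]
    refine ENNReal.rpow_le_rpow_of_exponent_le hK1 ?_
    rw [le_div_iff₀ hq]
    linarith
  -- Following one child only, the moment m of one generation bounds that of the next by K m^α. The
  -- chosen constant is the fixed point of this map.
  refine ⟨K ^ (1 / (1 - α)), ENNReal.rpow_ne_top_of_nonneg (by positivity) hK, fun n => ?_⟩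
  induction n with
  | zero =>
    simp only [levelMin_zero, ENNReal.toReal_ofReal']
    rw [(measurePreserving_root (d := d)).lintegral_comp
      (f := fun u => ENNReal.ofReal (Real.exp (α * max u 0))) (by fun_prop), ← hKdef]
    exact hKM
  | succ n ih =>
    have hle : ∀ U : List (Fin d) → ℝ, (levelMin α U (n + 1)).toReal ≤
        max (U []) 0 + α * (levelMin α (subtree U 0) n).toReal := by
      intro U
      have h1 : levelMin α U (n + 1) ≤
          ENNReal.ofReal (U []) + ENNReal.ofReal α * levelMin α (subtree U 0) n := by
        rw [levelMin_succ hα₀]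
        gcongr
        exact iInf_le _ 0
      have h2 : ENNReal.ofReal α * levelMin α (subtree U 0) n ≠ ⊤ :=
        ENNReal.mul_ne_top ENNReal.ofReal_ne_top (levelMin_ne_top _ n)
      have h3 := ENNReal.toReal_mono (ENNReal.add_ne_top.mpr ⟨ENNReal.ofReal_ne_top, h2⟩) h1
      rwa [ENNReal.toReal_add ENNReal.ofReal_ne_top h2, ENNReal.toReal_mul,
        ENNReal.toReal_ofReal hα₀.le, ENNReal.toReal_ofReal'] at h3
    have hm : Measurable fun U : List (Fin d) → ℝ => (levelMin α U n).toReal :=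
      (measurable_levelMin n).ennreal_toReal
    let Y : (List (Fin d) → ℝ) → ℝ≥0∞ := fun U =>
      ENNReal.ofReal (Real.exp (α * (levelMin α U n).toReal)) ^ α
    have hY : Measurable Y := by
      change Measurable fun U => ENNReal.ofReal (Real.exp (α * (levelMin α U n).toReal)) ^ α
      fun_prop
    calc ∫⁻ U : List (Fin d) → ℝ,
          ENNReal.ofReal (Real.exp (α * (levelMin α U (n + 1)).toReal)) ∂percLaw d
        ≤ ∫⁻ U : List (Fin d) → ℝ, (fun q : ℝ × ℝ≥0∞ =>
            ENNReal.ofReal (Real.exp (α * max q.1 0)) * q.2) (U [], Y (subtree U 0)) ∂percLaw d := by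
          refine lintegral_mono fun U => ?_
          change _ ≤ ENNReal.ofReal (Real.exp (α * max (U []) 0)) *
            ENNReal.ofReal (Real.exp (α * (levelMin α (subtree U 0) n).toReal)) ^ α
          rw [ENNReal.ofReal_rpow_of_pos (Real.exp_pos _), ← Real.exp_mul,
            ← ENNReal.ofReal_mul (Real.exp_pos _).le, ← Real.exp_add]
          refine ENNReal.ofReal_le_ofReal (Real.exp_le_exp.mpr ?_)
          have := mul_le_mul_of_nonneg_left (hle U) hα₀.le
          linarith
      _ = K * ∫⁻ U, Y U ∂percLaw d := by
          have hΦ : Measurable fun q : ℝ × ℝ≥0∞ =>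
              ENNReal.ofReal (Real.exp (α * max q.1 0)) * q.2 := by fun_prop
          have := lintegral_root (d := d) (k := fun ω => Y (ω 0)) (by fun_prop) hΦ
          rw [this]
          have h' : ∀ U : List (Fin d) → ℝ, ∫⁻ u, ENNReal.ofReal (Real.exp (α * max u 0)) *
              Y (subtree U 0) ∂expMeasure 1 = K * Y (subtree U 0) := fun U => by
            rw [lintegral_mul_const _ (by fun_prop), hKdef]
          simp only [h']
          rw [lintegral_const_mul K
            (f := fun U => Y (subtree U 0)) (hY.comp (measurable_subtree 0)),
            (measurePreserving_subtree (d := d) 0).lintegral_comp hY]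
      _ ≤ K * (K ^ (1 / (1 - α))) ^ α := by
          gcongr
          refine (lintegral_rpow_le_rpow_lintegral (by fun_prop) hα₀ hα₁).trans ?_
          exact ENNReal.rpow_le_rpow ih hα₀.le
      _ = K ^ (1 / (1 - α)) := by
          rw [← ENNReal.rpow_mul]
          conv_lhs => enter [1]; rw [← ENNReal.rpow_one K]
          rw [← ENNReal.rpow_add_of_nonneg _ _ zero_le_one (by positivity)]
          congr 1
          field_simp
          ring

/-- By monotone convergence and x ≤ e^x, the bounded exponential moments of the generation minima
give the escape time a finite mean. -/
theorem ae_escapeTime_ne_top [NeZero d] (hα₀ : 0 < α) (hα₁ : α < 1) :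
    ∀ᵐ U ∂percLaw d, escapeTime α U ≠ ⊤ := by
  obtain ⟨M, hM, hle⟩ := exists_lintegral_exp_levelMin_le (d := d) hα₀ hα₁
  have h : ∫⁻ U, ENNReal.ofReal α * escapeTime α U ∂percLaw d ≤ M := by
    simp only [escapeTime, ENNReal.mul_iSup]
    rw [lintegral_iSup (fun n => (measurable_levelMin n).const_mul _)
      fun m n hmn U => mul_le_mul_right (levelMin_mono U hmn) _]
    refine iSup_le fun n => (lintegral_mono fun U => ?_).trans (hle n)
    rw [← ENNReal.ofReal_toReal (levelMin_ne_top (α := α) U n), ← ENNReal.ofReal_mul hα₀.le,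
      ENNReal.toReal_ofReal ENNReal.toReal_nonneg]
    refine ENNReal.ofReal_le_ofReal ?_
    have := Real.add_one_le_exp (α * (levelMin α U n).toReal)
    linarith
  filter_upwards [ae_lt_top (measurable_escapeTime.const_mul _) (ne_top_of_le_ne_top hM h)]
    with U hU htop
  rw [htop, ENNReal.mul_top (by simpa using hα₀)] at hU
  exact lt_irrefl _ hU

theorem lintegral_exp_escapeTime_ne_top [NeZero d] (hα₀ : 0 < α) (hα₁ : α < 1) :
    ∫⁻ U : List (Fin d) → ℝ, ENNReal.ofReal (Real.exp (α * (escapeTime α U).toReal))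
      ∂percLaw d ≠ ⊤ := by
  obtain ⟨M, hM, hle⟩ := exists_lintegral_exp_levelMin_le (d := d) hα₀ hα₁
  refine ne_top_of_le_ne_top hM ?_
  calc ∫⁻ U : List (Fin d) → ℝ, ENNReal.ofReal (Real.exp (α * (escapeTime α U).toReal)) ∂percLaw d
      ≤ ∫⁻ U : List (Fin d) → ℝ, Filter.liminf
          (fun n => ENNReal.ofReal (Real.exp (α * (levelMin α U n).toReal))) Filter.atTop
          ∂percLaw d := by
        refine lintegral_mono_ae ?_
        filter_upwards [ae_escapeTime_ne_top hα₀ hα₁] with U hU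
        have ht : Filter.Tendsto (fun n => ENNReal.ofReal
            (Real.exp (α * (levelMin α U n).toReal))) Filter.atTop
            (nhds (ENNReal.ofReal (Real.exp (α * (escapeTime α U).toReal)))) := by
          refine ENNReal.tendsto_ofReal ((Real.continuous_exp.tendsto _).comp ?_)
          exact ((ENNReal.tendsto_toReal hU).comp
            (tendsto_atTop_iSup (levelMin_mono U))).const_mul α
        exact ht.liminf_eq.ge
    _ ≤ Filter.liminf (fun n => ∫⁻ U : List (Fin d) → ℝ,
          ENNReal.ofReal (Real.exp (α * (levelMin α U n).toReal)) ∂percLaw d) Filter.atTop :=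
        lintegral_liminf_le fun n => by
          have := (measurable_levelMin (d := d) (α := α) n).ennreal_toReal
          fun_prop
    _ ≤ M := by
        refine (Filter.liminf_le_liminf (Filter.Eventually.of_forall hle)).trans ?_
        simp

end Moments

/-! ### Regularity of the configuration -/

section Regularity

variable {d : ℕ} {α : ℝ}

theorem ae_escapeTime_pos : ∀ᵐ U ∂percLaw d, 0 < escapeTime α U := by
  filter_upwards [ae_root_pos] with U hU
  rw [escapeTime_eq_add]
  exact (ENNReal.ofReal_pos.mpr hU).trans_le le_self_add

theorem expMeasure_absolutelyContinuous : expMeasure 1 ≪ volume :=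
  withDensity_absolutelyContinuous _ _

/-- The value at the root is independent of the rest of the configuration and has a density, so
that the law of the escape time has no atoms. -/
theorem measure_escapeTime_eq [NeZero d] (hα₀ : 0 < α) (c : ℝ≥0∞) (hc : c ≠ ⊤) :
    percLaw d {U | escapeTime α U = c} = 0 := by
  have hm : MeasurableSet {U : List (Fin d) → ℝ | escapeTime α U = c} :=
    measurable_escapeTime (measurableSet_singleton c)
  let k : (Fin d → List (Fin d) → ℝ) → ℝ≥0∞ := fun ω => ⨅ i, ENNReal.ofReal α * escapeTime α (ω i)
  have hk : Measurable k := Measurable.iInf fun i =>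
    (measurable_escapeTime.comp (measurable_pi_apply i)).const_mul _
  let S : Set (ℝ × ℝ≥0∞) := {q | ENNReal.ofReal q.1 + q.2 = c}
  have hS : MeasurableSet S := by
    have : Measurable fun q : ℝ × ℝ≥0∞ => ENNReal.ofReal q.1 + q.2 := by fun_prop
    exact this (measurableSet_singleton c)
  have hΦ : Measurable (S.indicator (1 : ℝ × ℝ≥0∞ → ℝ≥0∞)) := measurable_one.indicator hS
  have h := lintegral_root hk hΦ
  have e : ∀ U : List (Fin d) → ℝ, S.indicator (1 : ℝ × ℝ≥0∞ → ℝ≥0∞) (U [], k fun i => subtree U i) =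
      {U | escapeTime α U = c}.indicator 1 U := by
    intro U
    have hiff : (U [], k fun i => subtree U i) ∈ S ↔ escapeTime α U = c := by
      rw [escapeTime_eq hα₀]
      exact Iff.rfl
    by_cases hU : escapeTime α U = c
    · rw [indicator_of_mem (hiff.mpr hU), indicator_of_mem (show U ∈ {U | escapeTime α U = c} from hU)]
      rfl
    · rw [indicator_of_notMem (fun h' => hU (hiff.mp h')),
        indicator_of_notMem (show U ∉ {U | escapeTime α U = c} from hU)]
  simp only [e] at h
  rw [lintegral_indicator_one hm] at h
  rw [h]
  refine (lintegral_congr fun U => ?_).trans lintegral_zero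
  generalize k (fun i => subtree U i) = t
  have hsec : MeasurableSet {u : ℝ | (u, t) ∈ S} := measurable_prodMk_right hS
  change ∫⁻ u, {u : ℝ | (u, t) ∈ S}.indicator 1 u ∂expMeasure 1 = 0
  rw [lintegral_indicator_one hsec]
  -- Given the contribution t of the children, at most one positive root value produces c.
  refine measure_mono_null (t := {u | ¬0 < u} ∪ {(c - t).toReal}) ?_
    (measure_union_null (ae_iff.mp ae_expMeasure_pos)
      (expMeasure_absolutelyContinuous Real.volume_singleton))
  intro u hu
  by_cases hu0 : 0 < u
  · right
    have hu' : ENNReal.ofReal u + t = c := hu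
    have ht : t ≠ ⊤ := fun h => hc (by rw [← hu', h, add_top])
    rw [mem_singleton_iff, ← hu', ENNReal.add_sub_cancel_right ht, ENNReal.toReal_ofReal hu0.le]
  · exact Or.inl hu0

/-- Ties are null by Fubini: the two escape times are independent and without atoms. -/
theorem ae_escapeTime_subtree_ne [NeZero d] (hα₀ : 0 < α) (hα₁ : α < 1) {i j : Fin d}
    (hij : j ≠ i) : ∀ᵐ U ∂percLaw d, escapeTime α (subtree U i) ≠ escapeTime α (subtree U j) := by
  obtain ⟨m, rfl⟩ : ∃ m, d = m + 1 := ⟨d - 1, by have := i.pos; omega⟩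
  obtain ⟨k, rfl⟩ := Fin.exists_succAbove_eq hij
  have hmp := (measurePreserving_piFinSuccAbove (fun _ : Fin (m + 1) => percLaw (m + 1)) i).comp
    (measurePreserving_subtrees (d := m + 1))
  have hp : ∀ᵐ q ∂(percLaw (m + 1)).prod (Measure.pi fun _ : Fin m => percLaw (m + 1)),
      escapeTime α q.1 ≠ escapeTime α (q.2 k) := by
    rw [ae_iff]
    simp only [not_not]
    refine Measure.measure_prod_null_of_ae_null (measurableSet_eq_fun
      (measurable_escapeTime.comp measurable_fst)
      (measurable_escapeTime.comp ((measurable_pi_apply k).comp measurable_snd))) ?_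
    filter_upwards [ae_escapeTime_ne_top (d := m + 1) hα₀ hα₁] with x hx
    have h := (measurePreserving_eval (fun _ : Fin m => percLaw (m + 1)) k).measure_preimage
      (s := {U | escapeTime α U = escapeTime α x})
      (measurable_escapeTime (measurableSet_singleton _)).nullMeasurableSet
    rw [measure_escapeTime_eq hα₀ _ hx] at h
    refine measure_mono_null (fun y hy => ?_) h
    exact (show escapeTime α x = escapeTime α (y k) from hy).symm
  exact hmp.quasiMeasurePreserving.ae hp

theorem ae_hasFastestChild [NeZero d] (hα₀ : 0 < α) (hα₁ : α < 1) :
    ∀ᵐ U ∂percLaw d, HasFastestChild α U := by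
  have h1 : ∀ᵐ U ∂percLaw d, ∀ i j : Fin d, j ≠ i →
      escapeTime α (subtree U i) ≠ escapeTime α (subtree U j) := by
    refine ae_all_iff.mpr fun i => ae_all_iff.mpr fun j => ?_
    by_cases hij : j = i
    · exact Filter.Eventually.of_forall fun _ h => absurd hij h
    · filter_upwards [ae_escapeTime_subtree_ne hα₀ hα₁ hij] with U hU _ using hU
  have h2 : ∀ᵐ U ∂percLaw d, ∀ i : Fin d, 0 < escapeTime α (subtree U i) := ae_all_iff.mpr fun i =>
    (measurePreserving_subtree i).quasiMeasurePreserving.ae ae_escapeTime_pos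
  have h3 : ∀ᵐ U ∂percLaw d, ∀ i : Fin d, escapeTime α (subtree U i) ≠ ⊤ := ae_all_iff.mpr fun i =>
    (measurePreserving_subtree i).quasiMeasurePreserving.ae (ae_escapeTime_ne_top hα₀ hα₁)
  filter_upwards [h1, h2, h3] with U hU1 hU2 hU3
  obtain ⟨i, hi⟩ := Finite.exists_min fun i => escapeTime α (subtree U i)
  exact ⟨i, fun j hj => lt_of_le_of_ne (hi j) (hU1 i j hj), hU2 i, hU3 i⟩

theorem measurePreserving_subtreeAt (x : List (Fin d)) :
    MeasurePreserving (fun U : List (Fin d) → ℝ => subtreeAt U x) (percLaw d) (percLaw d) := by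
  induction x with
  | nil => exact MeasurePreserving.id _
  | cons i x ih => exact ih.comp (measurePreserving_subtree i)

theorem ae_isRegularConfig [NeZero d] (hα₀ : 0 < α) (hα₁ : α < 1) :
    ∀ᵐ U ∂percLaw d, IsRegularConfig α U :=
  ae_all_iff.mpr fun x =>
    (measurePreserving_subtreeAt x).quasiMeasurePreserving.ae (ae_hasFastestChild hα₀ hα₁)

end Regularity

/-! ### The law of `W₀` -/

section InitialLaw

variable {d : ℕ} {α : ℝ}

instance initialLaw_isProbabilityMeasure : IsProbabilityMeasure (initialLaw d α) :=
  Measure.isProbabilityMeasure_map measurable_backboneTime_zero.aemeasurable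

theorem lintegral_initialLaw {f : ℝ → ℝ≥0∞} (hf : Measurable f) :
    ∫⁻ w, f w ∂initialLaw d α = ∫⁻ U : List (Fin d) → ℝ, f (backboneTime α 0 U) ∂percLaw d :=
  lintegral_map hf measurable_backboneTime_zero

theorem ae_initialLaw_pos [NeZero d] (hα₀ : 0 < α) (hα₁ : α < 1) :
    ∀ᵐ w ∂initialLaw d α, 0 < w := by
  unfold initialLaw
  rw [ae_map_iff measurable_backboneTime_zero.aemeasurable measurableSet_Ioi]
  filter_upwards [ae_hasFastestChild hα₀ hα₁] with U ⟨i, hi, hpos, hfin⟩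
  rw [hi.backboneTime_zero hα₀]
  exact ENNReal.toReal_pos hpos.ne' hfin

/-- The normalizing constant of the tilted law. -/
noncomputable def tiltMass (d : ℕ) (α : ℝ) : ℝ≥0∞ :=
  ∫⁻ w, ENNReal.ofReal (Real.exp (α * w)) ∂initialLaw d α

theorem tiltMass_ne_top [NeZero d] (hα₀ : 0 < α) (hα₁ : α < 1) : tiltMass d α ≠ ⊤ := by
  unfold tiltMass
  rw [lintegral_initialLaw (by fun_prop)]
  have hm : Measurable fun U : List (Fin d) → ℝ =>
      ENNReal.ofReal (Real.exp (α * (escapeTime α U).toReal)) := by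
    have := (measurable_escapeTime (d := d) (α := α)).ennreal_toReal
    fun_prop
  have e := (measurePreserving_subtree (d := d) 0).lintegral_comp hm
  refine ne_top_of_le_ne_top (lintegral_exp_escapeTime_ne_top (d := d) hα₀ hα₁) ?_
  rw [← e]
  refine lintegral_mono_ae ?_
  filter_upwards [ae_hasFastestChild hα₀ hα₁, (measurePreserving_subtree (d := d)
    0).quasiMeasurePreserving.ae (ae_escapeTime_ne_top hα₀ hα₁)] with U ⟨i, hi, _⟩ hfin
  rw [hi.backboneTime_zero hα₀]
  refine ENNReal.ofReal_le_ofReal (Real.exp_le_exp.mpr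
    (mul_le_mul_of_nonneg_left (ENNReal.toReal_mono hfin ?_) hα₀.le))
  by_cases h : (0 : Fin d) = i
  · rw [h]
  · exact (hi 0 h).le

theorem integrable_exp_initialLaw [NeZero d] (hα₀ : 0 < α) (hα₁ : α < 1) :
    Integrable (fun w => Real.exp (α * w)) (initialLaw d α) := by
  refine (lintegral_ofReal_ne_top_iff_integrable ?_ ?_).mp (tiltMass_ne_top hα₀ hα₁)
  · exact Measurable.aestronglyMeasurable (by fun_prop)
  · exact Filter.Eventually.of_forall fun _ => (Real.exp_pos _).le

theorem tiltedLaw_isProbabilityMeasure [NeZero d] (hα₀ : 0 < α) (hα₁ : α < 1) :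
    IsProbabilityMeasure (tiltedLaw d α) :=
  isProbabilityMeasure_tilted (integrable_exp_initialLaw hα₀ hα₁)

theorem tiltMass_mul_lintegral_tiltedLaw [NeZero d] (hα₀ : 0 < α) (hα₁ : α < 1) {g : ℝ → ℝ≥0∞}
    (hg : Measurable g) : tiltMass d α * ∫⁻ w, g w ∂tiltedLaw d α =
      ∫⁻ w, ENNReal.ofReal (Real.exp (α * w)) * g w ∂initialLaw d α := by
  have hint := integrable_exp_initialLaw (d := d) hα₀ hα₁
  have hpos : 0 < ∫ w, Real.exp (α * w) ∂initialLaw d α := integral_exp_pos hint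
  have hZ : tiltMass d α = ENNReal.ofReal (∫ w, Real.exp (α * w) ∂initialLaw d α) :=
    (ofReal_integral_eq_lintegral_ofReal hint
      (Filter.Eventually.of_forall fun _ => (Real.exp_pos _).le)).symm
  unfold tiltedLaw
  rw [lintegral_tilted, hZ, ← lintegral_const_mul _ (by fun_prop)]
  refine lintegral_congr fun w => ?_
  rw [← mul_assoc, ← ENNReal.ofReal_mul hpos.le, mul_div_cancel₀ _ hpos.ne']

theorem lintegral_initialLaw_eq_tiltedLaw [NeZero d] (hα₀ : 0 < α) (hα₁ : α < 1) {g : ℝ → ℝ≥0∞}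
    (hg : Measurable g) : ∫⁻ w, g w ∂initialLaw d α =
      tiltMass d α * ∫⁻ w, ENNReal.ofReal (Real.exp (-(α * w))) * g w ∂tiltedLaw d α := by
  rw [tiltMass_mul_lintegral_tiltedLaw hα₀ hα₁ (by fun_prop)]
  refine lintegral_congr fun w => ?_
  rw [← mul_assoc, ← ENNReal.ofReal_mul (Real.exp_pos _).le, ← Real.exp_add, add_neg_cancel,
    Real.exp_zero, ENNReal.ofReal_one, one_mul]

/-- The density of F with respect to the unnormalized tilted law is e^{-αw}, at most 1 on w > 0. -/
theorem initialLaw_le [NeZero d] (hα₀ : 0 < α) (hα₁ : α < 1) :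
    initialLaw d α ≤ tiltMass d α • tiltedLaw d α := by
  have hΛpos : ∀ᵐ w ∂tiltedLaw d α, 0 < w :=
    (tilted_absolutelyContinuous _ _).ae_le (ae_initialLaw_pos hα₀ hα₁)
  refine Measure.le_intro fun s hs _ => ?_
  have h1 : Measurable (s.indicator (1 : ℝ → ℝ≥0∞)) := measurable_one.indicator hs
  rw [← lintegral_indicator_one hs, lintegral_initialLaw_eq_tiltedLaw hα₀ hα₁ h1,
    Measure.smul_apply, smul_eq_mul, ← lintegral_indicator_one (μ := tiltedLaw d α) hs]
  refine mul_le_mul' le_rfl (lintegral_mono_ae ?_)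
  filter_upwards [hΛpos] with w hw
  refine mul_le_of_le_one_left zero_le ?_
  rw [ENNReal.ofReal_le_one, Real.exp_le_one_iff]
  have := mul_pos hα₀ hw
  linarith

/-! ### The joint law of the escape time and `W₀` -/

/-- The function of the configurations above the children of the root that gives `W₀`. -/
noncomputable def childrenTime (α : ℝ) (ω : Fin d → List (Fin d) → ℝ) : ℝ :=
  (⨅ i, ENNReal.ofReal α * escapeTime α (ω i)).toReal / α

theorem measurable_childrenTime : Measurable (childrenTime (d := d) α) := by
  have : Measurable fun ω : Fin d → List (Fin d) → ℝ =>
      ⨅ i, ENNReal.ofReal α * escapeTime α (ω i) := Measurable.iInf fun i =>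
    (measurable_escapeTime.comp (measurable_pi_apply i)).const_mul _
  exact this.ennreal_toReal.div_const α

theorem backboneTime_zero_eq_childrenTime [NeZero d] (hα₀ : 0 < α) (U : List (Fin d) → ℝ) :
    backboneTime α 0 U = childrenTime α fun i => subtree U i := by
  rw [backboneTime_zero, timeToInfinity_nil hα₀]
  rfl

theorem ae_escapeTime_toReal [NeZero d] (hα₀ : 0 < α) (hα₁ : α < 1) :
    ∀ᵐ U : List (Fin d) → ℝ ∂percLaw d,
      (escapeTime α U).toReal = U [] + α * backboneTime α 0 U := by
  filter_upwards [ae_root_pos, ae_escapeTime_ne_top hα₀ hα₁] with U hU hfin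
  rw [escapeTime_eq_add] at hfin ⊢
  rw [ENNReal.toReal_add ENNReal.ofReal_ne_top (ENNReal.add_ne_top.mp hfin).2,
    ENNReal.toReal_ofReal hU.le, backboneTime_zero, mul_div_cancel₀ _ hα₀.ne']

theorem lintegral_escapeTime_children [NeZero d] (hα₀ : 0 < α) (hα₁ : α < 1)
    {k : (Fin d → List (Fin d) → ℝ) → ℝ} (hk : Measurable k) {Φ : ℝ → ℝ → ℝ≥0∞}
    (hΦ : Measurable (Function.uncurry Φ)) :
    ∫⁻ U, Φ (escapeTime α U).toReal (k fun i => subtree U i) ∂percLaw d =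
      ∫⁻ U, ∫⁻ u, Φ (u + α * backboneTime α 0 U) (k fun i => subtree U i)
        ∂expMeasure 1 ∂percLaw d := by
  have hk' : Measurable fun ω : Fin d → List (Fin d) → ℝ => (childrenTime α ω, k ω) :=
    measurable_childrenTime.prodMk hk
  have hΦ' : Measurable fun q : ℝ × ℝ × ℝ => Φ (q.1 + α * q.2.1) q.2.2 :=
    hΦ.comp (f := fun q : ℝ × ℝ × ℝ => (q.1 + α * q.2.1, q.2.2)) (by fun_prop)
  have h := lintegral_root hk' hΦ'
  simp only [← backboneTime_zero_eq_childrenTime hα₀] at h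
  rw [← h]
  refine lintegral_congr_ae ?_
  filter_upwards [ae_escapeTime_toReal hα₀ hα₁] with U hU
  rw [hU]

theorem lintegral_expMeasure_add {c : ℝ} (hc : 0 ≤ c) {f : ℝ → ℝ≥0∞} (hf : Measurable f) :
    ∫⁻ u, f (u + c) ∂expMeasure 1 =
      ∫⁻ v in Ioi 0, (Ioi c).indicator (fun v => ENNReal.ofReal (Real.exp (c - v)) * f v) v := by
  rw [lintegral_expMeasure (by fun_prop), ← lintegral_indicator measurableSet_Ioi,
    ← lintegral_indicator measurableSet_Ioi]
  refine Eq.trans ?_ (lintegral_add_right_eq_self _ c)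
  refine lintegral_congr fun u => ?_
  by_cases hu : 0 < u
  · have h1 : u + c ∈ Ioi (0 : ℝ) := by simp only [mem_Ioi]; linarith
    have h2 : u + c ∈ Ioi c := by simp only [mem_Ioi]; linarith
    rw [indicator_of_mem (show u ∈ Ioi (0 : ℝ) from hu), indicator_of_mem h1, indicator_of_mem h2]
    congr 3
    ring
  · have h2 : u + c ∉ Ioi c := by simp only [mem_Ioi]; linarith
    rw [indicator_of_notMem (show u ∉ Ioi (0 : ℝ) from hu)]
    simp only [indicator, h2, if_false, ite_self]

/-- The joint law of the escape time from the root and `W₀`. -/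
theorem lintegral_escapeTime_backboneTime [NeZero d] (hα₀ : 0 < α) (hα₁ : α < 1)
    {Φ : ℝ → ℝ → ℝ≥0∞} (hΦ : Measurable (Function.uncurry Φ)) :
    ∫⁻ U : List (Fin d) → ℝ, Φ (escapeTime α U).toReal (backboneTime α 0 U) ∂percLaw d =
      ∫⁻ v in Ioi 0, ENNReal.ofReal (Real.exp (-v)) *
        (tiltMass d α * ∫⁻ w in Ioo 0 (v / α), Φ v w ∂tiltedLaw d α) := by
  have hΛpos : ∀ᵐ w ∂tiltedLaw d α, 0 < w :=
    (tilted_absolutelyContinuous _ _).ae_le (ae_initialLaw_pos hα₀ hα₁)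
  have h0 := lintegral_escapeTime_children hα₀ hα₁ (measurable_childrenTime (d := d) (α := α)) hΦ
  simp only [← backboneTime_zero_eq_childrenTime hα₀] at h0
  -- Given W₀ = w, the escape time has density e^{αw - v} on v > αw. The factor e^{αw} turns F into
  -- the tilted law, and e^{-v} stays outside.
  let G : ℝ → ℝ → ℝ≥0∞ := fun w v =>
    (Ioi (α * w)).indicator (fun v => ENNReal.ofReal (Real.exp (α * w - v)) * Φ v w) v
  have hG : Measurable (Function.uncurry G) := by
    have hs : MeasurableSet {q : ℝ × ℝ | α * q.1 < q.2} :=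
      measurableSet_lt (by fun_prop) (by fun_prop)
    have hm : Measurable fun q : ℝ × ℝ =>
        ENNReal.ofReal (Real.exp (α * q.1 - q.2)) * Φ q.2 q.1 :=
      Measurable.mul (by fun_prop) (hΦ.comp measurable_swap)
    exact hm.indicator hs
  have hinner : Measurable fun w : ℝ => ∫⁻ u, Φ (u + α * w) w ∂expMeasure 1 := by
    have : Measurable fun q : ℝ × ℝ => Φ (q.1 + α * q.2) q.2 :=
      hΦ.comp (f := fun q : ℝ × ℝ => (q.1 + α * q.2, q.2)) (by fun_prop)
    exact this.lintegral_prod_left'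
  calc _ = ∫⁻ w, ∫⁻ u, Φ (u + α * w) w ∂expMeasure 1 ∂initialLaw d α := by
        rw [h0, lintegral_initialLaw hinner]
    _ = ∫⁻ w, (∫⁻ v in Ioi 0, G w v) ∂initialLaw d α := by
        refine lintegral_congr_ae ?_
        filter_upwards [ae_initialLaw_pos hα₀ hα₁] with w hw
        exact lintegral_expMeasure_add (f := fun v => Φ v w) (by positivity)
          (hΦ.comp measurable_prodMk_right)
    _ = ∫⁻ v in Ioi 0, ∫⁻ w, G w v ∂initialLaw d α :=
        lintegral_lintegral_swap hG.aemeasurable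
    _ = _ := by
        refine setLIntegral_congr_fun measurableSet_Ioi fun v hv => ?_
        have hGv : Measurable fun w => G w v := hG.comp measurable_prodMk_right
        have hΦv : Measurable fun w => Φ v w := hΦ.comp measurable_prodMk_left
        rw [lintegral_initialLaw_eq_tiltedLaw hα₀ hα₁ hGv, mul_left_comm,
          ← lintegral_const_mul _ hΦv, ← lintegral_indicator measurableSet_Ioo]
        congr 1
        refine lintegral_congr_ae ?_
        filter_upwards [hΛpos] with w hw
        by_cases h : α * w < v
        · have h' : w ∈ Ioo 0 (v / α) := ⟨hw, by rw [lt_div_iff₀ hα₀]; linarith⟩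
          rw [indicator_of_mem h']
          change _ * (Ioi (α * w)).indicator _ v = _
          rw [indicator_of_mem (show v ∈ Ioi (α * w) from h), ← mul_assoc,
            ← ENNReal.ofReal_mul (Real.exp_pos _).le, ← Real.exp_add]
          congr 3
          ring
        · have h' : w ∉ Ioo 0 (v / α) := fun hh => h (by
            have := hh.2
            rw [lt_div_iff₀ hα₀] at this
            linarith)
          rw [indicator_of_notMem h']
          change _ * (Ioi (α * w)).indicator _ v = _
          rw [indicator_of_notMem (show v ∉ Ioi (α * w) from h), mul_zero]

/-! ### The tilted law is of pantograph type -/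

/-- The density of the law of `W₀` with respect to that of the escape time. -/
noncomputable def fastDensity (d : ℕ) (α v : ℝ) : ℝ≥0∞ := d * survival d α v ^ (d - 1)

theorem fastDensity_antitone : Antitone (fastDensity d α) := fun _ _ h => by
  unfold fastDensity
  gcongr
  exact survival_antitone h

/-- Almost surely exactly one child is the fastest, and each of the d candidates contributes the
same integral over a single subtree. -/
theorem lintegral_eq_of_isFastestChild [NeZero d] (hα₀ : 0 < α) (hα₁ : α < 1)
    {Ψ ψ : (List (Fin d) → ℝ) → ℝ≥0∞} (hψ : Measurable ψ)
    (h : ∀ᵐ U ∂percLaw d, ∀ i, IsFastestChild α U i → Ψ U = ψ (subtree U i)) :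
    ∫⁻ U, Ψ U ∂percLaw d = ∫⁻ U, ψ U * fastDensity d α (escapeTime α U).toReal ∂percLaw d := by
  have hfin := ae_escapeTime_ne_top (d := d) hα₀ hα₁
  have e : ∫⁻ U, Ψ U ∂percLaw d = ∫⁻ U, ∑ i,
      {U | IsFastestChild α U i}.indicator (fun U => ψ (subtree U i)) U ∂percLaw d := by
    refine lintegral_congr_ae ?_
    filter_upwards [h, ae_hasFastestChild hα₀ hα₁] with U hU ⟨i, hi, _⟩
    rw [Finset.sum_eq_single i, indicator_of_mem (show U ∈ {U | IsFastestChild α U i} from hi)]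
    · exact hU i hi
    · intro j _ hj
      exact indicator_of_notMem (fun hj' => hj (IsFastestChild.eq hj' hi)) _
    · exact fun hni => absurd (Finset.mem_univ i) hni
  have hm : ∀ i, Measurable fun U : List (Fin d) → ℝ =>
      {U | IsFastestChild α U i}.indicator (fun U => ψ (subtree U i)) U := fun i =>
    (hψ.comp (measurable_subtree i)).indicator (measurableSet_isFastestChild i)
  rw [e, lintegral_finsetSum _ fun i _ => hm i]
  simp only [lintegral_isFastestChild hfin _ hψ]
  rw [Finset.sum_const, Finset.card_univ, Fintype.card_fin, nsmul_eq_mul, ← lintegral_const_mul]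
  · refine lintegral_congr fun U => ?_
    unfold fastDensity
    ring
  · exact hψ.mul ((survival_antitone.measurable.comp
      measurable_escapeTime.ennreal_toReal).pow_const _)

theorem lintegral_initialLaw_eq_escapeTime [NeZero d] (hα₀ : 0 < α) (hα₁ : α < 1)
    {f : ℝ → ℝ≥0∞} (hf : Measurable f) : ∫⁻ w, f w ∂initialLaw d α =
      ∫⁻ U : List (Fin d) → ℝ, f (escapeTime α U).toReal *
        fastDensity d α (escapeTime α U).toReal ∂percLaw d := by
  rw [lintegral_initialLaw hf]
  refine lintegral_eq_of_isFastestChild hα₀ hα₁ (ψ := fun U => f (escapeTime α U).toReal)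
    (hf.comp measurable_escapeTime.ennreal_toReal) (Filter.Eventually.of_forall fun U i hi => ?_)
  rw [hi.backboneTime_zero hα₀]

/-- The root variable alone exceeds any level with positive probability; the density factor `a` is
thus nowhere zero. -/
theorem survival_ne_zero (v : ℝ) : survival d α v ≠ 0 := by
  have h1 : expMeasure 1 (Ioi (max v 0)) ≠ 0 := by
    rw [← compl_Iic, Ne, prob_compl_eq_zero_iff measurableSet_Iic]
    intro h
    have := cdf_expMeasure_eq one_pos (max v 0)
    rw [cdf_eq_real, measureReal_def, h, if_pos (le_max_right _ _)] at this
    have := Real.exp_pos (-(1 * max v 0))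
    simp at *
    linarith
  have h2 := (measurePreserving_root (d := d)).measure_preimage
    (s := Ioi (max v 0)) measurableSet_Ioi.nullMeasurableSet
  rw [← h2] at h1
  refine fun h0 => h1 (measure_mono_null (fun U hU => ?_) h0)
  have hU' : max v 0 < U [] := hU
  change ENNReal.ofReal v < escapeTime α U
  rw [escapeTime_eq_add]
  refine lt_of_lt_of_le ?_ le_self_add
  exact (ENNReal.ofReal_lt_ofReal_iff ((le_max_right _ _).trans_lt hU')).mpr
    ((le_max_left _ _).trans_lt hU')

/-- Up to normalization, the escape time has density e^{-v} Λ((0, v/α)). Passing to the minimum over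
the children multiplies by `fastDensity`, and tilting multiplies by e^{αv}. -/
theorem isPantographLaw_tiltedLaw [NeZero d] (hα₀ : 0 < α) (hα₁ : α < 1) :
    IsPantographLaw (tiltedLaw d α) α
      (fun v => fastDensity d α v * ENNReal.ofReal (Real.exp (-(1 - α) * v))) d (1 - α) where
  eq_withDensity := by
    have hprob := tiltedLaw_isProbabilityMeasure (d := d) hα₀ hα₁
    have hZ0 : tiltMass d α ≠ 0 := by
      intro h0
      have := lintegral_initialLaw_eq_tiltedLaw (d := d) hα₀ hα₁ (g := 1) measurable_one
      rw [h0, zero_mul] at this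
      simp at this
    have hZ := tiltMass_ne_top (d := d) hα₀ hα₁
    have hdm : Measurable (fastDensity d α) := fastDensity_antitone.measurable
    have hLm := measurable_measure_Ioo_div (tiltedLaw d α) α
    refine Measure.ext_of_lintegral _ fun f hf => ?_
    refine (ENNReal.mul_right_inj hZ0 hZ).mp ?_
    rw [tiltMass_mul_lintegral_tiltedLaw hα₀ hα₁ hf,
      lintegral_initialLaw_eq_escapeTime hα₀ hα₁ (by fun_prop),
      lintegral_escapeTime_backboneTime hα₀ hα₁
        (Φ := fun v _ => ENNReal.ofReal (Real.exp (α * v)) * f v * fastDensity d α v)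
        (by unfold Function.uncurry; fun_prop),
      lintegral_withDensity_eq_lintegral_mul _ (by fun_prop) hf,
      ← lintegral_const_mul _ (by fun_prop)]
    refine lintegral_congr fun v => ?_
    rw [setLIntegral_const, Pi.mul_apply]
    have e : ENNReal.ofReal (Real.exp (-(1 - α) * v)) =
        ENNReal.ofReal (Real.exp (-v)) * ENNReal.ofReal (Real.exp (α * v)) := by
      rw [← ENNReal.ofReal_mul (Real.exp_pos _).le, ← Real.exp_add]
      congr 2
      ring
    rw [e]
    ring
  antitone := fun v w h => by
    have h' : 0 < 1 - α := by linarith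
    dsimp only
    gcongr ?_ * ?_
    · exact fastDensity_antitone h
    · refine ENNReal.ofReal_le_ofReal (Real.exp_le_exp.mpr ?_)
      nlinarith
  ne_zero := fun v => by
    refine mul_ne_zero (mul_ne_zero ?_ (pow_ne_zero _ (survival_ne_zero v))) ?_
    · exact_mod_cast NeZero.ne d
    · simpa using Real.exp_pos _
  pos_const := by exact_mod_cast NeZero.pos d
  pos_rate := by linarith
  le_exp := fun v _ => by
    rw [ENNReal.ofReal_mul (Nat.cast_nonneg d), ENNReal.ofReal_natCast]
    gcongr
    exact mul_le_of_le_one_right zero_le (pow_le_one₀ zero_le prob_le_one)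

end InitialLaw

/-! ### The Markov property of the backbone times -/

section Backbone

variable {d : ℕ} {α : ℝ}

/-- Given the escape time `v` from the root, `W₀` has law `p(·| v)`. -/
theorem lintegral_escapeTime_stepKernel [NeZero d] (hα₀ : 0 < α) (hα₁ : α < 1)
    {χ k : ℝ → ℝ≥0∞} (hχ : Measurable χ) (hk : Measurable k) :
    ∫⁻ U : List (Fin d) → ℝ, χ (escapeTime α U).toReal * k (backboneTime α 0 U) ∂percLaw d =
      ∫⁻ U : List (Fin d) → ℝ, χ (escapeTime α U).toReal *
        ∫⁻ w, k w ∂stepKernel (tiltedLaw d α) α (escapeTime α U).toReal ∂percLaw d := by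
  have hprob := tiltedLaw_isProbabilityMeasure (d := d) hα₀ hα₁
  have hL := (isPantographLaw_tiltedLaw (d := d) hα₀ hα₁).measure_Ioo_ne_zero hα₀ hα₁
  have hK : Measurable fun v => ∫⁻ w, k w ∂stepKernel (tiltedLaw d α) α v := hk.lintegral_kernel
  rw [lintegral_escapeTime_backboneTime hα₀ hα₁ (Φ := fun v w => χ v * k w)
      (by unfold Function.uncurry; fun_prop),
    lintegral_escapeTime_backboneTime hα₀ hα₁
      (Φ := fun v _ => χ v * ∫⁻ w, k w ∂stepKernel (tiltedLaw d α) α v)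
      (by unfold Function.uncurry; fun_prop)]
  refine setLIntegral_congr_fun measurableSet_Ioi fun v hv => ?_
  have hv' : 0 < v := hv
  rw [setLIntegral_const, lintegral_const_mul _ hk, stepKernel_apply hα₀ hL hv',
    IsPantographLaw.lintegral_cond_eq, mul_assoc, mul_right_comm,
    ENNReal.inv_mul_cancel (hL _ (by positivity)) (measure_ne_top _ _), one_mul]

/-- One step of the chain from the law of `W₀` makes it stochastically smaller. -/
theorem initialLaw_Iic_le [NeZero d] (hα₀ : 0 < α) (hα₁ : α < 1) (t : ℝ) :
    initialLaw d α (Iic t) ≤ (stepKernel (tiltedLaw d α) α ∘ₘ initialLaw d α) (Iic t) := by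
  have hgm : Measurable (fastDensity d α) := fastDensity_antitone.measurable
  -- `r` is the density of F p with respect to F: F is the law of the escape time biased by
  -- `fastDensity`, a step of p from the escape time yields W₀, and the escape time is u + αW₀ with
  -- u independent.
  obtain ⟨r, hr⟩ : ∃ r : ℝ → ℝ≥0∞, r = fun w => ∫⁻ u, fastDensity d α (u + α * w) ∂expMeasure 1 :=
    ⟨_, rfl⟩
  have hranti : Antitone r := fun v w hvw => by
    rw [hr]
    exact lintegral_mono fun u => fastDensity_antitone (by gcongr)
  have hrm : Measurable r := hranti.measurable
  have key : ∀ s, MeasurableSet s →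
      (stepKernel (tiltedLaw d α) α ∘ₘ initialLaw d α) s = ∫⁻ w in s, r w ∂initialLaw d α := by
    intro s hs
    have hi : Measurable (s.indicator (1 : ℝ → ℝ≥0∞)) := measurable_one.indicator hs
    rw [← lintegral_indicator_one hs, Measure.lintegral_bind (Kernel.aemeasurable _)
        hi.aemeasurable, lintegral_initialLaw_eq_escapeTime hα₀ hα₁ hi.lintegral_kernel]
    simp only [mul_comm _ (fastDensity d α _)]
    rw [← lintegral_escapeTime_stepKernel hα₀ hα₁ hgm hi]
    simp only [backboneTime_zero_eq_childrenTime hα₀]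
    rw [lintegral_escapeTime_children hα₀ hα₁ (Φ := fun v w => fastDensity d α v *
      s.indicator 1 w) measurable_childrenTime (by unfold Function.uncurry; fun_prop)]
    simp only [← backboneTime_zero_eq_childrenTime hα₀]
    rw [← lintegral_indicator hs, lintegral_initialLaw (hrm.indicator hs)]
    refine lintegral_congr fun U => ?_
    rw [lintegral_mul_const _ (by fun_prop), hr]
    by_cases hU : backboneTime α 0 U ∈ s <;> simp [hU]
  -- As `r` is nonincreasing, either it is at least 1 on all of `Iic t`, or it is at most 1 on the
  -- complement.
  rcases le_total 1 (r t) with h | h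
  · rw [key _ measurableSet_Iic, ← setLIntegral_one]
    exact setLIntegral_mono' measurableSet_Iic fun w hw => h.trans (hranti hw)
  · have h1 : (stepKernel (tiltedLaw d α) α ∘ₘ initialLaw d α) (Iic t)ᶜ ≤
        initialLaw d α (Iic t)ᶜ := by
      rw [key _ measurableSet_Iic.compl, ← setLIntegral_one (Iic t)ᶜ]
      refine setLIntegral_mono' measurableSet_Iic.compl fun w hw => (hranti ?_).trans h
      exact (not_le.mp (show ¬w ≤ t from hw)).le
    rw [prob_compl_eq_one_sub measurableSet_Iic, prob_compl_eq_one_sub measurableSet_Iic] at h1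
    exact (ENNReal.sub_le_sub_iff_left prob_le_one ENNReal.one_ne_top).mp h1

/-- The backbone times are functions of the configurations above the children of the root. -/
theorem exists_backboneTime_eq [NeZero d] (hα₀ : 0 < α) (hα₁ : α < 1) (n : ℕ) :
    ∃ k : (Fin d → List (Fin d) → ℝ) → ℝ, Measurable k ∧
      ∀ᵐ U ∂percLaw d, backboneTime α n U = k fun i => subtree U i := by
  induction n with
  | zero =>
    exact ⟨_, measurable_childrenTime,
      Filter.Eventually.of_forall (backboneTime_zero_eq_childrenTime hα₀)⟩
  | succ n ih =>
    obtain ⟨k, hk, hkU⟩ := ih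
    let A : Fin d → Set (Fin d → List (Fin d) → ℝ) := fun i =>
      {ω | ∀ j, j ≠ i → escapeTime α (ω i) < escapeTime α (ω j)}
    have hA : ∀ i, MeasurableSet (A i) := fun i => by
      have : A i = ⋂ j, ⋂ (_ : j ≠ i), {ω | escapeTime α (ω i) < escapeTime α (ω j)} := by
        ext ω; simp [A]
      rw [this]
      exact MeasurableSet.iInter fun j => MeasurableSet.iInter fun _ =>
        measurableSet_lt (measurable_escapeTime.comp (measurable_pi_apply i))
          (measurable_escapeTime.comp (measurable_pi_apply j))
    refine ⟨fun ω => ∑ i, (A i).indicator (fun ω => k fun j => subtree (ω i) j) ω, ?_, ?_⟩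
    · refine Finset.measurable_sum _ fun i _ => Measurable.indicator (hk.comp ?_) (hA i)
      exact measurable_pi_lambda _ fun j => (measurable_subtree j).comp (measurable_pi_apply i)
    · have h' : ∀ᵐ U ∂percLaw d, ∀ i : Fin d,
          backboneTime α n (subtree U i) = k fun j => subtree (subtree U i) j :=
        ae_all_iff.mpr fun i => (measurePreserving_subtree i).quasiMeasurePreserving.ae hkU
      filter_upwards [h', ae_isRegularConfig hα₀ hα₁] with U hU hreg
      obtain ⟨i, hi, -⟩ := hreg.hasFastestChild
      rw [hreg.backboneTime_succ hα₀ hi, hU i, Finset.sum_eq_single i]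
      · exact (indicator_of_mem (show (fun i => subtree U i) ∈ A i from hi)
          (fun ω : Fin d → List (Fin d) → ℝ => k fun j => subtree (ω i) j)).symm
      · intro j _ hj
        exact indicator_of_notMem (fun hj' => hj (IsFastestChild.eq (U := U) hj' hi)) _
      · exact fun hni => absurd (Finset.mem_univ i) hni

theorem aemeasurable_backboneTime [NeZero d] (hα₀ : 0 < α) (hα₁ : α < 1) (n : ℕ) :
    AEMeasurable (fun U : List (Fin d) → ℝ => backboneTime α n U) (percLaw d) := by
  obtain ⟨k, hk, hkU⟩ := exists_backboneTime_eq (d := d) hα₀ hα₁ n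
  exact ⟨_, hk.comp (measurable_pi_lambda _ measurable_subtree), hkU⟩

/-- The joint law of `W₀` and `Wₙ`. -/
theorem lintegral_backboneTime [NeZero d] (hα₀ : 0 < α) (hα₁ : α < 1) (n : ℕ)
    {φ f : ℝ → ℝ≥0∞} (hφ : Measurable φ) (hf : Measurable f) :
    ∫⁻ U : List (Fin d) → ℝ, φ (backboneTime α 0 U) * f (backboneTime α n U) ∂percLaw d =
      ∫⁻ w, φ w * ∫⁻ x, f x ∂((stepKernel (tiltedLaw d α) α ^ n : Kernel ℝ ℝ) w)
        ∂initialLaw d α := by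
  -- The test function changes: integrating out the root variable replaces φ by the mean of φ times
  -- `fastDensity` at u + αW₀.
  induction n generalizing φ with
  | zero =>
    have e : ∀ w, ∫⁻ x, f x ∂((stepKernel (tiltedLaw d α) α ^ 0 : Kernel ℝ ℝ) w) = f w := fun w => by
      rw [pow_zero]
      exact (congrArg (fun ν => ∫⁻ x, f x ∂ν) (Kernel.id_apply w)).trans (lintegral_dirac' w hf)
    simp only [e]
    exact (lintegral_initialLaw (hφ.mul hf)).symm
  | succ n ih =>
    obtain ⟨k, hk, hkU⟩ := exists_backboneTime_eq (d := d) hα₀ hα₁ n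
    have hgm : Measurable (fastDensity d α) := fastDensity_antitone.measurable
    have hV := (measurable_escapeTime (d := d) (α := α)).ennreal_toReal
    have hχ : Measurable fun v => φ v * fastDensity d α v := hφ.mul hgm
    have hKn : Measurable fun w =>
        ∫⁻ x, f x ∂((stepKernel (tiltedLaw d α) α ^ n : Kernel ℝ ℝ) w) := hf.lintegral_kernel
    have hKn1 : Measurable fun w =>
        ∫⁻ x, f x ∂((stepKernel (tiltedLaw d α) α ^ (n + 1) : Kernel ℝ ℝ) w) := hf.lintegral_kernel
    have hφ' : Measurable fun w => ∫⁻ u, φ (u + α * w) * fastDensity d α (u + α * w)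
        ∂expMeasure 1 := by
      have : Measurable fun q : ℝ × ℝ =>
          φ (q.1 + α * q.2) * fastDensity d α (q.1 + α * q.2) := by fun_prop
      exact this.lintegral_prod_left'
    have hks : Measurable fun U : List (Fin d) → ℝ => k fun i => subtree U i :=
      hk.comp (measurable_pi_lambda _ measurable_subtree)
    have hroot : ∀ {k' : (Fin d → List (Fin d) → ℝ) → ℝ} {g : ℝ → ℝ≥0∞}, Measurable k' →
        Measurable g → ∫⁻ U : List (Fin d) → ℝ,
          φ (escapeTime α U).toReal * fastDensity d α (escapeTime α U).toReal *
            g (k' fun i => subtree U i) ∂percLaw d =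
        ∫⁻ U : List (Fin d) → ℝ, (∫⁻ u, φ (u + α * backboneTime α 0 U) *
          fastDensity d α (u + α * backboneTime α 0 U) ∂expMeasure 1) *
            g (k' fun i => subtree U i) ∂percLaw d := by
      intro k' g hk' hg
      rw [lintegral_escapeTime_children hα₀ hα₁ (Φ := fun v w => φ v * fastDensity d α v * g w) hk'
        (by unfold Function.uncurry; fun_prop)]
      refine lintegral_congr fun U => ?_
      rw [lintegral_mul_const _ (by fun_prop)]
    -- In the subtree of the fastest child, W₀ appears as the escape time and W_{n+1} as the n-th
    -- backbone time; summing over the children biases by `fastDensity`. After the induction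
    -- hypothesis the root variable is restored, and the law of W₀ given the escape time supplies
    -- the extra kernel factor.
    calc ∫⁻ U : List (Fin d) → ℝ, φ (backboneTime α 0 U) * f (backboneTime α (n + 1) U) ∂percLaw d
        = ∫⁻ U : List (Fin d) → ℝ, φ (escapeTime α U).toReal * f (k fun i => subtree U i) *
            fastDensity d α (escapeTime α U).toReal ∂percLaw d := by
          refine lintegral_eq_of_isFastestChild hα₀ hα₁
            (ψ := fun U => φ (escapeTime α U).toReal * f (k fun i => subtree U i))
            ((hφ.comp hV).mul (hf.comp hks)) ?_
          have h' : ∀ᵐ U ∂percLaw d, ∀ i : Fin d,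
              backboneTime α n (subtree U i) = k fun j => subtree (subtree U i) j :=
            ae_all_iff.mpr fun i => (measurePreserving_subtree i).quasiMeasurePreserving.ae hkU
          filter_upwards [h', ae_isRegularConfig hα₀ hα₁] with U hU hreg i hi
          rw [hreg.backboneTime_succ hα₀ hi, hU i, hi.backboneTime_zero hα₀]
      _ = ∫⁻ U : List (Fin d) → ℝ, (∫⁻ u, φ (u + α * backboneTime α 0 U) *
            fastDensity d α (u + α * backboneTime α 0 U) ∂expMeasure 1) *
              f (k fun i => subtree U i) ∂percLaw d := by
          rw [← hroot hk hf]
          refine lintegral_congr fun U => ?_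
          ring
      _ = ∫⁻ U : List (Fin d) → ℝ, (∫⁻ u, φ (u + α * backboneTime α 0 U) *
            fastDensity d α (u + α * backboneTime α 0 U) ∂expMeasure 1) *
              f (backboneTime α n U) ∂percLaw d := by
          refine lintegral_congr_ae ?_
          filter_upwards [hkU] with U hU
          rw [hU]
      _ = ∫⁻ w, (∫⁻ u, φ (u + α * w) * fastDensity d α (u + α * w) ∂expMeasure 1) *
            ∫⁻ x, f x ∂((stepKernel (tiltedLaw d α) α ^ n : Kernel ℝ ℝ) w) ∂initialLaw d α :=
          ih hφ'
      _ = ∫⁻ U : List (Fin d) → ℝ,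
            φ (escapeTime α U).toReal * fastDensity d α (escapeTime α U).toReal *
              ∫⁻ x, f x ∂((stepKernel (tiltedLaw d α) α ^ n : Kernel ℝ ℝ) (backboneTime α 0 U))
              ∂percLaw d := by
          have := hroot (k' := childrenTime α) measurable_childrenTime hKn
          simp only [← backboneTime_zero_eq_childrenTime hα₀] at this
          rw [this]
          exact lintegral_initialLaw (hφ'.mul hKn)
      _ = ∫⁻ U : List (Fin d) → ℝ,
            φ (escapeTime α U).toReal * fastDensity d α (escapeTime α U).toReal *
              ∫⁻ x, f x ∂((stepKernel (tiltedLaw d α) α ^ (n + 1) : Kernel ℝ ℝ)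
                (escapeTime α U).toReal) ∂percLaw d := by
          rw [lintegral_escapeTime_stepKernel hα₀ hα₁ hχ hKn]
          refine lintegral_congr fun U => ?_
          rw [pow_succ]
          congr 1
          exact (Kernel.lintegral_comp _ _ _ hf).symm
      _ = _ := by
          refine Eq.trans ?_ (lintegral_initialLaw_eq_escapeTime hα₀ hα₁ (hφ.mul hKn1)).symm
          refine lintegral_congr fun U => ?_
          rw [Pi.mul_apply]
          ring

/-- The backbone times form a Markov chain: the law of `Wₙ`. -/
theorem map_backboneTime [NeZero d] (hα₀ : 0 < α) (hα₁ : α < 1) (n : ℕ) :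
    (percLaw d).map (backboneTime α n) =
      (stepKernel (tiltedLaw d α) α ^ n) ∘ₘ initialLaw d α := by
  refine Measure.ext_of_lintegral _ fun f hf => ?_
  have h := lintegral_backboneTime (d := d) hα₀ hα₁ n (φ := fun _ => 1) measurable_const hf
  simp only [one_mul] at h
  rw [lintegral_map' hf.aemeasurable (aemeasurable_backboneTime hα₀ hα₁ n),
    Measure.lintegral_bind (Kernel.aemeasurable _) hf.aemeasurable]
  exact h

end Backbone

theorem corollary5p7 (d : ℕ) (hd : 1 ≤ d) (α : ℝ) (hα₀ : 0 < α) (hα₁ : α < 1) :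
    -- the coupled pair of chains, from arbitrary starting points and initial laws
    (∀ θ : ℝ, 0 < θ → ∃ c : ℝ, 0 < c ∧ ∃ lam : ℝ, 0 < lam ∧
      ∀ (n : ℕ) (w₁ w₂ : ℝ), 0 < w₁ → 0 < w₂ →
        chainLaw (backbonePairKernel d α) (Measure.dirac (w₁, w₂))
            {ω | (n : ℕ∞) < couplingTime (fun k => (ω k).1) (fun k => (ω k).2)} ≤
          ENNReal.ofReal (c * ((min w₁ w₂) ^ (-θ) + 1) * Real.exp (-lam * n))) ∧
    (∀ μ : Measure (ℝ × ℝ), IsProbabilityMeasure μ → (∀ᵐ w ∂μ, 0 < w.1 ∧ 0 < w.2) →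
      ∀ᵐ ω ∂(chainLaw (backbonePairKernel d α) μ),
        couplingTime (fun k => (ω k).1) (fun k => (ω k).2) < ⊤) ∧
    -- the stationary law, the monotone coupling, and the total variation bound
    ∃ (π : Measure ℝ) (_ : IsProbabilityMeasure π),
      IsStationaryLaw d α π ∧
      (∀ π' : Measure ℝ, IsStationaryLaw d α π' → π' = π) ∧
      ∃ c : ℝ, 0 < c ∧ ∃ lam : ℝ, 0 < lam ∧
        (∃ (Ω : Type) (_ : MeasurableSpace Ω) (P : Measure Ω) (_ : IsProbabilityMeasure P)
            (W W' : ℕ → Ω → ℝ),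
          (∀ n, Measurable (W n)) ∧ (∀ n, Measurable (W' n)) ∧
          P.map (fun ω n => W n ω) = chainLaw (backboneKernel d α) (initialLaw d α) ∧
          P.map (fun ω n => W' n ω) = chainLaw (backboneKernel d α) π ∧
          (∀ᵐ ω ∂P, ∀ n, W' n ω ≤ W n ω) ∧
          (∀ᵐ ω ∂P, ∀ n : ℕ, couplingTime (fun k => W k ω) (fun k => W' k ω) ≤ n →
            W n ω = W' n ω) ∧
          (∀ n : ℕ, P {ω | (n : ℕ∞) < couplingTime (fun k => W k ω) (fun k => W' k ω)} ≤
            ENNReal.ofReal (c * Real.exp (-lam * n)))) ∧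
        (∀ n : ℕ,
          (((percLaw d).map (backboneTime α n)).toSignedMeasure -
              π.toSignedMeasure).totalVariation univ ≤
            ENNReal.ofReal (2 * c * Real.exp (-lam * n))) := by
  have hd0 : NeZero d := ⟨by omega⟩
  have hprob := tiltedLaw_isProbabilityMeasure (d := d) hα₀ hα₁
  have h := isPantographLaw_tiltedLaw (d := d) hα₀ hα₁
  obtain ⟨π, hπ, hinv, ⟨K, hK, hFK, hπK⟩, hst⟩ := h.exists_stationary hα₀ hα₁
    (ae_initialLaw_pos hα₀ hα₁) (tiltMass_ne_top hα₀ hα₁) (initialLaw_le hα₀ hα₁)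
    (initialLaw_Iic_le hα₀ hα₁)
  have hπ0 : π (Iic 0) = 0 := by
    refine le_antisymm ((hπK _).trans ?_) zero_le
    rw [Measure.smul_apply, h.measure_Iic, smul_zero]
  have ae_pos : ∀ ρ : Measure ℝ, ρ (Iic 0) = 0 → ∀ᵐ w ∂ρ, 0 < w := fun ρ hρ => by
    rw [ae_iff]
    simp only [not_lt]
    exact hρ
  refine ⟨h.exists_couplingTime_bound hα₀ hα₁, fun μ _ hμ => h.ae_couplingTime_lt_top hα₀ hα₁ μ hμ,
    π, hπ, ⟨hπ, hπ0, hinv⟩, fun π' h' => ?_, ?_⟩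
  · have := h'.isProbabilityMeasure
    exact h.eq_of_invariant hα₀ hα₁ (ae_pos π hπ0) (ae_pos π' h'.measure_Iic) hinv h'.invariant
  · obtain ⟨c, hc, lam, hlam, hcoup, htv⟩ :=
      h.exists_monotone_coupling hα₀ hα₁ hK hFK hπK hinv hst
    refine ⟨c, hc, lam, hlam, hcoup, fun n => ?_⟩
    rw [Measure.toSignedMeasure_congr (map_backboneTime hα₀ hα₁ n)]
    exact htv n
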